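/- A left order on a group $G$ is a total order $<$ with $f<g\Rightarrow hf<hg$; a left invariant circular order on $G$ is a map $c:G^3\to\{0,1,-1\}$ with (1) $c(g_1,g_2,g_3)=0$ iff $g_i=g_j$ for some $i\neq j$, (2) $c(g_2,g_3,g_4)-c(g_1,g_3,g_4)+c(g_1,g_2,g_4)-c(g_1,g_2,g_3)=0$, (3) $c(hg_1,hg_2,hg_3)=c(g_1,g_2,g_3)$. Both sets carry the topology of pointwise convergence, giving spaces $LO(G)$ and $CO(G)$, and an order is isolated if it is an isolated point of this space. For $\phi\in\mathrm{Aut}(G)$ the automorphic image $\phi^*\lambda$ of a left order $\lambda$ is defined by $g<_{\phi^*\lambda}g'\iff\phi(g)<_\lambda\phi(g')$, and that of a circular order by $\phi^*c(g_1,g_2,g_3)=c(\phi(g_1),\phi(g_2),\phi(g_3))$. A homomorphism $\rho:G\to\mathrm{Homeo}_+(S^1)$, $S^1=\mathbb R/\mathbb Z$, is tight at $y\in S^1$ if the stabilizer of $y$ is trivial and the boundary points of each connected component of $S^1\setminus\overline{\rho(G)y}$ lie in $\rho(G)y$. It is called here a dynamical realization of $c\in CO(G)$ based at $y$ if it is tight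 at $y$ and $c(g_1,g_2,g_3)$ is $1$, $-1$ or $0$ according as $\rho(g_1)y,\rho(g_2)y,\rho(g_3)y$ are in anticlockwise position, in clockwise position, or not distinct. A subgroup $H$ is $c$-convex if it is trivial or, for a dynamical realization $\rho$ of $c$ based at $y$, $\rho(H)$ has a global fixed point and $\rho(G)y\cap I_H=\rho(H)y$, where $I_H$ is the component containing $y$ of the complement of the global fixed point set of $\rho(H)$. The linear part of $c$ is the largest $c$-convex subgroup. **Theorem.** (a) The braid group $B_3=\langle\sigma_1,\sigma_2\mid\sigma_1\sigma_2\sigma_1=\sigma_2\sigma_1\sigma_2\rangle$ has a countably infinite family of isolated left orders, none of which is an automorphic image of another. (b) Let $\overline G=\langle\alpha,\beta\mid\alpha^2=\beta^3=e\rangle$. Then $\overline G\cong PSL(2,\mathbb Z)$ through $\alpha\mapsto\pm\begin{pmatrix}0&-1\\1&0\end{pmatrix}$, $\beta\mapsto\pm\begin{pmatrix}1&1\\-1&0\end{pmatrix}$. Let $\omega'$ be any point of the upper half plane $\mathbb H$ with $|\omega'|=1$ and $\mathrm{Re}\,\omega'<-\tfrac12$, i.e. a point of the geodesic from $i$ through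 $\omega=(-1+\sqrt{-3})/2$ beyond $\omega$. Then there is a Fuchsian (faithful with discrete image) representation $\rho:\overline G\to PSL(2,\mathbb R)$ for which $\rho(\alpha)$ is the rotation by $\pi$ around $i$ and $\rho(\beta)$ the anticlockwise rotation by $2\pi/3$ around $\omega'$, and there are isolated circular orders $c^{(k)}\in CO(\overline G)$, one for each integer $k>0$ with $k\equiv\pm1\pmod 6$, none of which is an automorphic image of another, such that: (i) for each such $k$ there is a $k$-fold lift of $\rho$, i.e. a homomorphism $\rho^{(k)}:\overline G\to\mathrm{Homeo}_+(S^1)$ with $p_k\circ\rho^{(k)}(g)=\rho(g)\circ p_k$ for all $g$, where $p_k:S^1\to\partial\mathbb H=\mathbb R\cup\{\infty\}$ is the $k$-fold covering $t\mapsto\tan(\pi kt)$, and $\rho^{(k)}$ is a dynamical realization of $c^{(k)}$ based at each of the $k$ points $y$ with $p_k(y)=0$; (ii) the linear part of $c^{(k)}$ is $\langle(\alpha\beta)^{k}\rangle$, and for $k\neq k'$ no automorphism of $\overline G$ maps $\langle(\alpha\beta)^{k}\rangle$ onto $\langle(\alpha\beta)^{k'}\rangle$. -/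

import Mathlib

open Matrix

noncomputable section

/-! ### Left orders and left invariant circular orders -/

/-- A left order on `G`, given by its sign function: `lam g = 1` if `g` is positive, `lam g = -1` if
`g` is negative (the value at the identity is fixed to be `0`).
The order itself is `f < g ↔ lam (f⁻¹ * g) = 1`. -/
structure IsLeftOrder {G : Type*} [Group G] (lam : G → SignType) : Prop where
  eq_zero_iff : ∀ g, lam g = 0 ↔ g = 1
  mul_pos : ∀ f g, lam f = 1 → lam g = 1 → lam (f * g) = 1
  inv_eq : ∀ f, lam f⁻¹ = -lam f

/-- The space of left orders, with the topology of pointwise convergence (`SignType` is discrete). -/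
abbrev LO (G : Type*) [Group G] : Type _ := {lam : G → SignType // IsLeftOrder lam}

/-- A left invariant circular order on `G`. -/
structure IsCircularOrder {G : Type*} [Group G] (c : G → G → G → SignType) : Prop where
  eq_zero_iff : ∀ g₁ g₂ g₃, c g₁ g₂ g₃ = 0 ↔ g₁ = g₂ ∨ g₂ = g₃ ∨ g₁ = g₃
  cocycle : ∀ g₁ g₂ g₃ g₄,
    (c g₂ g₃ g₄ : ℤ) - (c g₁ g₃ g₄ : ℤ) + (c g₁ g₂ g₄ : ℤ) - (c g₁ g₂ g₃ : ℤ) = 0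
  left_inv : ∀ g₄ g₁ g₂ g₃, c (g₄ * g₁) (g₄ * g₂) (g₄ * g₃) = c g₁ g₂ g₃

/-- The space of left invariant circular orders, with the topology of pointwise convergence. -/
abbrev CO (G : Type*) [Group G] : Type _ := {c : G → G → G → SignType // IsCircularOrder c}

/-- `x` is an isolated point of the space `X`. -/
def IsIsolatedPoint {X : Type*} [TopologicalSpace X] (x : X) : Prop := IsOpen ({x} : Set X)

/-- The left order `φ^* lam`: `g < g'` for `φ^* lam` iff `φ g < φ g'` for `lam`. -/
def LO.pullback {G : Type*} [Group G] (φ : G ≃* G) (lam : LO G) : LO G :=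
  ⟨fun g => lam.1 (φ g),
    { eq_zero_iff := fun g => by rw [lam.2.eq_zero_iff]; simp
      mul_pos := fun f g hf hg => by rw [map_mul]; exact lam.2.mul_pos _ _ hf hg
      inv_eq := fun f => by rw [map_inv]; exact lam.2.inv_eq _ }⟩

/-- The circular order `φ^* c`. -/
def CO.pullback {G : Type*} [Group G] (φ : G ≃* G) (c : CO G) : CO G :=
  ⟨fun g₁ g₂ g₃ => c.1 (φ g₁) (φ g₂) (φ g₃),
    { eq_zero_iff := fun g₁ g₂ g₃ => by rw [c.2.eq_zero_iff]; simp
      cocycle := fun _ _ _ _ => c.2.cocycle _ _ _ _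
      left_inv := fun g₄ g₁ g₂ g₃ => by simp only [map_mul]; exact c.2.left_inv _ _ _ _ }⟩

/-! ### Actions on the circle, dynamical realizations, linear parts -/

/-- The group of orientation preserving homeomorphisms of the circle `ℝ / ℤ`, i.e. those preserving
the (anticlockwise) cyclic order. -/
def HomeoPlus : Subgroup (UnitAddCircle ≃ₜ UnitAddCircle) where
  carrier := {f | ∀ x y z, btw (f x) (f y) (f z) ↔ btw x y z}
  one_mem' := fun _ _ _ => Iff.rfl
  mul_mem' := fun {f g} hf hg x y z => (hf (g x) (g y) (g z)).trans (hg x y z)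
  inv_mem' := fun {f} hf x y z => by
    have h := hf (f⁻¹ x) (f⁻¹ y) (f⁻¹ z)
    have e : ∀ w, f (f⁻¹ w) = w := fun w => f.apply_symm_apply w
    rw [e, e, e] at h
    exact h.symm

open Classical in
/-- The sign of a triple of points of the circle: `1` if it is positioned anticlockwise, `-1` if it
is positioned clockwise, `0` if two of the points coincide. -/
def circleSign (x y z : UnitAddCircle) : SignType :=
  if sbtw x y z then 1 else if sbtw z y x then -1 else 0

section
variable {G : Type*} [Group G]

/-- The orbit of `y` under a subgroup `H`. -/
def subgroupOrbit (ρ : G →* HomeoPlus) (y : UnitAddCircle) (H : Subgroup G) : Set UnitAddCircle :=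
  {x | ∃ g ∈ H, x = (ρ g).1 y}

/-- The set of global fixed points of a subgroup `H`. -/
def globalFix (ρ : G →* HomeoPlus) (H : Subgroup G) : Set UnitAddCircle :=
  {x | ∀ g ∈ H, (ρ g).1 x = x}

/-- Tightness at `y`: the action is free at `y`, and the boundary points of any component of the
complement of the closure of the orbit of `y` belong to the orbit. -/
def IsTightAt (ρ : G →* HomeoPlus) (y : UnitAddCircle) : Prop :=
  (∀ g, (ρ g).1 y = y → g = 1) ∧
  ∀ x ∈ (closure (subgroupOrbit ρ y ⊤))ᶜ,
    frontier (connectedComponentIn (closure (subgroupOrbit ρ y ⊤))ᶜ x) ⊆ subgroupOrbit ρ y ⊤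

/-- `ρ` is (up to an orientation and base point preserving conjugacy) the dynamical realization of
`c` based at `y`: it is tight at `y` and `c` is the natural circular order of the orbit of `y`. -/
def IsDynamicalRealization (c : CO G) (ρ : G →* HomeoPlus) (y : UnitAddCircle) : Prop :=
  IsTightAt ρ y ∧
  ∀ g₁ g₂ g₃, c.1 g₁ g₂ g₃ = circleSign ((ρ g₁).1 y) ((ρ g₂).1 y) ((ρ g₃).1 y)

/-- `H` is `c`-convex: it is trivial or, for a dynamical realization `ρ` of `c` based at `y`, it acts
with global fixed points and the points of the `G`-orbit of `y` lying in the component `I_H` of `y`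
in the complement of the global fixed point set are exactly those of the `H`-orbit of `y`. -/
def CO.IsConvex (c : CO G) (H : Subgroup G) : Prop :=
  H = ⊥ ∨ ∃ (ρ : G →* HomeoPlus) (y : UnitAddCircle), IsDynamicalRealization c ρ y ∧
    (globalFix ρ H).Nonempty ∧
    subgroupOrbit ρ y ⊤ ∩ connectedComponentIn (globalFix ρ H)ᶜ y = subgroupOrbit ρ y H

/-- `L` is the linear part of `c`, i.e. the largest `c`-convex subgroup. -/
def CO.IsLinearPart (c : CO G) (L : Subgroup G) : Prop :=
  IsGreatest {H : Subgroup G | c.IsConvex H} L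

end

/-! ### The groups -/

/-- The braid group `B₃ = ⟨σ₁, σ₂ ∣ σ₁σ₂σ₁ = σ₂σ₁σ₂⟩`. -/
abbrev B3 : Type :=
  PresentedGroup ({FreeGroup.of 0 * FreeGroup.of 1 * FreeGroup.of 0 *
    (FreeGroup.of 1 * FreeGroup.of 0 * FreeGroup.of 1)⁻¹} : Set (FreeGroup (Fin 2)))

/-- The group `⟨α, β ∣ α² = β³ = e⟩`. -/
abbrev GBar : Type :=
  PresentedGroup ({FreeGroup.of 0 ^ 2, FreeGroup.of 1 ^ 3} : Set (FreeGroup (Fin 2)))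

/-- The generator `α`. -/
def gα : GBar := PresentedGroup.of 0

/-- The generator `β`. -/
def gβ : GBar := PresentedGroup.of 1

/-- `PSL(2, R)`. -/
abbrev PSL2 (R : Type) [CommRing R] : Type := ProjectiveSpecialLinearGroup (Fin 2) R

/-- The matrix `[[0, -1], [1, 0]]`. -/
def matα : SpecialLinearGroup (Fin 2) ℤ := ⟨!![0, -1; 1, 0], by simp [det_fin_two]⟩

/-- The matrix `[[1, 1], [-1, 0]]`. -/
def matβ : SpecialLinearGroup (Fin 2) ℤ := ⟨!![1, 1; -1, 0], by simp [det_fin_two]⟩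

/-- The class of a matrix of `SL(2, R)` in `PSL(2, R)`. -/
def toPSL2 {R : Type} [CommRing R] : SpecialLinearGroup (Fin 2) R →* PSL2 R :=
  QuotientGroup.mk' (Subgroup.center (SpecialLinearGroup (Fin 2) R))

/-! ### Fuchsian representations and their lifts to the boundary circle -/

/-- A matrix of the hyperbolic rotation of the upper half plane around `z` by the angle `θ`
(anticlockwise): it fixes `z`, with derivative `exp (i θ)` there. -/
def rotMatrix (z : UpperHalfPlane) (θ : ℝ) : SpecialLinearGroup (Fin 2) ℝ :=
  ⟨!![Real.cos (θ / 2) - Real.sin (θ / 2) * (z.re / z.im),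
      Real.sin (θ / 2) * ((z.re ^ 2 + z.im ^ 2) / z.im);
      -(Real.sin (θ / 2) / z.im),
      Real.cos (θ / 2) + Real.sin (θ / 2) * (z.re / z.im)], by
    have hz := z.im_ne_zero
    have h := Real.sin_sq_add_cos_sq (θ / 2)
    rw [det_fin_two_of]
    field_simp
    linear_combination z.im ^ 2 * h⟩

/-- The hyperbolic rotation around `z` by the angle `θ`, as an element of `PSL(2, ℝ)`. -/
def hypRotation (z : UpperHalfPlane) (θ : ℝ) : PSL2 ℝ := toPSL2 (rotMatrix z θ)

/-- A representation in `PSL(2, ℝ)` is Fuchsian if it is faithful with discrete image. -/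
def IsFuchsian {G : Type*} [Group G] (ρ : G →* PSL2 ℝ) : Prop :=
  Function.Injective ρ ∧ DiscreteTopology ρ.range

/-- The boundary `∂ℍ = ℝ ∪ {∞}` of the upper half plane, as the projective line on which `PSL(2, ℝ)`
acts by linear fractional transformations; `x ∈ ℝ` is `[x : 1]` and `∞` is `[1 : 0]`. -/
abbrev BdH : Type := Projectivization ℝ (Fin 2 → ℝ)

/-- The point `tan (π t) = [sin (π t) : cos (π t)]` of `∂ℍ`. -/
def tanPt (t : ℝ) : BdH :=
  Projectivization.mk ℝ ![Real.sin (Real.pi * t), Real.cos (Real.pi * t)] (by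
    intro h
    have h0 : Real.sin (Real.pi * t) = 0 := by simpa using congrFun h 0
    have h1 : Real.cos (Real.pi * t) = 0 := by simpa using congrFun h 1
    have h2 := Real.sin_sq_add_cos_sq (Real.pi * t)
    rw [h0, h1] at h2
    norm_num at h2)

theorem tanPt_periodic : Function.Periodic tanPt (1 : ℝ) := by
  intro t
  unfold tanPt
  rw [Projectivization.mk_eq_mk_iff']
  refine ⟨-1, ?_⟩
  ext i
  fin_cases i <;> simp [mul_add]

/-- The orientation preserving identification `t ↦ tan (π t)` of the circle `ℝ / ℤ` with `∂ℍ`. -/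
def circleToBdH : UnitAddCircle → BdH := tanPt_periodic.lift

/-- The `k`-fold covering map `p_k` from the circle onto `∂ℍ`. -/
def kCover (k : ℕ) (x : UnitAddCircle) : BdH := circleToBdH (k • x)

/-- The base point `y₀ = 0 ∈ ℝ ⊂ ∂ℍ`. -/
def basePt : BdH := Projectivization.mk ℝ ![0, 1] (by
  intro h
  have h1 := congrFun h 1
  simp at h1)

/-- `ρk` is a `k`-fold lift of the action of `ρ` on `∂ℍ` (for `k = 1`: this action itself). -/
def IsKFoldLift {G : Type*} [Group G] (ρ : G →* PSL2 ℝ) (k : ℕ) (ρk : G →* HomeoPlus) : Prop :=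
  ∀ g x, kCover k ((ρk g).1 x) = ρ g • kCover k x

/-- The positive integers congruent to `1` or `-1` modulo `6`. -/
def admissible : Set ℕ := {k | 0 < k ∧ ((k : ℤ) ≡ 1 [ZMOD 6] ∨ (k : ℤ) ≡ -1 [ZMOD 6])}

end

/-! The braid group is ⟨x, y ∣ x² = y³⟩ with t = x² central and quotient the modular group. In the
boundary coordinate θ ↦ tan(πθ) the rotations around i and ω' lift to X, the translation by 1/2, and
Y, with X² = Y³ the translation by 1; so the braid group acts on the line (`rep₀`). Everything rests
on the inequality 1/2 < Y(0) (`half_lt_Y_zero`), which holds because ω' lies beyond ω. It makes E =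
X⁻¹Y and F = X⁻¹Y² play ping-pong on [0, 1/2]: 0 < E(0) < E(1/2) < F(0) < F(1/2) < 1/2. Together
with the normal forms x^m u and x^m u x, where u is a positive word in e and f, this locates the
orbit of 0: the action is free there, and 0 is isolated in its orbit. Faithfulness and discreteness
of the Fuchsian representation follow.

Adding to `rep₀ g` the translation by n · deg g gives further actions (`rep`), in which t translates
by 6n + 1. The sign of `rep n g 0` is a left order. Finitely many inequalities between the orbit
points `lo n j`, `hi n j`, plus positivity of `least n`, let the ping-pong run inside any left order
satisfying them and decide the sign of every element (`exists_position`); hence the order is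
isolated. Its least positive element projects to (αβ)^|6n+1|, and exponents of powers of αβ are
controlled by the centralizers of unipotents in PSL(2, ℤ) (`dvd_of_pow_eq`). This separates the
orders up to automorphism.

Rescaling the line by |6n + 1| makes t act trivially on the circle, which gives the lift of degree
|6n + 1| and the circular order `circOrd n`; every k ≡ ±1 mod 6 is such a degree. Tightness holds
because long words contract [0, 1/2], so that a limit point outside the orbit is approached from
both sides (`exists_orb_near`). For isolation, a circular order c defines a central extension by ℤ;
the braid group maps to it and pulls back its left order. On the open set where the cocycle has a
given value at (β, β) this passage is continuous and injective, and it sends `circOrd n` to `leftOrd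
n`.

The fixed points ±`fix` of E bound an interval that meets the orbit of 0 only in the points E^i(0);
this makes ⟨(αβ)^k⟩ convex. A convex subgroup that is not contained in it would contain enough words
to generate the whole group, including the involution α, although a convex subgroup contains no
involution. So ⟨(αβ)^k⟩ is the linear part, and the linear parts tell the circular orders apart. -/

noncomputable section

/-! ### The braid group as the amalgam `⟨x, y ∣ x² = y³⟩` -/

namespace B3

/-- The element `x = σ₁σ₂σ₁`. -/
def x : B3 := PresentedGroup.of 0 * PresentedGroup.of 1 * PresentedGroup.of 0

/-- The element `y = σ₁σ₂`. -/
def y : B3 := PresentedGroup.of 0 * PresentedGroup.of 1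

/-- The generator `t = x² = y³` of the centre. -/
def t : B3 := x ^ 2

/-- The element `e = x⁻¹y`. -/
def e : B3 := x⁻¹ * y

/-- The element `f = x⁻¹y²`. -/
def f : B3 := x⁻¹ * y ^ 2

theorem braid_rel : (PresentedGroup.of 0 * PresentedGroup.of 1 * PresentedGroup.of 0 : B3) =
    PresentedGroup.of 1 * PresentedGroup.of 0 * PresentedGroup.of 1 := by
  have h := PresentedGroup.one_of_mem (rels := ({FreeGroup.of 0 * FreeGroup.of 1 * FreeGroup.of 0 *
    (FreeGroup.of 1 * FreeGroup.of 0 * FreeGroup.of 1)⁻¹} : Set (FreeGroup (Fin 2))))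
    (Set.mem_singleton _)
  rw [map_mul, map_inv, mul_inv_eq_one] at h
  simp only [map_mul] at h
  exact h

theorem y_cube : y ^ 3 = t := by
  have h := braid_rel
  simp only [y, t, x, pow_succ, pow_zero, one_mul]
  generalize (PresentedGroup.of 0 : B3) = a at *
  generalize (PresentedGroup.of 1 : B3) = b at *
  calc a * b * (a * b) * (a * b) = a * b * a * (b * a * b) := by group
    _ = _ := by rw [← h]

theorem of_zero : (PresentedGroup.of 0 : B3) = y⁻¹ * x := by simp only [x, y]; group

theorem of_one : (PresentedGroup.of 1 : B3) = x⁻¹ * y ^ 2 := by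
  have h := braid_rel
  simp only [x, y]
  generalize (PresentedGroup.of 0 : B3) = a at *
  generalize (PresentedGroup.of 1 : B3) = b at *
  rw [eq_inv_mul_iff_mul_eq, h]
  calc b * a * b * b = (b * a * b) * b := by group
    _ = a * b * a * b := by rw [← h]
    _ = (a * b) ^ 2 := by rw [pow_two, ← mul_assoc]

theorem t_comm (g : B3) : Commute t g := by
  have hx : t ∈ Subgroup.centralizer {x, y} := by
    rw [Subgroup.mem_centralizer_iff]
    rintro g (rfl | rfl)
    · simp only [t]; group
    · rw [← y_cube]; group
  have hc : Subgroup.closure (Set.range (PresentedGroup.of : Fin 2 → B3)) = ⊤ :=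
    PresentedGroup.closure_range_of _
  have hg : g ∈ Subgroup.closure (Set.range (PresentedGroup.of : Fin 2 → B3)) := by
    rw [hc]; trivial
  rw [Subgroup.mem_centralizer_iff] at hx
  have h1 : Commute t x := (hx x (by simp)).symm
  have h2 : Commute t y := (hx y (by simp)).symm
  induction hg using Subgroup.closure_induction with
  | mem z hz =>
    obtain ⟨i, rfl⟩ := hz
    fin_cases i
    · change Commute t (PresentedGroup.of 0 : B3)
      rw [of_zero]; exact h2.inv_right.mul_right h1
    · change Commute t (PresentedGroup.of 1 : B3)
      rw [of_one]; exact h1.inv_right.mul_right (h2.pow_right 2)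
  | one => exact Commute.one_right _
  | mul a b _ _ ha hb => exact ha.mul_right hb
  | inv a _ ha => exact ha.inv_right

theorem induction_left {p : B3 → Prop} (g : B3) (one : p 1) (hx : ∀ g, p g → p (x * g))
    (hx' : ∀ g, p g → p (x⁻¹ * g)) (hy : ∀ g, p g → p (y * g)) (hy' : ∀ g, p g → p (y⁻¹ * g)) :
    p g := by
  have hc : Subgroup.closure (Set.range (PresentedGroup.of : Fin 2 → B3)) = ⊤ :=
    PresentedGroup.closure_range_of _
  have hg : g ∈ Subgroup.closure (Set.range (PresentedGroup.of : Fin 2 → B3)) := by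
    rw [hc]; trivial
  induction hg using Subgroup.closure_induction_left with
  | one => exact one
  | mul_left a ha b _ hb =>
    obtain ⟨i, rfl⟩ := ha
    fin_cases i
    · change p ((PresentedGroup.of 0 : B3) * _)
      rw [of_zero, mul_assoc]; exact hy' _ (hx _ hb)
    · change p ((PresentedGroup.of 1 : B3) * _)
      rw [of_one, mul_assoc, pow_two y, mul_assoc y]; exact hx' _ (hy _ (hy _ hb))
  | inv_mul_cancel a ha b _ hb =>
    obtain ⟨i, rfl⟩ := ha
    fin_cases i
    · change p ((PresentedGroup.of 0 : B3)⁻¹ * _)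
      rw [of_zero, _root_.mul_inv_rev y⁻¹, inv_inv, mul_assoc x⁻¹]; exact hx' _ (hy _ hb)
    · change p ((PresentedGroup.of 1 : B3)⁻¹ * _)
      rw [of_one, _root_.mul_inv_rev x⁻¹, inv_inv, mul_assoc (y ^ 2)⁻¹, pow_two y,
        _root_.mul_inv_rev y, mul_assoc y⁻¹]
      exact hy' _ (hy' _ (hx _ hb))

/-- The universal property of `⟨x, y ∣ x² = y³⟩`. -/
def lift {G : Type*} [Group G] (a b : G) (h : a ^ 2 = b ^ 3) : B3 →* G :=
  PresentedGroup.toGroup (f := ![b⁻¹ * a, a⁻¹ * b ^ 2]) (by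
    rintro r rfl
    simp only [map_mul, map_inv, FreeGroup.lift_apply_of, cons_val_zero, cons_val_one]
    rw [mul_inv_eq_one]
    have h1 : b⁻¹ * a * (a⁻¹ * b ^ 2) * (b⁻¹ * a) = a := by group
    have h2 : a⁻¹ * b ^ 2 * (b⁻¹ * a) * (a⁻¹ * b ^ 2) = a⁻¹ * b ^ 3 := by group
    rw [h1, h2, ← h]; group)

theorem lift_x {G : Type*} [Group G] (a b : G) (h : a ^ 2 = b ^ 3) : lift a b h x = a := by
  simp only [lift, x, map_mul, PresentedGroup.toGroup.of, cons_val_zero, cons_val_one]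
  group

theorem lift_y {G : Type*} [Group G] (a b : G) (h : a ^ 2 = b ^ 3) : lift a b h y = b := by
  simp only [lift, y, map_mul, PresentedGroup.toGroup.of, cons_val_zero, cons_val_one]
  group

/-- The total exponent of the generators, as a homomorphism. -/
def degHom : B3 →* Multiplicative ℤ :=
  lift (Multiplicative.ofAdd 3) (Multiplicative.ofAdd 2) rfl

/-- The total exponent of the generators. -/
def deg (g : B3) : ℤ := (degHom g).toAdd

@[simp] theorem deg_mul (g h : B3) : deg (g * h) = deg g + deg h := by simp [deg]
@[simp] theorem deg_inv (g : B3) : deg g⁻¹ = -deg g := by simp [deg]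
@[simp] theorem deg_one : deg 1 = 0 := by simp [deg]
@[simp] theorem deg_pow (g : B3) (m : ℕ) : deg (g ^ m) = m * deg g := by simp [deg]
@[simp] theorem deg_zpow (g : B3) (m : ℤ) : deg (g ^ m) = m * deg g := by simp [deg]
@[simp] theorem deg_x : deg x = 3 := by simp [deg, degHom, lift_x]
@[simp] theorem deg_y : deg y = 2 := by simp [deg, degHom, lift_y]
@[simp] theorem deg_t : deg t = 6 := by simp [t]
@[simp] theorem deg_e : deg e = -1 := by simp [e]
@[simp] theorem deg_f : deg f = 1 := by simp [f]

theorem hom_ext {G : Type*} [Group G] {φ ψ : B3 →* G} (hx : φ x = ψ x) (hy : φ y = ψ y) :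
    φ = ψ := by
  refine MonoidHom.ext fun g => ?_
  refine induction_left (p := fun g => φ g = ψ g) g (by simp) ?_ ?_ ?_ ?_ <;>
  · intro g hg; simp [hg, hx, hy]

theorem x_sq : x ^ 2 = t := rfl

theorem y_inv : y⁻¹ = t⁻¹ * y ^ 2 := by rw [← y_cube]; group

theorem x_mul_e : x * e = y := by simp [e]
theorem x_mul_f : x * f = y ^ 2 := by simp [f]
theorem y_mul_x_mul_e : y * (x * e) = x * f := by rw [x_mul_e, x_mul_f, pow_two]
theorem y_mul_x_mul_f : y * (x * f) = t := by rw [x_mul_f, ← y_cube]; group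

theorem xt_pow (m : ℤ) : t ^ m = x ^ (2 * m) := by rw [t, ← zpow_natCast, ← _root_.zpow_mul]; rfl

/-- The monoid generated by `e` and `f`. -/
def posMonoid : Submonoid B3 := Submonoid.closure {e, f}

theorem posMonoid_cases {u : B3} (hu : u ∈ posMonoid) :
    u = 1 ∨ (∃ v ∈ posMonoid, u = e * v) ∨ ∃ v ∈ posMonoid, u = f * v := by
  induction hu using Submonoid.closure_induction_left with
  | one => exact Or.inl rfl
  | mul_left a ha b hb _ =>
    rcases ha with rfl | rfl
    · exact Or.inr (Or.inl ⟨b, hb, rfl⟩)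
    · exact Or.inr (Or.inr ⟨b, hb, rfl⟩)

theorem e_mem : e ∈ posMonoid := Submonoid.subset_closure (by simp)
theorem f_mem : f ∈ posMonoid := Submonoid.subset_closure (by simp)

/-- The normal form of the elements of the braid group. -/
theorem exists_normalForm (g : B3) :
    ∃ m : ℤ, ∃ u ∈ posMonoid, g = x ^ m * u ∨ g = x ^ m * u * x := by
  -- Only left multiplication by y needs work: powers of x are absorbed into x ^ m, and y⁻¹ = x⁻²
  -- y².
  have key : ∀ g, (∃ m : ℤ, ∃ u ∈ posMonoid, g = x ^ m * u ∨ g = x ^ m * u * x) →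
      ∃ m : ℤ, ∃ u ∈ posMonoid, y * g = x ^ m * u ∨ y * g = x ^ m * u * x := by
    rintro g ⟨m, u, hu, hg⟩
    -- The rewriting rules are y = xe, y(xe) = xf and y(xf) = t. Only an odd power of x followed by
    -- the empty word leaves a stray x on the right, since yx = (xe)x.
    have red : ∃ i : ℤ, ∃ v ∈ posMonoid, y * (x ^ m * u) = x ^ i * v ∨
        (u = 1 ∧ y * (x ^ m * u) = x ^ i * v * x) := by
      have hc : ∀ l : ℤ, ∀ g : B3, x ^ (2 * l) * g = g * x ^ (2 * l) := fun l g => by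
        rw [← xt_pow]; exact ((t_comm g).zpow_left l).eq
      obtain ⟨l, rfl | rfl⟩ := Int.even_or_odd' m
      · refine ⟨2 * l + 1, e * u, mul_mem e_mem hu, Or.inl ?_⟩
        rw [← mul_assoc, ← hc, ← x_mul_e, _root_.zpow_add, zpow_one]; group
      · have h2 : y * (x ^ (2 * l + 1) * u) = x ^ (2 * l) * (y * (x * u)) := by
          rw [_root_.zpow_add, zpow_one, ← mul_assoc, ← mul_assoc, ← hc]; group
        rcases posMonoid_cases hu with rfl | ⟨v, hv, rfl⟩ | ⟨v, hv, rfl⟩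
        · refine ⟨2 * l + 1, e, e_mem, Or.inr ⟨rfl, ?_⟩⟩
          rw [h2, _root_.zpow_add, zpow_one, mul_one, mul_assoc _ x e, x_mul_e, mul_assoc (x ^ (2 * l))]
        · refine ⟨2 * l + 1, f * v, mul_mem f_mem hv, Or.inl ?_⟩
          rw [h2, _root_.zpow_add, zpow_one, ← mul_assoc x e v, ← mul_assoc y, y_mul_x_mul_e]; group
        · refine ⟨2 * l + 2, v, hv, Or.inl ?_⟩
          rw [h2, _root_.zpow_add, ← mul_assoc x f v, ← mul_assoc y, y_mul_x_mul_f, t]; group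
    obtain ⟨i, v, hv, h | ⟨rfl, h⟩⟩ := red
    · refine ⟨i, v, hv, ?_⟩
      rcases hg with rfl | rfl
      · exact Or.inl h
      · right; rw [← h]; group
    · rcases hg with rfl | rfl
      · exact ⟨i, v, hv, Or.inr h⟩
      -- The stray x meets the trailing x of g; together they form the central t, which moves to the
      -- front as x ^ 2.
      · refine ⟨i + 2, v, hv, Or.inl ?_⟩
        rw [← mul_assoc, h, mul_assoc, ← pow_two, x_sq, ← (t_comm _).eq, ← x_sq, _root_.zpow_add,
          ← mul_assoc]
        congr 1
        group
  have keyx : ∀ i : ℤ, ∀ g, (∃ m : ℤ, ∃ u ∈ posMonoid, g = x ^ m * u ∨ g = x ^ m * u * x) →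
      ∃ m : ℤ, ∃ u ∈ posMonoid, x ^ i * g = x ^ m * u ∨ x ^ i * g = x ^ m * u * x := by
    rintro i g ⟨m, u, hu, rfl | rfl⟩
    · exact ⟨i + m, u, hu, Or.inl (by group)⟩
    · exact ⟨i + m, u, hu, Or.inr (by group)⟩
  refine induction_left (p := fun g => ∃ m : ℤ, ∃ u ∈ posMonoid, g = x ^ m * u ∨ g = x ^ m * u * x)
    g ⟨0, 1, one_mem _, by simp⟩ ?_ ?_ key ?_
  · intro g hg; simpa using keyx 1 g hg
  · intro g hg; simpa using keyx (-1) g hg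
  · intro g hg
    have h := keyx (-2) _ (key _ (key _ hg))
    have h' : x ^ (-2 : ℤ) * (y * (y * g)) = y⁻¹ * g := by
      rw [y_inv, t, pow_two y]; group
    rwa [h'] at h

end B3

/-! ### The projection onto `⟨α, β ∣ α² = β³ = e⟩` -/

theorem gα_sq : gα ^ 2 = 1 := by
  have h := PresentedGroup.one_of_mem (rels := ({FreeGroup.of 0 ^ 2, FreeGroup.of 1 ^ 3} :
    Set (FreeGroup (Fin 2)))) (x := FreeGroup.of 0 ^ 2) (by simp)
  rw [map_pow] at h
  exact h

theorem gβ_cube : gβ ^ 3 = 1 := by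
  have h := PresentedGroup.one_of_mem (rels := ({FreeGroup.of 0 ^ 2, FreeGroup.of 1 ^ 3} :
    Set (FreeGroup (Fin 2)))) (x := FreeGroup.of 1 ^ 3) (by simp)
  rw [map_pow] at h
  exact h

/-- The universal property of `⟨α, β ∣ α² = β³ = e⟩`. -/
def GBar.lift {G : Type*} [Group G] (a b : G) (ha : a ^ 2 = 1) (hb : b ^ 3 = 1) : GBar →* G :=
  PresentedGroup.toGroup (f := ![a, b]) (by rintro r (rfl | rfl) <;> simp [ha, hb])

@[simp] theorem GBar.lift_α {G : Type*} [Group G] (a b : G) (ha : a ^ 2 = 1) (hb : b ^ 3 = 1) :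
    GBar.lift a b ha hb gα = a := by simp [GBar.lift, gα]

@[simp] theorem GBar.lift_β {G : Type*} [Group G] (a b : G) (ha : a ^ 2 = 1) (hb : b ^ 3 = 1) :
    GBar.lift a b ha hb gβ = b := by simp [GBar.lift, gβ]

/-- The projection of the braid group onto its quotient by the centre. -/
def B3.proj : B3 →* GBar := B3.lift gα gβ (gα_sq.trans gβ_cube.symm)

namespace B3
@[simp] theorem proj_x : proj x = gα := lift_x _ _ _
@[simp] theorem proj_y : proj y = gβ := lift_y _ _ _
@[simp] theorem proj_t : proj t = 1 := by rw [t, map_pow, proj_x, gα_sq]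
theorem gα_inv : gα⁻¹ = gα := by rw [inv_eq_iff_mul_eq_one, ← pow_two, gα_sq]
@[simp] theorem proj_e : proj e = gα * gβ := by simp [e, gα_inv]
@[simp] theorem proj_f : proj f = gα * gβ ^ 2 := by simp [f, gα_inv]

theorem proj_surjective : Function.Surjective proj := by
  rw [← MonoidHom.range_eq_top, eq_top_iff]
  have hc : Subgroup.closure (Set.range (PresentedGroup.of : Fin 2 → GBar)) = ⊤ :=
    PresentedGroup.closure_range_of _
  rw [← hc, Subgroup.closure_le]
  rintro _ ⟨i, rfl⟩
  fin_cases i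
  · exact ⟨x, proj_x⟩
  · exact ⟨y, proj_y⟩
end B3

/-! ### Lifts of projective transformations to the line -/

/-- The direction vector `(sin (π θ), cos (π θ))`. -/
def dirVec (θ : ℝ) : Fin 2 → ℝ := ![Real.sin (Real.pi * θ), Real.cos (Real.pi * θ)]

/-- The homeomorphism `F` of the line lifts the projective transformation given by `M`. -/
def IsLineLift (F : ℝ → ℝ) (M : Matrix (Fin 2) (Fin 2) ℝ) : Prop :=
  ∀ θ, ∃ r : ℝ, r ≠ 0 ∧ M *ᵥ dirVec θ = r • dirVec (F θ)

theorem IsLineLift.comp {F F' : ℝ → ℝ} {M M' : Matrix (Fin 2) (Fin 2) ℝ} (h : IsLineLift F M)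
    (h' : IsLineLift F' M') : IsLineLift (F ∘ F') (M * M') := by
  intro θ
  obtain ⟨r', hr', e'⟩ := h' θ
  obtain ⟨r, hr, e⟩ := h (F' θ)
  refine ⟨r' * r, mul_ne_zero hr' hr, ?_⟩
  rw [← mulVec_mulVec, e', mulVec_smul, e, smul_smul]; rfl

theorem IsLineLift.of_eq {F : ℝ → ℝ} {M M' : Matrix (Fin 2) (Fin 2) ℝ} (h : IsLineLift F M)
    (e : M = M') : IsLineLift F M' := e ▸ h

theorem IsLineLift.of_smul {F : ℝ → ℝ} {M : Matrix (Fin 2) (Fin 2) ℝ} {a : ℝ} (ha : a ≠ 0)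
    (h : IsLineLift F (a • M)) : IsLineLift F M := by
  intro θ
  obtain ⟨r, hr, e⟩ := h θ
  refine ⟨a⁻¹ * r, mul_ne_zero (inv_ne_zero ha) hr, ?_⟩
  rw [mul_smul, ← e, smul_mulVec, smul_smul, inv_mul_cancel₀ ha, one_smul]

theorem IsLineLift.tanPt {F : ℝ → ℝ} {M : SpecialLinearGroup (Fin 2) ℝ} (h : IsLineLift F M.1)
    (θ : ℝ) : tanPt (F θ) = toPSL2 M • tanPt θ := by
  obtain ⟨r, hr, e⟩ := h θ
  have h1 : (toPSL2 M : PSL2 ℝ) • _root_.tanPt θ = M • _root_.tanPt θ := rfl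
  rw [h1]
  unfold _root_.tanPt
  rw [Projectivization.smul_mk, Projectivization.mk_eq_mk_iff']
  refine ⟨r⁻¹, ?_⟩
  change r⁻¹ • (M.1 *ᵥ dirVec θ) = dirVec (F θ)
  rw [e, smul_smul, inv_mul_cancel₀ hr, one_smul]

/-- Translation of the line. -/
def tr (a : ℝ) : CircleDeg1Liftˣ := CircleDeg1Lift.translate (Multiplicative.ofAdd a)

@[simp] theorem tr_apply (a θ : ℝ) : tr a θ = a + θ := rfl

theorem tr_mul (a b : ℝ) : tr a * tr b = tr (a + b) := by
  rw [tr, tr, tr, ← map_mul, ofAdd_add]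

theorem tr_zero : tr 0 = 1 := by rw [tr, ofAdd_zero, map_one]

theorem tr_zpow (a : ℝ) (m : ℤ) : tr a ^ m = tr (m * a) := by
  rw [tr, tr, ← map_zpow, ← ofAdd_zsmul, zsmul_eq_mul]

theorem tr_pow (a : ℝ) (m : ℕ) : tr a ^ m = tr (m * a) := by
  rw [tr, tr, ← map_pow, ← ofAdd_nsmul, nsmul_eq_mul]

theorem deg1_ext {F F' : CircleDeg1Liftˣ} (h : ∀ θ, F θ = F' θ) : F = F' :=
  Units.ext (CircleDeg1Lift.ext h)

@[simp] theorem deg1_mul_apply (F F' : CircleDeg1Liftˣ) (θ : ℝ) : (F * F') θ = F (F' θ) := rfl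

@[simp] theorem deg1_one_apply (θ : ℝ) : (1 : CircleDeg1Liftˣ) θ = θ := rfl

theorem deg1_strictMono (F : CircleDeg1Liftˣ) : StrictMono F :=
  (CircleDeg1Lift.toOrderIso F).strictMono

theorem deg1_continuous (F : CircleDeg1Liftˣ) : Continuous F :=
  (CircleDeg1Lift.toOrderIso F).continuous

theorem tr_int_comm (m : ℤ) (F : CircleDeg1Liftˣ) : Commute (tr m) F :=
  deg1_ext fun θ => by simp [CircleDeg1Lift.map_int_add]

theorem isLineLift_tr (a : ℝ) : IsLineLift (tr a)
    !![Real.cos (Real.pi * a), Real.sin (Real.pi * a);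
      -Real.sin (Real.pi * a), Real.cos (Real.pi * a)] := by
  intro θ
  refine ⟨1, one_ne_zero, ?_⟩
  ext i
  fin_cases i
  · simp [dirVec, mulVec, dotProduct, mul_add, Real.sin_add]; ring
  · simp [dirVec, mulVec, dotProduct, mul_add, Real.cos_add]; ring

/-- The lift of the hyperbolic transformation `[[1, -κ], [-κ, 1]]` close to the identity. -/
def hypFun (κ θ : ℝ) : ℝ := θ + Real.arctan (-κ * Real.cos (2 * (Real.pi * θ)) /
  (1 - κ * Real.sin (2 * (Real.pi * θ)))) / Real.pi

theorem one_sub_mul_sin_pos {κ : ℝ} (hκ : |κ| < 1) (a : ℝ) : 0 < 1 - κ * Real.sin a := by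
  have h : |κ * Real.sin a| < 1 := by
    rw [abs_mul]
    calc |κ| * |Real.sin a| ≤ |κ| * 1 := by gcongr; exact Real.abs_sin_le_one a
      _ < 1 := by simpa using hκ
  linarith [(abs_lt.1 h).2]

/-- Against the unit vector at angle φ, its image has inner product 1 - κ sin 2φ, positive for |κ| <
1, and wedge product -κ cos 2φ; the direction therefore turns by the arctangent of the quotient. -/
theorem hypFun_dirVec {κ : ℝ} (hκ : |κ| < 1) (θ : ℝ) :
    ∃ r : ℝ, 0 < r ∧ !![1, -κ; -κ, 1] *ᵥ dirVec θ = r • dirVec (hypFun κ θ) := by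
  set φ := Real.pi * θ with hφ
  have hD := one_sub_mul_sin_pos hκ (2 * φ)
  set q := -κ * Real.cos (2 * φ) / (1 - κ * Real.sin (2 * φ)) with hq
  have hs : 0 < Real.sqrt (1 + q ^ 2) := Real.sqrt_pos.2 (by positivity)
  have hqD : q * (1 - κ * Real.sin (2 * φ)) = -κ * Real.cos (2 * φ) := by
    rw [hq]; field_simp
  have e : Real.pi * hypFun κ θ = φ + Real.arctan q := by
    simp only [hypFun, ← hφ, ← hq]; field_simp; linarith
  have hsc := Real.sin_sq_add_cos_sq φ
  rw [Real.sin_two_mul, Real.cos_two_mul] at hqD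
  refine ⟨(1 - κ * Real.sin (2 * φ)) * Real.sqrt (1 + q ^ 2), by positivity, ?_⟩
  have e1 : Real.sin (φ + Real.arctan q) * Real.sqrt (1 + q ^ 2) =
      Real.sin φ + Real.cos φ * q := by
    rw [Real.sin_add, Real.sin_arctan, Real.cos_arctan]; field_simp
  have e2 : Real.cos (φ + Real.arctan q) * Real.sqrt (1 + q ^ 2) =
      Real.cos φ - Real.sin φ * q := by
    rw [Real.cos_add, Real.sin_arctan, Real.cos_arctan]; field_simp
  ext i
  fin_cases i
  · simp only [dirVec, mulVec, dotProduct, Fin.sum_univ_two, Pi.smul_apply, smul_eq_mul, e, ← hφ]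
    simp only [of_apply, cons_val', cons_val_zero, cons_val_one, Fin.zero_eta,
      cons_val_fin_one]
    rw [mul_assoc, mul_comm (Real.sqrt _), e1, Real.sin_two_mul]
    linear_combination (-Real.cos φ) * hqD + 2 * κ * Real.cos φ * hsc
  · simp only [dirVec, mulVec, dotProduct, Fin.sum_univ_two, Pi.smul_apply, smul_eq_mul, e, ← hφ]
    simp only [of_apply, cons_val', cons_val_zero, cons_val_one, Fin.mk_one,
      cons_val_fin_one]
    rw [mul_assoc, mul_comm (Real.sqrt _), e2, Real.sin_two_mul]
    linear_combination (Real.sin φ) * hqD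

theorem abs_hypFun_sub_lt (κ θ : ℝ) : |hypFun κ θ - θ| < 1 / 2 := by
  have hpi := Real.pi_pos
  rw [hypFun, add_sub_cancel_left, abs_div, abs_of_pos hpi, div_lt_iff₀ hpi, abs_lt]
  constructor
  · linarith [Real.neg_pi_div_two_lt_arctan (-κ * Real.cos (2 * (Real.pi * θ)) /
      (1 - κ * Real.sin (2 * (Real.pi * θ))))]
  · linarith [Real.arctan_lt_pi_div_two (-κ * Real.cos (2 * (Real.pi * θ)) /
      (1 - κ * Real.sin (2 * (Real.pi * θ))))]

theorem eq_of_dirVec_eq {a b r : ℝ} (hr : 0 < r) (h : dirVec a = r • dirVec b)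
    (hab : |a - b| < 1) : a = b := by
  have h0 : Real.sin (Real.pi * a) = r * Real.sin (Real.pi * b) := congrFun h 0
  have h1 : Real.cos (Real.pi * a) = r * Real.cos (Real.pi * b) := congrFun h 1
  have hr1 : r = 1 := by
    have ha := Real.sin_sq_add_cos_sq (Real.pi * a)
    have hb := Real.sin_sq_add_cos_sq (Real.pi * b)
    have : r ^ 2 = 1 := by rw [h0, h1] at ha; linear_combination ha - r ^ 2 * hb
    nlinarith
  have hc : Real.cos (Real.pi * (a - b)) = 1 := by
    rw [mul_sub, Real.cos_sub, h0, h1, hr1]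
    linear_combination Real.sin_sq_add_cos_sq (Real.pi * b)
  have hpi := Real.pi_pos
  rw [abs_lt] at hab
  rw [Real.cos_eq_one_iff_of_lt_of_lt (by nlinarith) (by nlinarith)] at hc
  have := (mul_eq_zero.1 hc).resolve_left hpi.ne'
  linarith

/-- The two matrices multiply to the positive scalar 1 - κ², so the composite preserves oriented
directions. Each factor moves points by less than 1/2, which rules out a nonzero even translation.
-/
theorem hypFun_neg_hypFun {κ : ℝ} (hκ : |κ| < 1) (θ : ℝ) : hypFun (-κ) (hypFun κ θ) = θ := by
  obtain ⟨r, hr, e⟩ := hypFun_dirVec hκ θ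
  obtain ⟨r', hr', e'⟩ := hypFun_dirVec (κ := -κ) (by rwa [abs_neg]) (hypFun κ θ)
  have hκ2 : 0 < 1 - κ ^ 2 := by
    have := (sq_lt_one_iff_abs_lt_one κ).2 hκ
    linarith
  have hM : !![1, -(-κ); -(-κ), 1] * !![1, -κ; -κ, 1] =
      (1 - κ ^ 2) • (1 : Matrix (Fin 2) (Fin 2) ℝ) := by
    ext i j; fin_cases i <;> fin_cases j <;> simp [mul_apply] <;> ring
  symm
  refine eq_of_dirVec_eq (r := r * r' / (1 - κ ^ 2)) (by positivity) ?_ ?_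
  · have h : (1 - κ ^ 2) • dirVec θ = (r * r') • dirVec (hypFun (-κ) (hypFun κ θ)) := by
      rw [mul_smul, ← e', ← mulVec_smul, ← e, mulVec_mulVec, hM, smul_mulVec, one_mulVec]
    rw [div_eq_inv_mul, mul_smul, ← h, smul_smul, inv_mul_cancel₀ hκ2.ne', one_smul]
  · have h1 := abs_lt.1 (abs_hypFun_sub_lt κ θ)
    have h2 := abs_lt.1 (abs_hypFun_sub_lt (-κ) (hypFun κ θ))
    rw [abs_lt]; constructor <;> linarith

theorem hypFun_add_one (κ θ : ℝ) : hypFun κ (θ + 1) = hypFun κ θ + 1 := by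
  have e : 2 * (Real.pi * (θ + 1)) = 2 * (Real.pi * θ) + 2 * Real.pi := by ring
  rw [hypFun, hypFun, e, Real.cos_add_two_pi, Real.sin_add_two_pi]; ring

/-- A continuous injection of the line is strictly monotone or strictly antitone, and degree one
excludes the latter. -/
theorem hypFun_monotone {κ : ℝ} (hκ : |κ| < 1) : Monotone (hypFun κ) := by
  have hc : Continuous (hypFun κ) := by
    unfold hypFun
    refine continuous_id.add ((Real.continuous_arctan.comp ?_).div_const _)
    exact Continuous.div (by fun_prop) (by fun_prop) fun θ => (one_sub_mul_sin_pos hκ _).ne'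
  have hi : Function.Injective (hypFun κ) := 
    Function.LeftInverse.injective (hypFun_neg_hypFun hκ)
  rcases hc.strictMono_of_inj hi with h | h
  · exact h.monotone
  · have h1 := h (show (0 : ℝ) < 0 + 1 by norm_num)
    rw [hypFun_add_one] at h1
    linarith

/-- The lift of `[[1, -κ], [-κ, 1]]` as a homeomorphism. -/
def hypLift {κ : ℝ} (hκ : |κ| < 1) : CircleDeg1Liftˣ where
  val := ⟨⟨hypFun κ, hypFun_monotone hκ⟩, hypFun_add_one κ⟩
  inv := ⟨⟨hypFun (-κ), hypFun_monotone (by rwa [abs_neg])⟩, hypFun_add_one (-κ)⟩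
  val_inv := by
    ext θ
    have := hypFun_neg_hypFun (κ := -κ) (by rwa [abs_neg]) θ
    rw [neg_neg] at this
    exact this
  inv_val := by
    ext θ
    exact hypFun_neg_hypFun hκ θ

theorem isLineLift_hypLift {κ : ℝ} (hκ : |κ| < 1) :
    IsLineLift (hypLift hκ) !![1, -κ; -κ, 1] := fun θ => by
  obtain ⟨r, hr, e⟩ := hypFun_dirVec hκ θ
  exact ⟨r, hr.ne', e⟩

theorem isLineLift_hypLift_inv {κ : ℝ} (hκ : |κ| < 1) :
    IsLineLift ((hypLift hκ)⁻¹ : CircleDeg1Liftˣ) !![1, κ; κ, 1] := fun θ => by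
  obtain ⟨r, hr, e⟩ := hypFun_dirVec (κ := -κ) (by rwa [abs_neg]) θ
  rw [neg_neg] at e
  exact ⟨r, hr.ne', e⟩

/-! ### The rotations `α`, `β` and their lifts to the line -/

/-- The points of the geodesic from `i` through `ω = (-1 + √-3) / 2` beyond `ω`. -/
abbrev FarPoint : Type := {z : UpperHalfPlane // z.re ^ 2 + z.im ^ 2 = 1 ∧ z.re < -(1 / 2)}

namespace FarPoint
variable (w : FarPoint)

theorem im_pos : 0 < w.1.im := w.1.im_pos

/-- The upper right entry of the matrix of the rotation by `2π/3` around `w`. -/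
def s : ℝ := Real.sqrt 3 / 2 / w.1.im

/-- Half the difference of the diagonal entries of the matrix of the rotation by `2π/3`. -/
def p : ℝ := -(Real.sqrt 3 / 2 * (w.1.re / w.1.im))

theorem sqrt3_sq : Real.sqrt 3 ^ 2 = 3 := Real.sq_sqrt (by norm_num)

/-- This is the determinant condition on the matrix of the rotation around `w`. -/
theorem s_sq : w.s ^ 2 = w.p ^ 2 + 3 / 4 := by
  have h := w.im_pos
  have h1 := w.2.1
  rw [s, p]; field_simp
  linear_combination 4 * (1 - w.1.re ^ 2) * sqrt3_sq - 12 * h1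

theorem im_lt : w.1.im < Real.sqrt 3 / 2 := by
  have h := w.im_pos
  have h1 := w.2.1
  have h2 := w.2.2
  have h3 := sqrt3_sq
  have : 0 ≤ Real.sqrt 3 := Real.sqrt_nonneg 3
  nlinarith

theorem one_lt_s : 1 < w.s := by
  rw [s, lt_div_iff₀ w.im_pos, one_mul]; exact w.im_lt

/-- This is where `w` must lie beyond ω: at ω itself p = 1/2 and s = 1, and the matrices of E and F
would be parabolic. -/
theorem half_lt_p : 1 / 2 < w.p := by
  have h := w.im_pos
  have h2 := w.2.2
  have h3 := w.im_lt
  rw [p, ← mul_div_assoc, ← neg_div, lt_div_iff₀ h]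
  nlinarith

/-- The hyperbolic tangent of half the distance from `i` to `w`. -/
def κ : ℝ := -w.1.re / (1 + w.1.im)

theorem abs_κ_lt : |w.κ| < 1 := by
  have h := w.im_pos
  have h1 := w.2.1
  have h2 := w.2.2
  rw [κ, abs_of_nonneg (div_nonneg (by linarith) (by linarith)), div_lt_one (by linarith)]
  nlinarith

theorem rotMatrix_eq : (rotMatrix w.1 (2 * Real.pi / 3)).1 =
    !![1 / 2 + w.p, w.s; -w.s, 1 / 2 - w.p] := by
  have e : 2 * Real.pi / 3 / 2 = Real.pi / 3 := by ring
  simp only [rotMatrix, e, Real.cos_pi_div_three, Real.sin_pi_div_three, w.2.1, p, s]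
  ext i j; fin_cases i <;> fin_cases j <;> simp <;> ring

/-- The lift of the rotation `α` by `π` around `i`. -/
def X : CircleDeg1Liftˣ := tr (1 / 2)

/-- The lift of the rotation `β` by `2π/3` around `w`. -/
def Y : CircleDeg1Liftˣ := hypLift w.abs_κ_lt * tr (1 / 3) * (hypLift w.abs_κ_lt)⁻¹

theorem X_sq : X ^ 2 = tr 1 := by rw [X, tr_pow]; norm_num

theorem Y_cube : w.Y ^ 3 = tr 1 := by
  have h : tr (1 / 3) ^ 3 = tr 1 := by rw [tr_pow]; norm_num
  have h1 := (tr_int_comm 1 (hypLift w.abs_κ_lt)).eq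
  rw [Int.cast_one] at h1
  rw [Y, conj_pow, h, ← h1, mul_assoc, mul_inv_cancel, mul_one]

theorem X_apply (θ : ℝ) : X θ = θ + 1 / 2 := by rw [X, tr_apply, add_comm]
theorem X_inv_apply (θ : ℝ) : (X⁻¹ : CircleDeg1Liftˣ) θ = θ - 1 / 2 := by
  rw [X, tr, CircleDeg1Lift.translate_inv_apply]; ring

theorem isLineLift_X : IsLineLift X (rotMatrix UpperHalfPlane.I Real.pi).1 := by
  refine IsLineLift.of_eq (isLineLift_tr (1 / 2)) ?_
  ext i j; fin_cases i <;> fin_cases j <;>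
    simp [rotMatrix, ← div_eq_mul_inv, UpperHalfPlane.I_re, UpperHalfPlane.I_im]

theorem isLineLift_X_inv : IsLineLift (X⁻¹ : CircleDeg1Liftˣ) !![0, -1; 1, 0] := by
  have h := isLineLift_tr (-(1 / 2))
  have e : X⁻¹ = tr (-(1 / 2)) := deg1_ext fun θ => by
    rw [X_inv_apply, tr_apply]; ring
  rw [e]
  refine IsLineLift.of_eq h ?_
  ext i j; fin_cases i <;> fin_cases j <;> simp [← div_eq_mul_inv]

/-- The transformation [[1, -κ], [-κ, 1]] carries i to `w` along the unit circle; conjugating the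
rotation around i by it gives the rotation around `w`, up to the scalar 1 - κ². -/
theorem isLineLift_Y' : IsLineLift w.Y !![1 / 2 + w.p, w.s; -w.s, 1 / 2 - w.p] := by
  have hκ := w.abs_κ_lt
  have h := ((isLineLift_hypLift hκ).comp (isLineLift_tr (1 / 3))).comp (isLineLift_hypLift_inv hκ)
  have hκ2 : 1 - w.κ ^ 2 ≠ 0 := by
    have := (sq_lt_one_iff_abs_lt_one w.κ).2 hκ
    linarith
  refine IsLineLift.of_smul hκ2 ?_
  refine IsLineLift.of_eq h ?_
  have hi := w.im_pos
  have h1 := w.2.1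
  have hi1 : 1 + w.1.im ≠ 0 := by linarith
  have hi0 := hi.ne'
  -- Since |w| = 1, re² = (1 - im)(1 + im), so κ² = (1 - im)/(1 + im).
  have hk : w.κ ^ 2 * (1 + w.1.im) = 1 - w.1.im := by
    rw [κ]; field_simp; linear_combination h1
  have hks : (1 - w.κ ^ 2) * w.s = Real.sqrt 3 / 2 * (1 + w.κ ^ 2) := by
    rw [s]; field_simp; linear_combination -hk
  have hkp : (1 - w.κ ^ 2) * w.p = Real.sqrt 3 * w.κ := by
    have h2 : w.1.re = -w.κ * (1 + w.1.im) := by rw [κ]; field_simp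
    rw [p, h2]; field_simp; linear_combination -w.κ * hk
  ext i j
  fin_cases i <;> fin_cases j <;>
    simp [mul_apply, Real.cos_pi_div_three, Real.sin_pi_div_three,
      ← div_eq_mul_inv]
  · linear_combination -hkp
  · linear_combination -hks
  · linear_combination hks
  · linear_combination hkp

theorem isLineLift_Y : IsLineLift w.Y (rotMatrix w.1 (2 * Real.pi / 3)).1 := by
  rw [rotMatrix_eq]; exact w.isLineLift_Y'

theorem lt_Y (θ : ℝ) : θ < w.Y θ := by
  set D := hypLift w.abs_κ_lt
  have e : w.Y θ = D (tr (1 / 3) (D⁻¹ θ)) := rfl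
  rw [e, tr_apply]
  calc θ = D (D⁻¹ θ) := by simp
    _ < _ := deg1_strictMono D (by linarith)

theorem Y_Y_Y (θ : ℝ) : w.Y (w.Y (w.Y θ)) = θ + 1 := by
  have h : (w.Y ^ 3) θ = tr 1 θ := by rw [Y_cube]
  rw [tr_apply, add_comm] at h
  rw [← h]; rfl

theorem Y_zero_lt : w.Y 0 < 1 := by
  calc w.Y 0 < w.Y (w.Y (w.Y 0)) := (w.lt_Y _).trans (w.lt_Y _)
    _ = 1 := by rw [Y_Y_Y, zero_add]

/-- The rotation β sends 0 to s/(1/2 - p), which is negative because p > 1/2. Since 0 < Y(0) < 1, a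
negative tangent puts Y(0) in the second half of that interval. -/
theorem half_lt_Y_zero : 1 / 2 < w.Y 0 := by
  obtain ⟨r, hr, e⟩ := w.isLineLift_Y' 0
  have h0 : w.s = r * Real.sin (Real.pi * w.Y 0) := by simpa [dirVec] using congrFun e 0
  have h1 : 1 / 2 - w.p = r * Real.cos (Real.pi * w.Y 0) := by simpa [dirVec] using congrFun e 1
  have hpi := Real.pi_pos
  have hs := w.one_lt_s
  have hp := w.half_lt_p
  have hsin : 0 < Real.sin (Real.pi * w.Y 0) :=
    Real.sin_pos_of_pos_of_lt_pi (by nlinarith [w.lt_Y 0]) (by nlinarith [w.Y_zero_lt])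
  by_contra hc
  push Not at hc
  have hcos : 0 ≤ Real.cos (Real.pi * w.Y 0) :=
    Real.cos_nonneg_of_neg_pi_div_two_le_of_le (by nlinarith [w.lt_Y 0]) (by nlinarith)
  have hr0 : 0 < r := by
    by_contra h
    push Not at h
    nlinarith
  nlinarith

/-- The lift of `αβ` fixing an endpoint of the component of `0` in the domain of discontinuity. -/
def E : CircleDeg1Liftˣ := X⁻¹ * w.Y

/-- The lift of `αβ²` with a fixed point between `0` and `1/2`. -/
def F : CircleDeg1Liftˣ := X⁻¹ * w.Y ^ 2

theorem E_apply (θ : ℝ) : w.E θ = w.Y θ - 1 / 2 := X_inv_apply _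
theorem F_apply (θ : ℝ) : w.F θ = w.Y (w.Y θ) - 1 / 2 := X_inv_apply _

theorem isLineLift_E : IsLineLift w.E !![w.s, w.p - 1 / 2; w.p + 1 / 2, w.s] := by
  have h := isLineLift_X_inv.comp w.isLineLift_Y'
  refine IsLineLift.of_eq h ?_
  ext i j; fin_cases i <;> fin_cases j <;> simp [mul_apply]
  ring

theorem isLineLift_F : IsLineLift w.F !![w.s, w.p + 1 / 2; w.p - 1 / 2, w.s] := by
  have h := isLineLift_X_inv.comp (w.isLineLift_Y'.comp w.isLineLift_Y')
  have hs := w.s_sq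
  refine IsLineLift.of_eq h ?_
  ext i j; fin_cases i <;> fin_cases j <;> simp [mul_apply]
  · ring
  · linear_combination hs
  · linear_combination -hs
  · ring

theorem E_zero_pos : 0 < w.E 0 := by
  have := w.half_lt_Y_zero
  rw [E_apply]; linarith

/-- Here and in `F_half_lt` the inequality 1/2 < Y(0) is transported by Y and Y²; Y³ being the
translation by 1 closes the circle. -/
theorem E_half_lt_F_zero : w.E (1 / 2) < w.F 0 := by
  have := deg1_strictMono w.Y w.half_lt_Y_zero
  rw [E_apply, F_apply]; linarith

theorem F_half_lt : w.F (1 / 2) < 1 / 2 := by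
  have := deg1_strictMono w.Y (deg1_strictMono w.Y w.half_lt_Y_zero)
  rw [Y_Y_Y] at this
  rw [F_apply]; linarith

theorem F_zero_pos : 0 < w.F 0 := by
  have := deg1_strictMono w.E (show (0 : ℝ) < 1 / 2 by norm_num)
  linarith [w.E_half_lt_F_zero, w.E_zero_pos]

theorem E_half_lt : w.E (1 / 2) < 1 / 2 := by
  have := deg1_strictMono w.F (show (0 : ℝ) < 1 / 2 by norm_num)
  linarith [w.E_half_lt_F_zero, w.F_half_lt]

end FarPoint

namespace FarPoint
variable (w : FarPoint) (n : ℤ)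

/-! ### The action of the braid group on the line -/

/-- The action of the braid group on the line, lifting the action of `PSL(2, ℤ)` on the circle. -/
def rep₀ : B3 →* CircleDeg1Liftˣ := B3.lift X w.Y (X_sq.trans w.Y_cube.symm)

@[simp] theorem rep₀_x : w.rep₀ B3.x = X := B3.lift_x _ _ _
@[simp] theorem rep₀_y : w.rep₀ B3.y = w.Y := B3.lift_y _ _ _
@[simp] theorem rep₀_t : w.rep₀ B3.t = tr 1 := by rw [B3.t, map_pow, rep₀_x, X_sq]
@[simp] theorem rep₀_e : w.rep₀ B3.e = w.E := by simp [B3.e, E]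
@[simp] theorem rep₀_f : w.rep₀ B3.f = w.F := by simp [B3.f, F]

theorem rep₀_x_zpow_apply (m : ℤ) (θ : ℝ) : w.rep₀ (B3.x ^ m) θ = m / 2 + θ := by
  rw [map_zpow, rep₀_x, X, tr_zpow, tr_apply]; ring

theorem rep₀_t_zpow (m : ℤ) : w.rep₀ (B3.t ^ m) = tr m := by
  rw [map_zpow, rep₀_t, tr_zpow, mul_one]

/-- The action `rep₀` twisted by the character sending both generators to the translation by `n`. -/
def rep : B3 →* CircleDeg1Liftˣ where
  toFun g := w.rep₀ g * tr (n * B3.deg g : ℤ)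
  map_one' := by simp [tr_zero]
  map_mul' g h := by
    have h1 := (tr_int_comm (n * B3.deg g) (w.rep₀ h)).eq
    have h2 : tr (n * B3.deg (g * h) : ℤ) = tr (n * B3.deg g : ℤ) * tr (n * B3.deg h : ℤ) := by
      rw [tr_mul, B3.deg_mul]; push_cast; ring_nf
    rw [h2, map_mul, mul_assoc (w.rep₀ g) (tr _), ← mul_assoc (tr _) (w.rep₀ h), h1]
    simp only [mul_assoc]

theorem rep_apply (g : B3) (θ : ℝ) : w.rep n g θ = w.rep₀ g θ + (n * B3.deg g : ℤ) := by
  change w.rep₀ g (((n * B3.deg g : ℤ) : ℝ) + θ) = _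
  rw [CircleDeg1Lift.map_int_add, add_comm]

theorem rep_eq_rep₀ (g : B3) : w.rep n g = w.rep₀ (g * B3.t ^ (n * B3.deg g)) := by
  rw [map_mul, rep₀_t_zpow]; rfl

theorem rep_t_zpow_apply (m : ℤ) (θ : ℝ) : w.rep n (B3.t ^ m) θ = θ + ((6 * n + 1) * m : ℤ) := by
  rw [rep_apply, rep₀_t_zpow, tr_apply, B3.deg_zpow, B3.deg_t]; push_cast; ring

theorem exists_rep_eq {g : B3} (h : (6 * n + 1) ∣ B3.deg g) :
    ∃ l : ℤ, w.rep n (g * B3.t ^ l) = w.rep₀ g := by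
  obtain ⟨s, hs⟩ := h
  -- With deg g = (6n + 1)s and deg t = 6 the corrected element has degree s, so the twist
  -- translates by ns and cancels t ^ (-n s).
  refine ⟨-n * s, ?_⟩
  rw [rep_eq_rep₀, mul_assoc g, ← _root_.zpow_add]
  have : -n * s + n * B3.deg (g * B3.t ^ (-n * s)) = 0 := by
    rw [B3.deg_mul, B3.deg_zpow, B3.deg_t, hs]; ring
  rw [this, zpow_zero, mul_one]

theorem rep₀_posMonoid_mem {u : B3} (hu : u ∈ B3.posMonoid) {θ : ℝ} (hθ : θ ∈ Set.Icc 0 (1 / 2 : ℝ)) :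
    w.rep₀ u θ ∈ Set.Icc 0 (1 / 2 : ℝ) := by
  induction hu using Submonoid.closure_induction_left with
  | one => simpa using hθ
  | mul_left a ha b hb ih =>
    rcases ha with rfl | rfl
    · rw [map_mul, rep₀_e, deg1_mul_apply]
      exact ⟨w.E_zero_pos.le.trans ((deg1_strictMono w.E).monotone ih.1),
        ((deg1_strictMono w.E).monotone ih.2).trans w.E_half_lt.le⟩
    · rw [map_mul, rep₀_f, deg1_mul_apply]
      exact ⟨w.F_zero_pos.le.trans ((deg1_strictMono w.F).monotone ih.1),
        ((deg1_strictMono w.F).monotone ih.2).trans w.F_half_lt.le⟩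

/-- This is the normal form seen on the orbit: the leading power of x translates by half-integers,
the first letter of u puts the point in E[0, 1/2] or F[0, 1/2], and a trailing x only replaces the
starting point 0 by 1/2. -/
theorem orbit_cases (g : B3) : (∃ m : ℤ, g = B3.x ^ m) ∨
    ∃ m : ℤ, ∃ ζ ∈ Set.Icc (0 : ℝ) (1 / 2),
      w.rep₀ g 0 = m / 2 + w.E ζ ∨ w.rep₀ g 0 = m / 2 + w.F ζ := by
  obtain ⟨m, u, hu, h⟩ := B3.exists_normalForm g
  have key : ∀ θ ∈ Set.Icc (0 : ℝ) (1 / 2), u = 1 ∨ ∃ ζ ∈ Set.Icc (0 : ℝ) (1 / 2),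
      w.rep₀ (B3.x ^ m * u) θ = m / 2 + w.E ζ ∨ w.rep₀ (B3.x ^ m * u) θ = m / 2 + w.F ζ := by
    intro θ hθ
    rcases B3.posMonoid_cases hu with rfl | ⟨v, hv, rfl⟩ | ⟨v, hv, rfl⟩
    · exact Or.inl rfl
    · refine Or.inr ⟨w.rep₀ v θ, w.rep₀_posMonoid_mem hv hθ, Or.inl ?_⟩
      rw [map_mul, deg1_mul_apply, rep₀_x_zpow_apply, map_mul, rep₀_e, deg1_mul_apply]
    · refine Or.inr ⟨w.rep₀ v θ, w.rep₀_posMonoid_mem hv hθ, Or.inr ?_⟩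
      rw [map_mul, deg1_mul_apply, rep₀_x_zpow_apply, map_mul, rep₀_f, deg1_mul_apply]
  rcases h with rfl | rfl
  · rcases key 0 ⟨le_rfl, by norm_num⟩ with rfl | ⟨ζ, hζ, h⟩
    · exact Or.inl ⟨m, mul_one _⟩
    · exact Or.inr ⟨m, ζ, hζ, h⟩
  · rcases key (1 / 2) ⟨by norm_num, le_rfl⟩ with rfl | ⟨ζ, hζ, h⟩
    · exact Or.inl ⟨m + 1, by rw [mul_one, _root_.zpow_add, zpow_one]⟩
    · refine Or.inr ⟨m, ζ, hζ, ?_⟩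
      rwa [map_mul _ _ B3.x, rep₀_x, deg1_mul_apply, X_apply, zero_add]

theorem E_mem {ζ : ℝ} (h : ζ ∈ Set.Icc (0 : ℝ) (1 / 2)) : w.E ζ ∈ Set.Ico (w.E 0) (1 / 2) :=
  ⟨(deg1_strictMono w.E).monotone h.1,
    ((deg1_strictMono w.E).monotone h.2).trans_lt w.E_half_lt⟩

theorem F_mem {ζ : ℝ} (h : ζ ∈ Set.Icc (0 : ℝ) (1 / 2)) : w.F ζ ∈ Set.Ico (w.E 0) (1 / 2) :=
  ⟨((deg1_strictMono w.E).monotone (by norm_num)).trans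
    (w.E_half_lt_F_zero.le.trans ((deg1_strictMono w.F).monotone h.1)),
    ((deg1_strictMono w.F).monotone h.2).trans_lt w.F_half_lt⟩

theorem orbit_cases' (g : B3) : (∃ m : ℤ, g = B3.x ^ m) ∨
    ∃ m : ℤ, ∃ ζ ∈ Set.Ico (w.E 0) (1 / 2), w.rep₀ g 0 = m / 2 + ζ := by
  rcases w.orbit_cases g with h | ⟨m, ζ, hζ, h | h⟩
  · exact Or.inl h
  · exact Or.inr ⟨m, _, w.E_mem hζ, h⟩
  · exact Or.inr ⟨m, _, w.F_mem hζ, h⟩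

/-- An orbit point that does not come from a power of x lies strictly between consecutive
half-integers, so it cannot be an integer. -/
theorem eq_t_zpow_of_rep₀ {g : B3} {l : ℤ} (h : w.rep₀ g 0 = l) : g = B3.t ^ l := by
  rcases w.orbit_cases' g with ⟨m, rfl⟩ | ⟨m, ζ, hζ, h'⟩
  · rw [rep₀_x_zpow_apply, add_zero, div_eq_iff two_ne_zero] at h
    have : m = 2 * l := by rw [mul_comm]; exact_mod_cast h
    rw [this, B3.xt_pow]
  · exfalso
    have h1 : w.E 0 > 0 := w.E_zero_pos
    have h2 := hζ.1
    have h3 := hζ.2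
    rw [h] at h'
    have h4 : m < 2 * l := by
      have : (m : ℝ) < 2 * l := by linarith
      exact_mod_cast this
    have h5 : 2 * l < m + 1 := by
      have : 2 * (l : ℝ) < m + 1 := by linarith
      exact_mod_cast this
    omega

/-- Removing the twist leaves an integer point, so g is a power of t; comparing degrees, with 6n + 1
≠ 0, determines which power. -/
theorem eq_t_zpow_of_rep {g : B3} {l : ℤ} (h : w.rep n g 0 = ((6 * n + 1) * l : ℤ)) :
    g = B3.t ^ l := by
  have h1 : w.rep₀ (g * B3.t ^ (-l)) 0 = (-(n * B3.deg g) + 6 * n * l : ℤ) := by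
    rw [rep_apply] at h
    rw [map_mul, rep₀_t_zpow, deg1_mul_apply, tr_apply, CircleDeg1Lift.map_int_add]
    push_cast at h ⊢
    linarith
  have h2 := w.eq_t_zpow_of_rep₀ h1
  have h3 := congrArg B3.deg h2
  rw [B3.deg_mul, B3.deg_zpow, B3.deg_zpow, B3.deg_t] at h3
  have h4 : (6 * n + 1) * (B3.deg g - 6 * l) = 0 := by linear_combination h3
  have h5 : B3.deg g - 6 * l = 0 := (mul_eq_zero.1 h4).resolve_left (by omega)
  have h6 : -(n * B3.deg g) + 6 * n * l = 0 := by linear_combination -n * h5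
  rw [h6, zpow_zero, _root_.zpow_neg, mul_inv_eq_one] at h2
  exact h2

theorem eq_one_of_rep {g : B3} (h : w.rep n g 0 = 0) : g = 1 := by
  simpa using w.eq_t_zpow_of_rep n (g := g) (l := 0) (by simpa using h)

theorem rep₀_notMem_Ioo (g : B3) : w.rep₀ g 0 ∉ Set.Ioo 0 (w.E 0) := by
  intro ⟨h1, h2⟩
  have hE : w.E 0 < 1 / 2 := (deg1_strictMono w.E (by norm_num)).trans w.E_half_lt
  rcases w.orbit_cases' g with ⟨m, rfl⟩ | ⟨m, ζ, hζ, h'⟩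
  · rw [rep₀_x_zpow_apply, add_zero] at h1 h2
    have h3 : 0 < m := by
      have : (0 : ℝ) < m := by linarith
      exact_mod_cast this
    have h4 : m < 1 := by
      have : (m : ℝ) < 1 := by linarith
      exact_mod_cast this
    omega
  · obtain ⟨h3, h4⟩ := hζ
    rw [h'] at h1 h2
    have h5 : -1 < m := by
      have : (-1 : ℝ) < m := by linarith
      exact_mod_cast this
    have h6 : m < 0 := by
      have : (m : ℝ) < 0 := by linarith
      exact_mod_cast this
    omega

/-! ### The limit set -/

/-- The orbit of `0`. -/
def orb₀ : Set ℝ := Set.range fun g => w.rep₀ g 0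

/-- The accumulation points of the orbit of `0`. -/
def lim : Set ℝ := closure w.orb₀ \ w.orb₀

theorem rep₀_mem_orb₀_iff (g : B3) (z : ℝ) : w.rep₀ g z ∈ w.orb₀ ↔ z ∈ w.orb₀ := by
  constructor
  · rintro ⟨h, hh⟩
    refine ⟨g⁻¹ * h, ?_⟩
    simp only at hh
    simp only [map_mul, deg1_mul_apply, hh, map_inv]
    exact CircleDeg1Lift.units_inv_apply_apply _ _
  · rintro ⟨h, rfl⟩
    exact ⟨g * h, by simp⟩

theorem rep₀_mem_lim {z : ℝ} (hz : z ∈ w.lim) (g : B3) : w.rep₀ g z ∈ w.lim := by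
  refine ⟨?_, fun h => hz.2 ((w.rep₀_mem_orb₀_iff g z).1 h)⟩
  refine map_mem_closure (deg1_continuous _) hz.1 fun a ha => (w.rep₀_mem_orb₀_iff g a).2 ha

theorem notMem_lim_of_isOpen {U : Set ℝ} (hU : IsOpen U) (h : Disjoint U w.orb₀) {z : ℝ} (hz : z ∈ U) :
    z ∉ w.lim := fun hl =>
  (h.closure_right hU).le_bot ⟨hz, hl.1⟩

theorem zero_mem_orb₀ : (0 : ℝ) ∈ w.orb₀ := ⟨1, by simp⟩
theorem half_mem_orb₀ : (1 / 2 : ℝ) ∈ w.orb₀ := ⟨B3.x, by simp [X_apply]⟩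

theorem E_zero_lt_of_mem_lim {z : ℝ} (hz : z ∈ w.lim) (h : 0 < z) : w.E 0 < z := by
  by_contra hc
  rcases (not_lt.1 hc).lt_or_eq with h1 | rfl
  · refine w.notMem_lim_of_isOpen isOpen_Ioo (Set.disjoint_left.2 ?_) ⟨h, h1⟩ hz
    rintro _ h2 ⟨g, rfl⟩
    exact w.rep₀_notMem_Ioo g h2
  · exact hz.2 ⟨B3.e, by simp⟩

/-- The orbit has no point in (0, E(0)), so a positive limit point lies beyond E(0). Its preimage
under E is again a positive limit point, and the argument repeats. -/
theorem E_pow_zero_lt_of_mem_lim (i : ℕ) : ∀ {z : ℝ}, z ∈ w.lim → 0 < z → (w.E ^ i) 0 < z := by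
  induction i with
  | zero => intro z _ h; simpa using h
  | succ i ih =>
    intro z hz h
    have h1 := w.E_zero_lt_of_mem_lim hz h
    have h2 := w.rep₀_mem_lim hz B3.e⁻¹
    have h3 : w.E (w.rep₀ B3.e⁻¹ z) = z := by
      rw [map_inv, rep₀_e]; exact CircleDeg1Lift.units_apply_inv_apply _ _
    have h4 : 0 < w.rep₀ B3.e⁻¹ z := by
      rw [← (deg1_strictMono w.E).lt_iff_lt, h3]; exact h1
    have h5 := deg1_strictMono w.E (ih h2 h4)
    rw [h3] at h5
    rwa [pow_succ', deg1_mul_apply]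

theorem E_inv_pow_zero_gt_of_mem_lim (i : ℕ) :
    ∀ {z : ℝ}, z ∈ w.lim → z < 0 → z < (w.E⁻¹ ^ i) 0 := by
  induction i with
  | zero => intro z _ h; simpa using h
  | succ i ih =>
    intro z hz h
    have h2 := w.rep₀_mem_lim hz B3.e
    rw [rep₀_e] at h2
    have h4 : w.E z < 0 := by
      by_contra hc
      rcases (not_lt.1 hc).lt_or_eq with h5 | h5
      · have := w.E_zero_lt_of_mem_lim h2 h5
        rw [(deg1_strictMono w.E).lt_iff_lt] at this
        linarith
      · exact h2.2 (h5 ▸ w.zero_mem_orb₀)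
    have h5 := deg1_strictMono w.E⁻¹ (ih h2 h4)
    rw [CircleDeg1Lift.units_inv_apply_apply] at h5
    rwa [pow_succ', deg1_mul_apply]

/-- All orbit points in (0, 1/2) lie in the compact set E[0, 1/2] ∪ F[0, 1/2], hence so do their
limits. The preimage ζ is an interior point because 0 and 1/2 belong to the orbit. -/
theorem exists_of_mem_lim {z : ℝ} (hz : z ∈ w.lim) (h : z ∈ Set.Ioo (0 : ℝ) (1 / 2)) :
    ∃ ζ ∈ w.lim, ζ ∈ Set.Ioo (0 : ℝ) (1 / 2) ∧ (z = w.E ζ ∨ z = w.F ζ) := by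
  have hS : IsClosed (w.E '' Set.Icc 0 (1 / 2) ∪ w.F '' Set.Icc 0 (1 / 2)) :=
    (isCompact_Icc.image (deg1_continuous _)).isClosed.union
      (isCompact_Icc.image (deg1_continuous _)).isClosed
  have hsub : Set.Ioo (0 : ℝ) (1 / 2) ∩ w.orb₀ ⊆
      w.E '' Set.Icc 0 (1 / 2) ∪ w.F '' Set.Icc 0 (1 / 2) := by
    rintro _ ⟨⟨h1, h2⟩, g, rfl⟩
    simp only at h1 h2 ⊢
    have hm : ∀ m : ℤ, ∀ ζ ∈ Set.Ico (0 : ℝ) (1 / 2), w.rep₀ g 0 = m / 2 + ζ → m = 0 := by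
      intro m ζ hζ h3
      have h4 : -1 < m := by
        have : (-1 : ℝ) < m := by linarith [hζ.2]
        exact_mod_cast this
      have h5 : m < 1 := by
        have : (m : ℝ) < 1 := by linarith [hζ.1]
        exact_mod_cast this
      omega
    have hE := w.E_zero_pos.le
    rcases w.orbit_cases g with ⟨m, rfl⟩ | ⟨m, ζ, hζ, h3 | h3⟩
    · rw [rep₀_x_zpow_apply, add_zero] at h1 h2
      have h3 : 0 < m := by
        have : (0 : ℝ) < m := by linarith
        exact_mod_cast this
      have h4 : m < 1 := by
        have : (m : ℝ) < 1 := by linarith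
        exact_mod_cast this
      omega
    · have := hm m _ (Set.Ico_subset_Ico_left hE (w.E_mem hζ)) h3
      exact Or.inl ⟨ζ, hζ, by rw [h3, this]; simp⟩
    · have := hm m _ (Set.Ico_subset_Ico_left hE (w.F_mem hζ)) h3
      exact Or.inr ⟨ζ, hζ, by rw [h3, this]; simp⟩
  have h1 := closure_minimal hsub hS (isOpen_Ioo.inter_closure ⟨h, hz.1⟩)
  have key : ∀ g : B3, ∀ ζ ∈ Set.Icc (0 : ℝ) (1 / 2), w.rep₀ g ζ = z →
      ζ ∈ w.lim ∧ ζ ∈ Set.Ioo (0 : ℝ) (1 / 2) := by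
    rintro g ζ hζ rfl
    have h2 : ζ ∈ w.lim := by
      have := w.rep₀_mem_lim hz g⁻¹
      rwa [map_inv, CircleDeg1Lift.units_inv_apply_apply] at this
    refine ⟨h2, lt_of_le_of_ne hζ.1 ?_, lt_of_le_of_ne hζ.2 ?_⟩
    · rintro rfl; exact h2.2 w.zero_mem_orb₀
    · rintro rfl; exact h2.2 w.half_mem_orb₀
  rcases h1 with ⟨ζ, hζ, h2⟩ | ⟨ζ, hζ, h2⟩
  · obtain ⟨h3, h4⟩ := key B3.e ζ hζ (by simpa using h2)
    exact ⟨ζ, h3, h4, Or.inl h2.symm⟩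
  · obtain ⟨h3, h4⟩ := key B3.f ζ hζ (by simpa using h2)
    exact ⟨ζ, h3, h4, Or.inr h2.symm⟩

end FarPoint

/-! ### Contraction by long words and two-sided accumulation -/

namespace FarPoint
variable (w : FarPoint) (n : ℤ)

/-- The matrices of long words in `E` and `F` have large lower entries. -/
def HasGrowth (m : ℕ) (u : B3) : Prop :=
  ∃ M : Matrix (Fin 2) (Fin 2) ℝ, IsLineLift (w.rep₀ u) M ∧ M.det = 1 ∧
    (w.p - 1 / 2) * w.s ^ m ≤ M 1 0 ∧ (w.p - 1 / 2) * w.s ^ m ≤ M 1 1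

theorem p_lt_s : w.p < w.s := by
  have h := w.s_sq
  have h1 := w.half_lt_p
  have h2 := w.one_lt_s
  nlinarith

/-- The count starts at 0 for a single letter, so growth m is attained by words of m + 1 letters. -/
theorem hasGrowth_e : w.HasGrowth 0 B3.e := by
  refine ⟨_, by rw [rep₀_e]; exact w.isLineLift_E, ?_, ?_, ?_⟩
  · rw [det_fin_two_of]; linear_combination w.s_sq
  · simp; linarith
  · simp; linarith [w.p_lt_s]

theorem hasGrowth_f : w.HasGrowth 0 B3.f := by
  refine ⟨_, by rw [rep₀_f]; exact w.isLineLift_F, ?_, ?_, ?_⟩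
  · rw [det_fin_two_of]; linear_combination w.s_sq
  · simp
  · simp; linarith [w.p_lt_s]

/-- The matrix of a letter has diagonal entries s and positive off-diagonal entries, so right
multiplication increases a positive bottom row by a factor of at least s. -/
theorem HasGrowth.mul_e {w : FarPoint} {m : ℕ} {u : B3} (h : w.HasGrowth m u) :
    w.HasGrowth (m + 1) (u * B3.e) := by
  obtain ⟨M, h1, h2, h3, h4⟩ := h
  have hs := w.one_lt_s
  have hp := w.half_lt_p
  have hpos : 0 < (w.p - 1 / 2) * w.s ^ m := mul_pos (by linarith) (by positivity)
  refine ⟨M * !![w.s, w.p - 1 / 2; w.p + 1 / 2, w.s], ?_, ?_, ?_, ?_⟩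
  · rw [map_mul, rep₀_e]; exact h1.comp w.isLineLift_E
  · rw [det_mul, h2, det_fin_two_of]; linear_combination w.s_sq
  · simp only [mul_apply, Fin.sum_univ_two, pow_succ]; simp
    nlinarith
  · simp only [mul_apply, Fin.sum_univ_two, pow_succ]; simp
    nlinarith

theorem HasGrowth.mul_f {w : FarPoint} {m : ℕ} {u : B3} (h : w.HasGrowth m u) :
    w.HasGrowth (m + 1) (u * B3.f) := by
  obtain ⟨M, h1, h2, h3, h4⟩ := h
  have hs := w.one_lt_s
  have hp := w.half_lt_p
  have hpos : 0 < (w.p - 1 / 2) * w.s ^ m := mul_pos (by linarith) (by positivity)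
  refine ⟨M * !![w.s, w.p + 1 / 2; w.p - 1 / 2, w.s], ?_, ?_, ?_, ?_⟩
  · rw [map_mul, rep₀_f]; exact h1.comp w.isLineLift_F
  · rw [det_mul, h2, det_fin_two_of]; linear_combination w.s_sq
  · simp only [mul_apply, Fin.sum_univ_two, pow_succ]; simp
    nlinarith
  · simp only [mul_apply, Fin.sum_univ_two, pow_succ]; simp
    nlinarith

/-- The columns of M are the images of the directions at 1/2 and 0. The determinant, which is 1, is
the product of their norms with the sine of the angle between them; norms that grow like s ^ m force
a small angle. -/
theorem HasGrowth.length_le {w : FarPoint} {m : ℕ} {u : B3} (h : w.HasGrowth m u)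
    (hu : u ∈ B3.posMonoid) :
    2 * (w.rep₀ u (1 / 2) - w.rep₀ u 0) ≤ ((w.p - 1 / 2) ^ 2 * w.s ^ (2 * m))⁻¹ := by
  obtain ⟨M, h1, h2, h3, h4⟩ := h
  have hs := w.one_lt_s
  have hp := w.half_lt_p
  have hpos : 0 < (w.p - 1 / 2) * w.s ^ m := mul_pos (by linarith) (by positivity)
  obtain ⟨r, hr, e⟩ := h1 0
  obtain ⟨r', hr', e'⟩ := h1 (1 / 2)
  set a := w.rep₀ u 0
  set b := w.rep₀ u (1 / 2)
  have hab : a ≤ b := (deg1_strictMono (w.rep₀ u)).monotone (by norm_num)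
  have ha := w.rep₀_posMonoid_mem hu (θ := 0) ⟨le_rfl, by norm_num⟩
  have hb := w.rep₀_posMonoid_mem hu (θ := 1 / 2) ⟨by norm_num, le_rfl⟩
  have e0 := congrFun e 0
  have e1 := congrFun e 1
  have e0' := congrFun e' 0
  have e1' := congrFun e' 1
  simp [dirVec, mulVec, dotProduct, ← div_eq_mul_inv] at e0 e1 e0' e1'
  rw [det_fin_two] at h2
  have hpi := Real.pi_pos
  -- Jordan's inequality, available because a and b lie in [0, 1/2].
  have hsin : 2 * (b - a) ≤ Real.sin (Real.pi * (b - a)) := by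
    have := Real.mul_le_sin (x := Real.pi * (b - a)) (by nlinarith) (by nlinarith [hb.2, ha.1])
    calc 2 * (b - a) = 2 / Real.pi * (Real.pi * (b - a)) := by field_simp
      _ ≤ _ := this
  have hcross : r * r' * Real.sin (Real.pi * (b - a)) = 1 := by
    rw [mul_sub, Real.sin_sub]
    rw [e0, e1, e0', e1'] at h2
    linear_combination h2
  have hA := Real.sin_sq_add_cos_sq (Real.pi * a)
  have hB := Real.sin_sq_add_cos_sq (Real.pi * b)
  have hr2 : ((w.p - 1 / 2) * w.s ^ m) ^ 2 ≤ r ^ 2 := by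
    have : r ^ 2 = (M 0 1) ^ 2 + (M 1 1) ^ 2 := by rw [e0, e1]; linear_combination -r ^ 2 * hA
    nlinarith [sq_nonneg (M 0 1)]
  have hr2' : ((w.p - 1 / 2) * w.s ^ m) ^ 2 ≤ r' ^ 2 := by
    have : r' ^ 2 = (M 0 0) ^ 2 + (M 1 0) ^ 2 := by rw [e0', e1']; linear_combination -r' ^ 2 * hB
    nlinarith [sq_nonneg (M 0 0)]
  have h5 := sq_le_sq.1 hr2
  have h6 := sq_le_sq.1 hr2'
  rw [abs_of_pos hpos] at h5 h6
  have h7 : ((w.p - 1 / 2) * w.s ^ m) * ((w.p - 1 / 2) * w.s ^ m) ≤ |r * r'| := by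
    rw [abs_mul]; exact mul_le_mul h5 h6 hpos.le (abs_nonneg r)
  have h8 : ((w.p - 1 / 2) * w.s ^ m) * ((w.p - 1 / 2) * w.s ^ m) =
      (w.p - 1 / 2) ^ 2 * w.s ^ (2 * m) := by ring
  rw [h8] at h7
  have h9 : 0 < (w.p - 1 / 2) ^ 2 * w.s ^ (2 * m) := by rw [← h8]; positivity
  have h10 : |r * r'| * |Real.sin (Real.pi * (b - a))| = 1 := by rw [← abs_mul, hcross, abs_one]
  refine hsin.trans ((le_abs_self _).trans ?_)
  rw [← one_div, le_div_iff₀ h9]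
  nlinarith [abs_nonneg (Real.sin (Real.pi * (b - a)))]

/-- Words of length `m` contract `[0, 1/2]` uniformly. -/
theorem exists_length_lt {ε : ℝ} (hε : 0 < ε) : ∃ m, ∀ u ∈ B3.posMonoid, w.HasGrowth m u →
    w.rep₀ u (1 / 2) - w.rep₀ u 0 < ε := by
  have hs := w.one_lt_s
  have hp := w.half_lt_p
  have hc0 : 0 < w.p - 1 / 2 := by linarith
  have hc : 0 < (w.p - 1 / 2) ^ 2 := by positivity
  obtain ⟨m, hm⟩ := pow_unbounded_of_one_lt (((w.p - 1 / 2) ^ 2 * ε)⁻¹) hs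
  refine ⟨m, fun u hu h => ?_⟩
  have h1 := h.length_le hu
  have h2 : w.s ^ m ≤ w.s ^ (2 * m) := pow_le_pow_right₀ hs.le (by omega)
  have h3 : ((w.p - 1 / 2) ^ 2 * w.s ^ (2 * m))⁻¹ < ε := by
    rw [inv_lt_comm₀ (by positivity) hε]
    calc ε⁻¹ = (w.p - 1 / 2) ^ 2 * (((w.p - 1 / 2) ^ 2 * ε)⁻¹) := by
          rw [_root_.mul_inv, ← mul_assoc, mul_inv_cancel₀ hc.ne', one_mul]
      _ < (w.p - 1 / 2) ^ 2 * w.s ^ (2 * m) := by gcongr; exact hm.trans_le h2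
  have h4 := (deg1_strictMono (w.rep₀ u)).monotone (show (0 : ℝ) ≤ 1 / 2 by norm_num)
  linarith

theorem exists_growth_of_mem_lim {z : ℝ} (hz : z ∈ w.lim) (h : z ∈ Set.Ioo (0 : ℝ) (1 / 2)) (m : ℕ) :
    ∃ u ∈ B3.posMonoid, w.HasGrowth m u ∧ ∃ ζ ∈ w.lim, ζ ∈ Set.Ioo (0 : ℝ) (1 / 2) ∧
      z = w.rep₀ u ζ := by
  induction m with
  | zero =>
    obtain ⟨ζ, h1, h2, h3 | h3⟩ := w.exists_of_mem_lim hz h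
    · exact ⟨B3.e, B3.e_mem, w.hasGrowth_e, ζ, h1, h2, by rw [rep₀_e, h3]⟩
    · exact ⟨B3.f, B3.f_mem, w.hasGrowth_f, ζ, h1, h2, by rw [rep₀_f, h3]⟩
  | succ m ih =>
    obtain ⟨u, hu, hg, ζ', h1', h2', h3'⟩ := ih
    obtain ⟨ζ, h1, h2, h3 | h3⟩ := w.exists_of_mem_lim h1' h2'
    · exact ⟨u * B3.e, mul_mem hu B3.e_mem, hg.mul_e, ζ, h1, h2, by
        rw [map_mul, rep₀_e, deg1_mul_apply, ← h3, h3']⟩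
    · exact ⟨u * B3.f, mul_mem hu B3.f_mem, hg.mul_f, ζ, h1, h2, by
        rw [map_mul, rep₀_f, deg1_mul_apply, ← h3, h3']⟩

theorem exists_rep₀_of_mem_lim {z ε : ℝ} (hz : z ∈ w.lim) (hε : 0 < ε) :
    ∃ v : B3, ∃ ζ ∈ w.lim, ζ ∈ Set.Ioo (0 : ℝ) (1 / 2) ∧ z = w.rep₀ v ζ ∧
      w.rep₀ v (1 / 2) - w.rep₀ v 0 < ε := by
  set m : ℤ := ⌊2 * z⌋ with hm
  have h1 := Int.floor_le (2 * z)
  have h2 := Int.lt_floor_add_one (2 * z)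
  rw [← hm] at h1 h2
  set z' := w.rep₀ (B3.x ^ (-m)) z with hz'
  have hlim := w.rep₀_mem_lim hz (B3.x ^ (-m))
  rw [← hz'] at hlim
  have e : z' = z - m / 2 := by rw [hz', rep₀_x_zpow_apply]; push_cast; ring
  have hI : z' ∈ Set.Ioo (0 : ℝ) (1 / 2) := by
    refine ⟨lt_of_le_of_ne (by linarith) ?_, by linarith⟩
    intro h
    exact hlim.2 (h ▸ w.zero_mem_orb₀)
  obtain ⟨M, hM⟩ := w.exists_length_lt hε
  obtain ⟨u, hu, hg, ζ, h3, h4, h5⟩ := w.exists_growth_of_mem_lim hlim hI M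
  refine ⟨B3.x ^ m * u, ζ, h3, h4, ?_, ?_⟩
  · rw [map_mul, deg1_mul_apply, ← h5, rep₀_x_zpow_apply]; linarith
  · simp only [map_mul, deg1_mul_apply, rep₀_x_zpow_apply]
    linarith [hM u hu hg]

theorem E_pow_zero_nonneg (i : ℕ) : 0 ≤ (w.E ^ i) 0 := by
  induction i with
  | zero => simp
  | succ i ih =>
    rw [pow_succ', deg1_mul_apply]
    exact w.E_zero_pos.le.trans ((deg1_strictMono w.E).monotone ih)

theorem E_inv_pow_zero_nonpos (i : ℕ) : (w.E⁻¹ ^ i) 0 ≤ 0 := by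
  induction i with
  | zero => simp
  | succ i ih =>
    rw [pow_succ', deg1_mul_apply]
    have h := (deg1_strictMono w.E⁻¹).monotone (ih.trans w.E_zero_pos.le)
    rwa [CircleDeg1Lift.units_inv_apply_apply] at h

/-- The orbit of `0` under the twisted action. -/
def orb : Set ℝ := Set.range fun g => w.rep n g 0

theorem orb_subset : w.orb n ⊆ w.orb₀ := by
  rintro _ ⟨g, rfl⟩
  exact ⟨g * B3.t ^ (n * B3.deg g), by simp only [rep_eq_rep₀]⟩

theorem mem_orb_of_dvd {g : B3} (h : (6 * n + 1) ∣ B3.deg g) : w.rep₀ g 0 ∈ w.orb n := by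
  obtain ⟨l, hl⟩ := w.exists_rep_eq n h
  exact ⟨g * B3.t ^ l, by simp only [hl]⟩

/-- The gaps next to 0 are carried around by the group, so every point of the full orbit is isolated
in it; a point of the full orbit in the closure of the twisted orbit must then be in the twisted
orbit. -/
theorem mem_lim_of_mem_closure_orb {z : ℝ} (hz : z ∈ closure (w.orb n)) (h : z ∉ w.orb n) :
    z ∈ w.lim := by
  refine ⟨closure_mono (w.orb_subset n) hz, ?_⟩
  rintro ⟨g, rfl⟩
  simp only at hz h
  set U : Set ℝ := Set.Ioo (w.rep₀ g (w.E⁻¹ 0)) (w.rep₀ g (w.E 0))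
  have hU : w.rep₀ g 0 ∈ U := by
    refine ⟨deg1_strictMono _ ?_, deg1_strictMono _ w.E_zero_pos⟩
    have := deg1_strictMono w.E⁻¹ w.E_zero_pos
    rwa [CircleDeg1Lift.units_inv_apply_apply] at this
  obtain ⟨_, ⟨h1, h2⟩, ⟨g', rfl⟩⟩ := mem_closure_iff.1 hz U isOpen_Ioo hU
  apply h
  obtain ⟨g'', hg''⟩ := w.orb_subset n ⟨g', rfl⟩
  simp only at hg''
  suffices hs : w.rep₀ g'' 0 = w.rep₀ g 0 from ⟨g', by simp only [← hs, hg'']⟩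
  simp only [← hg''] at h1 h2
  have e : w.rep₀ g'' 0 = w.rep₀ g (w.rep₀ (g⁻¹ * g'') 0) := by simp
  rw [e, (deg1_strictMono _).lt_iff_lt] at h1 h2
  rw [e]
  congr 1
  rcases lt_trichotomy (w.rep₀ (g⁻¹ * g'') 0) 0 with h3 | h3 | h3
  · exfalso
    refine w.rep₀_notMem_Ioo (B3.e * (g⁻¹ * g'')) ?_
    rw [map_mul, rep₀_e, deg1_mul_apply]
    refine ⟨?_, deg1_strictMono _ h3⟩
    have := deg1_strictMono w.E h1
    rwa [CircleDeg1Lift.units_apply_inv_apply] at this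
  · exact h3
  · exact absurd ⟨h3, h2⟩ (w.rep₀_notMem_Ioo _)

/-- An accumulation point of the orbit is accumulated from both sides. -/
theorem exists_orb_near {z ε : ℝ} (hz : z ∈ closure (w.orb n)) (h : z ∉ w.orb n) (hε : 0 < ε) :
    (∃ a ∈ w.orb n, a ∈ Set.Ioo (z - ε) z) ∧ ∃ a ∈ w.orb n, a ∈ Set.Ioo z (z + ε) := by
  obtain ⟨v, ζ, hζ, hI, rfl, hlen⟩ :=
    w.exists_rep₀_of_mem_lim (w.mem_lim_of_mem_closure_orb n hz h) hε
  have hm := deg1_strictMono (w.rep₀ v)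
  have h0 := hm hI.1
  have h1 := hm hI.2
  have hk : (1 : ℤ) ≤ (6 * n + 1) ^ 2 := by
    have : 0 < (6 * n + 1) ^ 2 := by
      have : 6 * n + 1 ≠ 0 := by omega
      positivity
    omega
  constructor
  -- The exponent is congruent to deg v modulo 6n + 1, so that v e^i has degree divisible by 6n + 1
  -- and its point lies in the twisted orbit; the square times the absolute value makes it
  -- nonnegative.
  · obtain ⟨i, hi⟩ := Int.eq_ofNat_of_zero_le
      (show 0 ≤ B3.deg v + (6 * n + 1) ^ 2 * |B3.deg v| by
        nlinarith [neg_abs_le (B3.deg v), abs_nonneg (B3.deg v)])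
    refine ⟨_, w.mem_orb_of_dvd n (g := v * B3.e ^ i) ⟨-(6 * n + 1) * |B3.deg v|, ?_⟩, ?_⟩
    · rw [B3.deg_mul, B3.deg_pow, B3.deg_e, ← hi]; ring
    · rw [map_mul, map_pow, rep₀_e, deg1_mul_apply]
      have := hm.monotone (w.E_pow_zero_nonneg i)
      exact ⟨by linarith, hm (w.E_pow_zero_lt_of_mem_lim i hζ hI.1)⟩
  -- On the right, the points E⁻ⁱ(0) + 1/2 of the orbit lie between ζ and 1/2; the 3 is the degree
  -- of the extra letter x.
  · obtain ⟨i, hi⟩ := Int.eq_ofNat_of_zero_le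
      (show 0 ≤ -(B3.deg v + 3) + (6 * n + 1) ^ 2 * |B3.deg v + 3| by
        nlinarith [le_abs_self (B3.deg v + 3), abs_nonneg (B3.deg v + 3)])
    refine ⟨_, w.mem_orb_of_dvd n (g := v * (B3.x * B3.e⁻¹ ^ i))
      ⟨(6 * n + 1) * |B3.deg v + 3|, ?_⟩, ?_⟩
    · rw [B3.deg_mul, B3.deg_mul, B3.deg_pow, B3.deg_inv, B3.deg_e, B3.deg_x, ← hi]; ring
    · have e1 : w.rep₀ (v * (B3.x * B3.e⁻¹ ^ i)) 0 = w.rep₀ v ((w.E⁻¹ ^ i) 0 + 1 / 2) := by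
        rw [map_mul, map_mul, map_pow, map_inv, rep₀_e, rep₀_x, deg1_mul_apply, deg1_mul_apply,
          X_apply]
      rw [e1]
      have h2 := w.rep₀_mem_lim hζ B3.x⁻¹
      rw [map_inv, rep₀_x, X_inv_apply] at h2
      have h3 := w.E_inv_pow_zero_gt_of_mem_lim i h2 (by linarith [hI.2])
      have := hm.monotone (show (w.E⁻¹ ^ i) 0 + 1 / 2 ≤ 1 / 2 by
        linarith [w.E_inv_pow_zero_nonpos i])
      exact ⟨hm (by linarith), by linarith⟩

end FarPoint

/-! ### Left orders as linear orders -/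

namespace IsLeftOrder
variable {G : Type*} [Group G] {lam : G → SignType} (h : IsLeftOrder lam)
include h

theorem map_one : lam 1 = 0 := (h.eq_zero_iff 1).2 rfl

theorem asymm {g : G} (h1 : lam g = 1) (h2 : lam g⁻¹ = 1) : False := by
  rw [h.inv_eq, h1] at h2
  exact absurd h2 (by decide)

end IsLeftOrder

/-- The non-strict order defined by a sign function. -/
def SignLE {G : Type*} [Group G] (lam : G → SignType) (f g : G) : Prop := f = g ∨ lam (f⁻¹ * g) = 1

namespace SignLE
variable {G : Type*} [Group G] {lam : G → SignType}

theorem refl (f : G) : SignLE lam f f := Or.inl rfl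

theorem of_pos {f g : G} (h : lam (f⁻¹ * g) = 1) : SignLE lam f g := Or.inr h

theorem trans (h : IsLeftOrder lam) {f g k : G} (h1 : SignLE lam f g) (h2 : SignLE lam g k) :
    SignLE lam f k := by
  rcases h1 with rfl | h1
  · exact h2
  rcases h2 with rfl | h2
  · exact Or.inr h1
  · right
    have := h.mul_pos _ _ h1 h2
    rwa [mul_assoc, mul_inv_cancel_left] at this

theorem mul_left {f g : G} (k : G) (h : SignLE lam f g) : SignLE lam (k * f) (k * g) := by
  rcases h with rfl | h
  · exact Or.inl rfl
  · right
    rwa [_root_.mul_inv_rev, mul_assoc, inv_mul_cancel_left]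

theorem of_mul_left {f g : G} (k : G) (h : SignLE lam (k * f) (k * g)) : SignLE lam f g := by
  simpa using h.mul_left k⁻¹

theorem eq_one_of_one_le {g : G} (h : SignLE lam 1 g) (hg : g ≠ 1) : lam g = 1 := by
  rcases h with rfl | h
  · exact absurd rfl hg
  · simpa using h

theorem eq_neg_one_of_le_one (hl : IsLeftOrder lam) {g : G} (h : SignLE lam g 1) (hg : g ≠ 1) :
    lam g = -1 := by
  rcases h with rfl | h
  · exact absurd rfl hg
  · rw [mul_one, hl.inv_eq] at h
    rw [← neg_neg (lam g), h]

end SignLE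

/-! ### Orders on the braid group given by finitely many inequalities -/

namespace B3

/-- The left end points of the intervals of the ping-pong partition. -/
def lo (n j : ℤ) : B3 := e ^ ((6 * j) % (6 * n + 1)) * t ^ ((j + n * ((6 * j) % (6 * n + 1))) / (6 * n + 1))

/-- The right end points of the intervals of the ping-pong partition. -/
def hi (n j : ℤ) : B3 := x * lo n (j - 3 * n)

/-- The finitely many inequalities defining an isolated left order. -/
structure Interlaced (n : ℤ) (lam : B3 → SignType) : Prop where
  lo_lt_hi : ∀ j ∈ Finset.Ico 0 |6 * n + 1|, lam ((lo n j)⁻¹ * hi n j) = 1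
  hi_lt_lo : ∀ j ∈ Finset.Ico 0 |6 * n + 1|, lam ((hi n j)⁻¹ * lo n (j + 1)) = 1
  pos : lam (e ^ |6 * n + 1| * t ^ ((6 * n + 1).sign * n)) = 1

theorem lo_zero (n : ℤ) : lo n 0 = 1 := by simp [lo]

theorem lo_add_mul (n j m : ℤ) : lo n (j + (6 * n + 1) * m) = t ^ m * lo n j := by
  have h1 : (6 * (j + (6 * n + 1) * m)) % (6 * n + 1) = (6 * j) % (6 * n + 1) := by
    rw [mul_add, mul_left_comm, Int.add_mul_emod_self_left]
  have h2 : 6 * n + 1 ≠ 0 := by omega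
  rw [lo, lo, h1, add_right_comm, Int.add_mul_ediv_left _ _ h2, _root_.zpow_add,
    ← mul_assoc (e ^ _), ← ((t_comm _).zpow_left m).eq]

theorem hi_add_mul (n j m : ℤ) : hi n (j + (6 * n + 1) * m) = t ^ m * hi n j := by
  rw [hi, add_sub_right_comm, lo_add_mul, hi, ← mul_assoc x, ← ((t_comm _).zpow_left m).eq, mul_assoc (t ^ m)]

theorem x_mul_lo (n j : ℤ) : x * lo n j = hi n (j + 3 * n) := by rw [hi, add_sub_cancel_right]

theorem x_mul_hi (n j : ℤ) : x * hi n j = lo n (j + 3 * n + 1) := by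
  have h : j + 3 * n + 1 = j - 3 * n + (6 * n + 1) * 1 := by ring
  rw [h, lo_add_mul, hi, ← mul_assoc x, zpow_one, ← pow_two x, x_sq]

/-- Modulo 6n + 1 the sum is j + 6nj = (6n + 1)j, so the division in the definition of `lo` is
exact. -/
theorem add_mul_emod_dvd (n j : ℤ) : (6 * n + 1) ∣ j + n * ((6 * j) % (6 * n + 1)) := by
  have h := Int.emod_add_mul_ediv (6 * j) (6 * n + 1)
  refine ⟨j - n * (6 * j / (6 * n + 1)), ?_⟩
  linear_combination n * h

/-- Multiplication by e raises the exponent of e in `lo` by one. When it reaches |6n + 1| it wraps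
around to 0, and the discrepancy is exactly the element required to be positive. -/
theorem e_mul_lo (n j : ℤ) : e * lo n j = lo n (j - n) ∨
    e * lo n j = lo n (j - n) * (e ^ |6 * n + 1| * t ^ ((6 * n + 1).sign * n)) := by
  set k := 6 * n + 1 with hk
  have hk0 : k ≠ 0 := by omega
  set i := (6 * j) % k with hi
  have hi0 : 0 ≤ i := Int.emod_nonneg _ hk0
  have hi1 : i < |k| := Int.emod_lt_abs _ hk0
  obtain ⟨l, hl⟩ := add_mul_emod_dvd n j
  rw [← hk, ← hi] at hl
  have hlo : lo n j = e ^ i * t ^ l := by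
    rw [lo, ← hk, ← hi, hl, Int.mul_ediv_cancel_left _ hk0]
  have hmod : (6 * (j - n)) % k = (i + 1) % k := by
    rw [hi, Int.emod_add_emod]
    have : 6 * (j - n) = 6 * j + 1 + k * (-1) := by rw [hk]; ring
    rw [this, Int.add_mul_emod_self_left]
  rcases lt_or_eq_of_le (show i + 1 ≤ |k| by omega) with h | h
  · left
    have h1 : (6 * (j - n)) % k = i + 1 := by
      rw [hmod]
      rw [← Int.emod_abs]
      exact Int.emod_eq_of_lt (by omega) h
    have h2 : j - n + n * (i + 1) = k * l := by linarith
    rw [hlo, lo, ← hk, h1, h2, Int.mul_ediv_cancel_left _ hk0, ← mul_assoc e, ← _root_.zpow_one_add, add_comm]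
  · right
    have h1 : (6 * (j - n)) % k = 0 := by
      rw [hmod, h, ← Int.emod_abs, Int.emod_self]
    have h3 : k.sign * k = |k| := Int.sign_mul_self_eq_abs k
    have h2 : j - n + n * 0 = k * (l - k.sign * n) := by
      have : i = k.sign * k - 1 := by omega
      rw [this] at hl
      linear_combination hl
    rw [hlo, lo, ← hk, h1, h2, Int.mul_ediv_cancel_left _ hk0, zpow_zero, one_mul, ← mul_assoc e,
      ← _root_.zpow_one_add, add_comm 1 i, h, ((t_comm _).zpow_left _).eq, mul_assoc (e ^ _), ← _root_.zpow_add]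
    congr 2
    ring

namespace Interlaced
variable {n : ℤ} {lam : B3 → SignType} (h : Interlaced n lam) (hl : IsLeftOrder lam)
include h

theorem lo_le_hi (j : ℤ) : SignLE lam (lo n j) (hi n j) := by
  have hk0 : 6 * n + 1 ≠ 0 := by omega
  have h1 := h.lo_lt_hi (j % (6 * n + 1))
    (Finset.mem_Ico.2 ⟨Int.emod_nonneg _ hk0, Int.emod_lt_abs _ hk0⟩)
  rw [← Int.emod_add_mul_ediv j (6 * n + 1), lo_add_mul, hi_add_mul]
  exact (SignLE.of_pos h1).mul_left _

theorem hi_le_lo (j : ℤ) : SignLE lam (hi n j) (lo n (j + 1)) := by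
  have hk0 : 6 * n + 1 ≠ 0 := by omega
  have h1 := h.hi_lt_lo (j % (6 * n + 1))
    (Finset.mem_Ico.2 ⟨Int.emod_nonneg _ hk0, Int.emod_lt_abs _ hk0⟩)
  have h2 : j + 1 = j % (6 * n + 1) + 1 + (6 * n + 1) * (j / (6 * n + 1)) := by
    linear_combination -Int.emod_add_mul_ediv j (6 * n + 1)
  rw [h2, lo_add_mul]
  nth_rw 1 [← Int.emod_add_mul_ediv j (6 * n + 1)]
  rw [hi_add_mul]
  exact (SignLE.of_pos h1).mul_left _

theorem lo_le_e_mul_lo (j : ℤ) : SignLE lam (lo n (j - n)) (e * lo n j) := by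
  rcases e_mul_lo n j with h1 | h1
  · rw [h1]; exact SignLE.refl _
  · rw [h1]
    refine SignLE.of_pos ?_
    rw [inv_mul_cancel_left]; exact h.pos

theorem hi_le_y_mul_lo (j : ℤ) : SignLE lam (hi n (j + 2 * n)) (y * lo n j) := by
  have h1 := (h.lo_le_e_mul_lo j).mul_left x
  rw [← mul_assoc x, x_mul_e, x_mul_lo] at h1
  convert h1 using 2; ring

/-- An upper bound comes from a lower bound through y³ = t: multiplied by y, the claim becomes the
previous lemma at the index j + 4n + 1, since t shifts indices by 6n + 1. -/
theorem yy_mul_hi_le (j : ℤ) : SignLE lam (y * (y * hi n j)) (lo n (j + 4 * n + 1)) := by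
  refine SignLE.of_mul_left y ?_
  have h1 := h.hi_le_y_mul_lo (j + 4 * n + 1)
  have h2 : y * (y * (y * hi n j)) = hi n (j + 4 * n + 1 + 2 * n) := by
    have : j + 4 * n + 1 + 2 * n = j + (6 * n + 1) * 1 := by ring
    rw [this, hi_add_mul, zpow_one, ← y_cube, pow_succ, pow_two, mul_assoc (y * y), mul_assoc y y]
  rwa [h2]

include hl

theorem lo_mono {i j : ℤ} (hij : i ≤ j) : SignLE lam (lo n i) (lo n j) := by
  obtain ⟨d, rfl⟩ := Int.le.dest hij
  induction d with
  | zero => simpa using SignLE.refl _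
  | succ d ih =>
    refine (ih (by omega)).trans hl ((h.lo_le_hi _).trans hl ?_)
    have := h.hi_le_lo (i + d)
    push_cast
    rwa [add_assoc] at this

theorem hi_le_yy_mul_lo (j : ℤ) : SignLE lam (hi n (j + 4 * n)) (y * (y * lo n j)) := by
  have h1 := (h.hi_le_y_mul_lo j).mul_left y
  have h2 := (h.lo_le_hi (j + 2 * n)).mul_left y
  have h3 := h.hi_le_y_mul_lo (j + 2 * n)
  rw [show j + 4 * n = j + 2 * n + 2 * n by ring]
  exact h3.trans hl (h2.trans hl h1)

theorem y_mul_hi_le (j : ℤ) : SignLE lam (y * hi n j) (lo n (j + 2 * n + 1)) := by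
  refine SignLE.of_mul_left y (SignLE.of_mul_left y ?_)
  have h1 := h.hi_le_yy_mul_lo hl (j + 2 * n + 1)
  have h2 : y * (y * (y * hi n j)) = hi n (j + 2 * n + 1 + 4 * n) := by
    have : j + 2 * n + 1 + 4 * n = j + (6 * n + 1) * 1 := by ring
    rw [this, hi_add_mul, zpow_one, ← y_cube, pow_succ, pow_two, mul_assoc (y * y), mul_assoc y y]
  rwa [h2]

/-- This is the ping-pong inside the abstract order: e and f map the interval of index j into the
interval whose index is shifted by n times the degree. -/
theorem posMonoid_mul {u : B3} (hu : u ∈ posMonoid) : ∀ j : ℤ,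
    SignLE lam (lo n (j + n * deg u)) (u * lo n j) ∧
      SignLE lam (u * hi n j) (hi n (j + n * deg u)) := by
  induction hu using Submonoid.closure_induction_left with
  | one => intro j; simpa using ⟨SignLE.refl _, SignLE.refl _⟩
  | mul_left a ha b hb ih =>
    have step : ∀ j : ℤ, SignLE lam (lo n (j + n * deg a)) (a * lo n j) ∧
      SignLE lam (a * hi n j) (hi n (j + n * deg a)) := by
      intro j
      rcases ha with rfl | rfl
      · rw [deg_e]
        constructor
        · convert h.lo_le_e_mul_lo j using 2; ring
        · refine SignLE.of_mul_left x ?_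
          rw [← mul_assoc x, x_mul_e, x_mul_hi]
          convert h.y_mul_hi_le hl j using 2; ring
      · rw [deg_f]
        constructor
        · refine SignLE.of_mul_left x ?_
          rw [← mul_assoc x, x_mul_f, x_mul_lo, pow_two y, mul_assoc y]
          convert h.hi_le_yy_mul_lo hl j using 2; ring
        · refine SignLE.of_mul_left x ?_
          rw [← mul_assoc x, x_mul_f, x_mul_hi, pow_two y, mul_assoc y]
          convert h.yy_mul_hi_le j using 2; ring
    intro j
    rw [deg_mul, mul_add, add_comm (n * deg a), ← add_assoc, mul_assoc a, mul_assoc a]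
    exact ⟨(step _).1.trans hl ((ih j).1.mul_left a), ((ih j).2.mul_left a).trans hl (step _).2⟩

omit h hl in
/-- The inequalities determine the position of every element. -/
theorem exists_position (n : ℤ) (g : B3) : ∃ N : ℤ, ∀ lam, IsLeftOrder lam → Interlaced n lam →
    (0 ≤ N → SignLE lam 1 g) ∧ (N < 0 → SignLE lam g 1) := by
  -- Powers of t shift the index by 6n + 1, and a further x interchanges the two kinds of intervals.
  -- As `lo n 0` is the identity, the sign of the final index tells on which side of 1 the element
  -- lies.
  have main : ∀ (m J : ℤ) (c : B3), (∀ lam, IsLeftOrder lam → Interlaced n lam →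
      SignLE lam (lo n J) c ∧ SignLE lam c (hi n J)) →
      ∃ N : ℤ, ∀ lam, IsLeftOrder lam → Interlaced n lam →
        (0 ≤ N → SignLE lam 1 (x ^ m * c)) ∧ (N < 0 → SignLE lam (x ^ m * c) 1) := by
    intro m J c hc
    have hcl : ∀ l : ℤ, ∀ lam, IsLeftOrder lam → Interlaced n lam →
        SignLE lam (lo n (J + (6 * n + 1) * l)) (t ^ l * c) ∧
          SignLE lam (t ^ l * c) (hi n (J + (6 * n + 1) * l)) := by
      intro l lam hl h
      rw [lo_add_mul, hi_add_mul]
      exact ⟨(hc lam hl h).1.mul_left _, (hc lam hl h).2.mul_left _⟩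
    obtain ⟨l, rfl | rfl⟩ := Int.even_or_odd' m
    · refine ⟨J + (6 * n + 1) * l, fun lam hl h => ?_⟩
      obtain ⟨h1, h2⟩ := hcl l lam hl h
      rw [← xt_pow, ← lo_zero n]
      exact ⟨fun hN => (h.lo_mono hl hN).trans hl h1, fun hN =>
        h2.trans hl ((h.hi_le_lo _).trans hl (h.lo_mono hl hN))⟩
    · refine ⟨J + (6 * n + 1) * l + 3 * n, fun lam hl h => ?_⟩
      obtain ⟨h1, h2⟩ := hcl l lam hl h
      have e1 : x ^ (2 * l + 1) * c = x * (t ^ l * c) := by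
        rw [add_comm, _root_.zpow_add, xt_pow, zpow_one, mul_assoc x]
      have h1' := h1.mul_left x
      have h2' := h2.mul_left x
      rw [x_mul_lo, ← e1] at h1'
      rw [x_mul_hi, ← e1] at h2'
      rw [← lo_zero n]
      exact ⟨fun hN => (h.lo_mono hl hN).trans hl ((h.lo_le_hi _).trans hl h1'), fun hN =>
        h2'.trans hl (h.lo_mono hl hN)⟩
  obtain ⟨m, u, hu, rfl | rfl⟩ := exists_normalForm g
  · refine main m (n * deg u) u fun lam hl h => ?_
    obtain ⟨h1, h2⟩ := h.posMonoid_mul hl hu 0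
    have h3 := (h.lo_le_hi 0).mul_left u
    rw [zero_add, lo_zero, mul_one] at h1
    rw [zero_add] at h2
    rw [lo_zero, mul_one] at h3
    exact ⟨h1, h3.trans hl h2⟩
  · rw [mul_assoc (x ^ m)]
    -- The trailing x is itself the right end point of index 3n.
    refine main m (3 * n + n * deg u) (u * x) fun lam hl h => ?_
    obtain ⟨h1, h2⟩ := h.posMonoid_mul hl hu (3 * n)
    have h3 := (h.lo_le_hi (3 * n)).mul_left u
    have h4 : hi n (3 * n) = x := by rw [hi, sub_self, lo_zero, mul_one]
    rw [h4] at h2 h3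
    exact ⟨h1.trans hl h3, h2⟩

end Interlaced

/-- The index from `exists_position` is chosen before the order, so both orders give every element
the same sign. -/
theorem eq_of_interlaced {n : ℤ} {l l' : LO B3} (h : Interlaced n l.1) (h' : Interlaced n l'.1) :
    l = l' := by
  refine Subtype.ext (funext fun g => ?_)
  by_cases hg : g = 1
  · rw [hg, l.2.map_one, l'.2.map_one]
  obtain ⟨N, hN⟩ := Interlaced.exists_position n g
  obtain ⟨h1, h2⟩ := hN _ l.2 h
  obtain ⟨h1', h2'⟩ := hN _ l'.2 h'
  rcases le_or_gt 0 N with h0 | h0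
  · rw [(h1 h0).eq_one_of_one_le hg, (h1' h0).eq_one_of_one_le hg]
  · rw [(h2 h0).eq_neg_one_of_le_one l.2 hg, (h2' h0).eq_neg_one_of_le_one l'.2 hg]

theorem isIsolatedPoint_of_interlaced {n : ℤ} {l : LO B3} (h : Interlaced n l.1) :
    IsIsolatedPoint l := by
  have ho : ∀ g : B3, IsOpen {l' : LO B3 | l'.1 g = 1} := fun g =>
    (isOpen_discrete ({1} : Set SignType)).preimage
      (f := fun l' : LO B3 => l'.1 g) ((continuous_apply g).comp continuous_subtype_val)
  have e1 : ({l} : Set (LO B3)) =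
      ((⋂ j ∈ Finset.Ico 0 |6 * n + 1|, {l' : LO B3 | l'.1 ((lo n j)⁻¹ * hi n j) = 1}) ∩
      ⋂ j ∈ Finset.Ico 0 |6 * n + 1|, {l' : LO B3 | l'.1 ((hi n j)⁻¹ * lo n (j + 1)) = 1}) ∩
      {l' : LO B3 | l'.1 (e ^ |6 * n + 1| * t ^ ((6 * n + 1).sign * n)) = 1} := by
    ext l'
    simp only [Set.mem_singleton_iff, Set.mem_inter_iff, Set.mem_iInter, Set.mem_ofPred_eq]
    constructor
    · rintro rfl
      exact ⟨⟨h.1, h.2⟩, h.3⟩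
    · rintro ⟨⟨h1, h2⟩, h3⟩
      exact eq_of_interlaced ⟨h1, h2, h3⟩ h
  rw [IsIsolatedPoint, e1]
  exact ((isOpen_biInter_finset fun j _ => ho _).inter (isOpen_biInter_finset fun j _ => ho _)).inter
    (ho _)

end B3

/-! ### The modular group -/

theorem sl_mul_val {R : Type} [CommRing R] (M N : Matrix.SpecialLinearGroup (Fin 2) R) :
    (M * N).1 = M.1 * N.1 := rfl

theorem toPSL2_eq_one_iff {R : Type} [CommRing R] [IsDomain R] (M : SpecialLinearGroup (Fin 2) R) :
    toPSL2 M = 1 ↔ M.1 = 1 ∨ M.1 = -1 := by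
  have h0 : toPSL2 M = 1 ↔ M ∈ Subgroup.center (SpecialLinearGroup (Fin 2) R) :=
    QuotientGroup.eq_one_iff M
  rw [h0, Matrix.SpecialLinearGroup.mem_center_iff]
  constructor
  · rintro ⟨r, hr, h⟩
    rw [Fintype.card_fin, sq_eq_one_iff] at hr
    rcases hr with rfl | rfl
    · left; rw [← h]; simp
    · right; rw [← h]; ext i j; fin_cases i <;> fin_cases j <;> simp
  · rintro (h | h)
    · exact ⟨1, by simp, by rw [h]; simp⟩
    · exact ⟨-1, by simp, by rw [h]; ext i j; fin_cases i <;> fin_cases j <;> simp⟩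

theorem toPSL2_eq_iff {R : Type} [CommRing R] [IsDomain R] (M N : SpecialLinearGroup (Fin 2) R) :
    toPSL2 M = toPSL2 N ↔ M.1 = N.1 ∨ M.1 = -N.1 := by
  rw [← mul_inv_eq_one, ← map_inv, ← map_mul, toPSL2_eq_one_iff]
  have key : ∀ A : Matrix (Fin 2) (Fin 2) R, (M * N⁻¹).1 = A ↔ M.1 = A * N.1 := by
    intro A
    have h1 : (N⁻¹).1 * N.1 = 1 := by
      rw [← sl_mul_val, inv_mul_cancel]; rfl
    have h2 : N.1 * (N⁻¹).1 = 1 := by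
      rw [← sl_mul_val, mul_inv_cancel]; rfl
    constructor
    · rintro rfl
      change M.1 = (M.1 * (N⁻¹).1) * N.1
      rw [mul_assoc, h1, mul_one]
    · intro h
      change M.1 * (N⁻¹).1 = A
      rw [h, mul_assoc, h2, mul_one]
  rw [key, key, one_mul, neg_one_mul]

theorem toPSL2_matα_sq : (toPSL2 matα) ^ 2 = 1 := by
  rw [← map_pow, toPSL2_eq_one_iff]
  right
  decide

theorem toPSL2_matβ_cube : (toPSL2 matβ) ^ 3 = 1 := by
  rw [← map_pow, toPSL2_eq_one_iff]
  right
  decide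

/-- The homomorphism of `⟨α, β ∣ α² = β³ = e⟩` onto the modular group. -/
def modularHom : GBar →* PSL2 ℤ :=
  GBar.lift (toPSL2 matα) (toPSL2 matβ) toPSL2_matα_sq toPSL2_matβ_cube

/-- The lower triangular unipotent matrices. -/
def unip : Multiplicative ℤ →* SpecialLinearGroup (Fin 2) ℤ where
  toFun m := ⟨!![1, 0; m.toAdd, 1], by simp [det_fin_two]⟩
  map_one' := by ext i j; fin_cases i <;> fin_cases j <;> simp
  map_mul' a b := Subtype.ext (by
    change !![1, 0; (a * b).toAdd, 1] = !![1, 0; a.toAdd, 1] * !![1, 0; b.toAdd, 1]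
    ext i j; fin_cases i <;> fin_cases j <;> simp [mul_apply])

theorem unip_val (m : ℤ) : (unip (Multiplicative.ofAdd m)).1 = !![1, 0; m, 1] := rfl

theorem modularT_val : (ModularGroup.T).1 = !![1, 1; 0, 1] := rfl

theorem unip_zpow (m : ℤ) : unip (Multiplicative.ofAdd m) = unip (Multiplicative.ofAdd 1) ^ m := by
  rw [← map_zpow, ← ofAdd_zsmul, smul_eq_mul, mul_one]

theorem modularHom_αβ : modularHom (gα * gβ) = toPSL2 (unip (Multiplicative.ofAdd 1)) := by
  rw [map_mul, modularHom, GBar.lift_α, GBar.lift_β, ← map_mul]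
  congr 1
  exact Subtype.ext (by decide)

theorem modularHom_αββ : modularHom (gα * gβ ^ 2) = toPSL2 ModularGroup.T := by
  rw [map_mul, map_pow, modularHom, GBar.lift_α, GBar.lift_β, ← map_pow, ← map_mul]
  congr 1
  exact Subtype.ext (by decide)

theorem modularHom_αβ_zpow (m : ℤ) :
    modularHom ((gα * gβ) ^ m) = toPSL2 (unip (Multiplicative.ofAdd m)) := by
  rw [map_zpow, modularHom_αβ, unip_zpow m, map_zpow]

theorem modularHom_surjective : Function.Surjective modularHom := by
  intro A
  obtain ⟨M, rfl⟩ : ∃ M, toPSL2 M = A := QuotientGroup.mk'_surjective _ A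
  have hM : M ∈ Subgroup.closure {ModularGroup.S, ModularGroup.T} := by
    rw [SpecialLinearGroup.SL2Z_generators]; trivial
  change toPSL2 M ∈ modularHom.range
  induction hM using Subgroup.closure_induction with
  | mem z hz =>
    rcases hz with rfl | rfl
    · refine ⟨gα, ?_⟩
      rw [modularHom, GBar.lift_α]; congr 1
    · exact ⟨_, modularHom_αββ⟩
  | one => rw [map_one]; exact one_mem _
  | mul a b _ _ ha hb => rw [map_mul]; exact mul_mem ha hb
  | inv a _ ha => rw [map_inv]; exact inv_mem ha

/-- The letters e and f act as the two elementary unipotents, each adding one row to the other.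
Invertibility makes both row sums positive, so every letter strictly increases the sum of the
entries. -/
theorem exists_nonneg_matrix {u : B3} (hu : u ∈ B3.posMonoid) :
    ∃ M : SpecialLinearGroup (Fin 2) ℤ, modularHom (B3.proj u) = toPSL2 M ∧ (∀ i j, 0 ≤ M.1 i j) ∧
      2 ≤ M.1 0 0 + M.1 0 1 + M.1 1 0 + M.1 1 1 ∧
      (u = 1 ∨ 3 ≤ M.1 0 0 + M.1 0 1 + M.1 1 0 + M.1 1 1) := by
  induction hu using Submonoid.closure_induction_left with
  | one => exact ⟨1, by simp, fun i j => by fin_cases i <;> fin_cases j <;> simp, by simp, by simp⟩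
  | mul_left a ha b hb ih =>
    obtain ⟨M, h1, h2, h3, -⟩ := ih
    have hd := M.2
    rw [det_fin_two] at hd
    have h00 := h2 0 0
    have h01 := h2 0 1
    have h10 := h2 1 0
    have h11 := h2 1 1
    have hr0 : 0 < M.1 0 0 + M.1 0 1 := by
      by_contra hc
      have e1 : M.1 0 0 = 0 := by omega
      have e2 : M.1 0 1 = 0 := by omega
      rw [e1, e2] at hd; simp at hd
    have hr1 : 0 < M.1 1 0 + M.1 1 1 := by
      by_contra hc
      have e1 : M.1 1 0 = 0 := by omega
      have e2 : M.1 1 1 = 0 := by omega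
      rw [e1, e2] at hd; simp at hd
    rcases ha with rfl | rfl
    · refine ⟨unip (Multiplicative.ofAdd 1) * M, ?_, ?_⟩
      · rw [map_mul, map_mul, map_mul, h1, B3.proj_e, modularHom_αβ]
      · have e : (unip (Multiplicative.ofAdd 1) * M).1 =
            !![M.1 0 0, M.1 0 1; M.1 0 0 + M.1 1 0, M.1 0 1 + M.1 1 1] := by
          rw [sl_mul_val, unip_val]
          ext i j; fin_cases i <;> fin_cases j <;> simp [mul_apply]
        rw [e]
        refine ⟨fun i j => by fin_cases i <;> fin_cases j <;> simp <;> omega, ?_, Or.inr ?_⟩ <;>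
          simp <;> omega
    · refine ⟨ModularGroup.T * M, ?_, ?_⟩
      · rw [map_mul, map_mul, map_mul, h1, B3.proj_f, modularHom_αββ]
      · have e : (ModularGroup.T * M).1 =
            !![M.1 0 0 + M.1 1 0, M.1 0 1 + M.1 1 1; M.1 1 0, M.1 1 1] := by
          rw [sl_mul_val, modularT_val]
          ext i j; fin_cases i <;> fin_cases j <;> simp [mul_apply]
        rw [e]
        refine ⟨fun i j => by fin_cases i <;> fin_cases j <;> simp <;> omega, ?_, Or.inr ?_⟩ <;>
          simp <;> omega

theorem gα_zpow (m : ℤ) : gα ^ m = 1 ∨ gα ^ m = gα := by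
  have h2 : gα ^ (2 : ℤ) = 1 := by
    have := gα_sq
    rwa [← zpow_natCast] at this
  obtain ⟨l, rfl | rfl⟩ := Int.even_or_odd' m
  · left; rw [_root_.zpow_mul, h2, _root_.one_zpow]
  · right; rw [_root_.zpow_add, _root_.zpow_mul, h2, _root_.one_zpow, one_mul, zpow_one]

/-- A nonempty word in e and f has a nonnegative matrix of entry sum at least 3, whereas ±1 and ±
`matα` have sum at most 2. By the normal form only powers of α remain in the kernel. -/
theorem modularHom_injective : Function.Injective modularHom := by
  rw [injective_iff_map_eq_one]
  intro g' hg'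
  obtain ⟨g, rfl⟩ := B3.proj_surjective g'
  have key : ∀ m : ℤ, ∀ u ∈ B3.posMonoid,
      modularHom (B3.proj u) = modularHom (gα ^ m) → u = 1 := by
    intro m u hu h
    obtain ⟨M, h1, h2, h3, h4⟩ := exists_nonneg_matrix hu
    rcases h4 with h4 | h4
    · exact h4
    exfalso
    rw [h1] at h
    rcases gα_zpow m with h5 | h5 <;> rw [h5] at h
    · rw [map_one, toPSL2_eq_one_iff] at h
      rcases h with h | h <;> rw [h] at h4 <;> simp at h4
    · rw [modularHom, GBar.lift_α, toPSL2_eq_iff] at h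
      rcases h with h | h <;> rw [h] at h4 <;> simp [matα] at h4
  have hα : ∀ m : ℤ, modularHom (gα ^ m) = 1 → gα ^ m = 1 := by
    intro m h
    rcases gα_zpow m with h5 | h5
    · exact h5
    · exfalso
      rw [h5, modularHom, GBar.lift_α, toPSL2_eq_one_iff] at h
      rcases h with h | h <;> simpa [matα] using congrFun (congrFun h 0) 0
  obtain ⟨m, u, hu, rfl | rfl⟩ := B3.exists_normalForm g
  · have h1 := hg'
    rw [map_mul, map_zpow, B3.proj_x, map_mul, mul_eq_one_iff_eq_inv', ← map_inv, ← _root_.zpow_neg] at h1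
    have := key _ u hu h1
    subst this
    rw [mul_one, map_zpow, B3.proj_x] at hg' ⊢
    exact hα m hg'
  · have h1 := hg'
    rw [map_mul _ _ B3.x, map_mul, map_mul B3.proj, map_zpow, B3.proj_x, map_mul, mul_eq_one_iff_eq_inv,
      ← map_inv, ← eq_inv_mul_iff_mul_eq, ← map_inv, ← map_mul, ← _root_.zpow_neg, B3.gα_inv,
      ← _root_.zpow_add_one] at h1
    have := key _ u hu h1
    subst this
    rw [mul_one, map_mul, map_zpow, B3.proj_x, ← _root_.zpow_add_one] at hg' ⊢
    exact hα _ hg'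

theorem toPSL2_unip_injective {m m' : ℤ} (h : toPSL2 (unip (Multiplicative.ofAdd m)) =
    toPSL2 (unip (Multiplicative.ofAdd m'))) : m = m' := by
  rw [toPSL2_eq_iff, unip_val, unip_val] at h
  rcases h with h | h
  · simpa using congrFun (congrFun h 1) 0
  · have := congrFun (congrFun h 0) 0
    simp at this

/-- The centralizer of a nontrivial unipotent element. -/
theorem exists_unip_of_commute {A : PSL2 ℤ} {l : ℤ} (hl : l ≠ 0)
    (h : Commute A (toPSL2 (unip (Multiplicative.ofAdd l)))) :
    ∃ m : ℤ, A = toPSL2 (unip (Multiplicative.ofAdd m)) := by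
  obtain ⟨M, rfl⟩ : ∃ M, toPSL2 M = A := QuotientGroup.mk'_surjective _ A
  have h1 := h.eq
  rw [← map_mul, ← map_mul, toPSL2_eq_iff] at h1
  have hd := M.2
  rw [det_fin_two] at hd
  have e1 : (M * unip (Multiplicative.ofAdd l)).1 =
      !![M.1 0 0 + M.1 0 1 * l, M.1 0 1; M.1 1 0 + M.1 1 1 * l, M.1 1 1] := by
    rw [sl_mul_val, unip_val]
    ext i j; fin_cases i <;> fin_cases j <;> simp [mul_apply]
  have e2 : (unip (Multiplicative.ofAdd l) * M).1 =
      !![M.1 0 0, M.1 0 1; l * M.1 0 0 + M.1 1 0, l * M.1 0 1 + M.1 1 1] := by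
    rw [sl_mul_val, unip_val]
    ext i j; fin_cases i <;> fin_cases j <;> simp [mul_apply]
  rw [e1, e2] at h1
  rcases h1 with h1 | h1
  · have h00 := congrFun (congrFun h1 0) 0
    have h10 := congrFun (congrFun h1 1) 0
    simp at h00 h10
    have hb : M.1 0 1 = 0 := h00.resolve_right hl
    have ha : M.1 0 0 = M.1 1 1 := by
      have : l * (M.1 0 0 - M.1 1 1) = 0 := by linear_combination -h10
      have := (mul_eq_zero.1 this).resolve_left hl
      omega
    rw [hb, ha, zero_mul, sub_zero, ← pow_two, sq_eq_one_iff] at hd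
    rcases hd with hd | hd
    · refine ⟨M.1 1 0, (toPSL2_eq_iff _ _).2 (Or.inl ?_)⟩
      rw [unip_val]
      ext i j; fin_cases i <;> fin_cases j <;> simp [ha, hb, hd]
    · refine ⟨-M.1 1 0, (toPSL2_eq_iff _ _).2 (Or.inr ?_)⟩
      rw [unip_val]
      ext i j; fin_cases i <;> fin_cases j <;> simp [ha, hb, hd]
  · exfalso
    have h00 := congrFun (congrFun h1 0) 0
    have h01 := congrFun (congrFun h1 0) 1
    simp at h00 h01
    have hb : M.1 0 1 = 0 := by omega
    rw [hb] at h00 hd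
    have ha : M.1 0 0 = 0 := by omega
    rw [ha] at hd
    simp at hd

/-- A homomorphism sending a power of `αβ` to a power of `αβ` divides exponents. -/
theorem dvd_of_pow_eq {u : GBar} {k l : ℤ} (hl : l ≠ 0) (h : u ^ k = (gα * gβ) ^ l) : k ∣ l := by
  -- u commutes with its own power, a nontrivial unipotent, so u is unipotent too; exponents are
  -- then compared in a copy of ℤ.
  have h1 : Commute (modularHom u) (toPSL2 (unip (Multiplicative.ofAdd l))) := by
    rw [← modularHom_αβ_zpow, ← h]
    exact ((Commute.refl u).zpow_right k).map modularHom
  obtain ⟨m, hm⟩ := exists_unip_of_commute hl h1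
  have h2 := congrArg modularHom h
  rw [map_zpow, hm, ← modularHom_αβ_zpow, ← map_zpow, ← _root_.zpow_mul, modularHom_αβ_zpow,
    modularHom_αβ_zpow] at h2
  exact ⟨m, by rw [← toPSL2_unip_injective h2, mul_comm]⟩

theorem dvd_of_map_zpowers_eq {φ : GBar →* GBar} {k l : ℕ} (hl : l ≠ 0)
    (h : (Subgroup.zpowers ((gα * gβ) ^ k)).map φ = Subgroup.zpowers ((gα * gβ) ^ l)) : k ∣ l := by
  have h1 : (gα * gβ) ^ l ∈ (Subgroup.zpowers ((gα * gβ) ^ k)).map φ := by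
    rw [h]; exact Subgroup.mem_zpowers _
  obtain ⟨_, ⟨i, rfl⟩, h2⟩ := h1
  have h3 : (φ (gα * gβ)) ^ ((k : ℤ) * i) = (gα * gβ) ^ (l : ℤ) := by
    rw [_root_.zpow_mul, zpow_natCast, zpow_natCast, ← map_pow, ← map_zpow]; exact h2
  have h4 := dvd_of_pow_eq (by exact_mod_cast hl) h3
  exact Int.natCast_dvd_natCast.1 ((Dvd.intro _ rfl).trans h4)

theorem map_zpowers_ne {k l : ℕ} (hk : k ≠ 0) (hl : l ≠ 0) (hkl : k ≠ l) (φ : GBar ≃* GBar) :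
    (Subgroup.zpowers ((gα * gβ) ^ k)).map (φ : GBar →* GBar) ≠
      Subgroup.zpowers ((gα * gβ) ^ l) := by
  intro h
  refine hkl (Nat.dvd_antisymm (dvd_of_map_zpowers_eq hl h)
    (dvd_of_map_zpowers_eq (φ := (φ.symm : GBar →* GBar)) hk ?_))
  rw [← h, Subgroup.map_map]
  convert Subgroup.map_id _
  ext x; simp

/-- Commuting with αβ makes the element lower unipotent, and commuting with the upper unipotent αβ²
makes it trivial. -/
theorem eq_one_of_central {g : GBar} (h : ∀ g', Commute g g') : g = 1 := by
  have h1 : Commute (modularHom g) (toPSL2 (unip (Multiplicative.ofAdd 1))) := by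
    rw [← modularHom_αβ]; exact (h _).map modularHom
  obtain ⟨m, hm⟩ := exists_unip_of_commute one_ne_zero h1
  have h2 : Commute (modularHom g) (toPSL2 ModularGroup.T) := by
    rw [← modularHom_αββ]; exact (h _).map modularHom
  have h3 := h2.eq
  rw [hm, ← map_mul, ← map_mul, toPSL2_eq_iff, sl_mul_val, sl_mul_val, unip_val, modularT_val] at h3
  have hm0 : m = 0 := by
    rcases h3 with h3 | h3
    · simpa [mul_apply] using congrFun (congrFun h3 0) 0
    · have := congrFun (congrFun h3 0) 1
      simp [mul_apply] at this
  apply modularHom_injective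
  rw [hm, hm0, map_one]; simp

namespace FarPoint
variable (w : FarPoint) (n : ℤ)

/-! ### The left orders on the braid group -/

theorem exists_farPoint : Nonempty FarPoint :=
  ⟨⟨⟨⟨-(3 / 5), 4 / 5⟩, by norm_num⟩, by
    constructor <;> simp [UpperHalfPlane.re, UpperHalfPlane.im] <;> norm_num⟩⟩

theorem rep_lt_iff (g h : B3) (a b : ℝ) :
    w.rep n g a < w.rep n h b ↔ a < w.rep n (g⁻¹ * h) b := by
  have : w.rep n h b = w.rep n g (w.rep n (g⁻¹ * h) b) := by
    rw [← deg1_mul_apply, ← map_mul, mul_inv_cancel_left]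
  rw [this, (deg1_strictMono _).lt_iff_lt]

/-- The left order on the braid group coming from the action on the orbit of `0`. -/
def leftOrd : LO B3 := ⟨fun g => SignType.sign (w.rep n g 0),
  { eq_zero_iff := fun g => by
      rw [sign_eq_zero_iff]
      exact ⟨w.eq_one_of_rep n, by rintro rfl; simp⟩
    mul_pos := fun f g hf hg => by
      rw [sign_eq_one_iff] at *
      rw [map_mul, deg1_mul_apply]
      exact hf.trans (deg1_strictMono _ hg)
    inv_eq := fun f => by
      have h := w.rep_lt_iff n f 1 0 0
      have h' := w.rep_lt_iff n 1 f 0 0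
      have h1 := w.rep_lt_iff n 1 f⁻¹ 0 0
      have h2 := w.rep_lt_iff n f⁻¹ 1 0 0
      simp only [map_one, deg1_one_apply, inv_one, one_mul, mul_one, inv_inv] at h h' h1 h2
      rcases lt_trichotomy (w.rep n f 0) 0 with h0 | h0 | h0
      · rw [sign_neg h0, sign_pos (h.1 h0)]; rfl
      · rw [w.eq_one_of_rep n h0]; simp
      · rw [sign_pos h0, sign_neg (h2.2 h0)] }⟩

theorem leftOrd_eq_one_iff (g : B3) : (w.leftOrd n).1 g = 1 ↔ 0 < w.rep n g 0 := sign_eq_one_iff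

theorem leftOrd_inv_mul_eq_one_iff (g h : B3) :
    (w.leftOrd n).1 (g⁻¹ * h) = 1 ↔ w.rep n g 0 < w.rep n h 0 := by
  rw [leftOrd_eq_one_iff, rep_lt_iff]

theorem rep_e_zpow_mul (i l : ℤ) (θ : ℝ) :
    w.rep n (B3.e ^ i * B3.t ^ l) θ = (w.E ^ i) θ + ((6 * n + 1) * l - n * i : ℤ) := by
  rw [map_mul, deg1_mul_apply, rep_t_zpow_apply, rep_apply, map_zpow, rep₀_e]
  have := CircleDeg1Lift.map_add_int ((w.E ^ i : CircleDeg1Liftˣ) : CircleDeg1Lift) θ ((6 * n + 1) * l)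
  rw [this]
  simp; ring

theorem E_pow_zero_lt_half (i : ℕ) : (w.E ^ i) 0 < 1 / 2 := by
  have h : B3.e ^ i ∈ B3.posMonoid := pow_mem B3.e_mem i
  have h0 := (w.rep₀_posMonoid_mem h (θ := 1 / 2) ⟨by norm_num, le_rfl⟩).2
  rw [map_pow, rep₀_e] at h0
  exact lt_of_lt_of_le (deg1_strictMono _ (by norm_num)) h0

/-- The integer j itself need not be in the twisted orbit. The exponent 6j mod (6n + 1) is chosen so
that some e^i t^l acts as E^i followed by translation by j, which requires j + ni to be divisible by
6n + 1. -/
theorem exists_rep_lo (j : ℤ) : ∃ i : ℕ, w.rep n (B3.lo n j) 0 = (w.E ^ i) 0 + j := by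
  have hk : 6 * n + 1 ≠ 0 := by omega
  obtain ⟨i, hi⟩ := Int.eq_ofNat_of_zero_le (Int.emod_nonneg (6 * j) hk)
  refine ⟨i, ?_⟩
  rw [B3.lo, rep_e_zpow_mul, Int.mul_ediv_cancel' (B3.add_mul_emod_dvd n j), hi, zpow_natCast]
  congr 2
  ring

theorem exists_rep_hi (j : ℤ) : ∃ i : ℕ, w.rep n (B3.hi n j) 0 = (w.E ^ i) 0 + 1 / 2 + j := by
  obtain ⟨i, hi⟩ := w.exists_rep_lo n (j - 3 * n)
  refine ⟨i, ?_⟩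
  rw [B3.hi, map_mul, deg1_mul_apply, hi, rep_apply, rep₀_x, X_apply]
  simp; ring

/-- The least positive element. -/
def least : B3 := B3.e ^ |6 * n + 1| * B3.t ^ ((6 * n + 1).sign * n)

theorem rep_least : w.rep n (least n) = w.E ^ (6 * n + 1).natAbs := by
  refine deg1_ext fun θ => ?_
  rw [least, rep_e_zpow_mul, Int.abs_eq_natAbs, zpow_natCast]
  have h := Int.sign_mul_natAbs (6 * n + 1)
  have h2 : (6 * n + 1) * ((6 * n + 1).sign * n) - n * ((6 * n + 1).natAbs : ℤ) = 0 := by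
    have h3 : (6 * n + 1).sign * (6 * n + 1) = (6 * n + 1).natAbs := by
      rw [Int.sign_mul_self_eq_abs, Int.abs_eq_natAbs]
    linear_combination n * h3
  rw [h2]; simp

theorem E_pow_zero_pos {i : ℕ} (hi : i ≠ 0) : 0 < (w.E ^ i) 0 := by
  obtain ⟨i, rfl⟩ := Nat.exists_eq_succ_of_ne_zero hi
  rw [Nat.succ_eq_add_one, pow_succ', deg1_mul_apply]
  exact w.E_zero_pos.trans_le ((deg1_strictMono _).monotone (w.E_pow_zero_nonneg i))

theorem interlaced_leftOrd : B3.Interlaced n (w.leftOrd n).1 where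
  lo_lt_hi j _ := by
    rw [leftOrd_inv_mul_eq_one_iff]
    obtain ⟨i, hi⟩ := w.exists_rep_lo n j
    obtain ⟨i', hi'⟩ := w.exists_rep_hi n j
    have := w.E_pow_zero_nonneg i'
    have := w.E_pow_zero_lt_half i
    rw [hi, hi']; linarith
  hi_lt_lo j _ := by
    rw [leftOrd_inv_mul_eq_one_iff]
    obtain ⟨i, hi⟩ := w.exists_rep_lo n (j + 1)
    obtain ⟨i', hi'⟩ := w.exists_rep_hi n j
    have := w.E_pow_zero_nonneg i
    have := w.E_pow_zero_lt_half i'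
    rw [hi, hi', Int.cast_add, Int.cast_one]; linarith
  pos := by
    rw [leftOrd_eq_one_iff]
    change 0 < w.rep n (least n) 0
    rw [rep_least]
    exact w.E_pow_zero_pos (by omega)

theorem isIsolatedPoint_leftOrd : IsIsolatedPoint (w.leftOrd n) :=
  B3.isIsolatedPoint_of_interlaced (w.interlaced_leftOrd n)

theorem exists_E_pow_le {z : ℝ} (hz : 0 ≤ z) {j : ℕ} (h : z < (w.E ^ j) 0) :
    ∃ i < j, (w.E ^ i) 0 ≤ z ∧ z < (w.E ^ (i + 1)) 0 := by
  induction j with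
  | zero => simp at h; linarith
  | succ j ih =>
    by_cases hj : z < (w.E ^ j) 0
    · obtain ⟨i, hi, h⟩ := ih hj
      exact ⟨i, by omega, h⟩
    · exact ⟨j, by omega, not_lt.1 hj, h⟩

/-- The points of the orbit of `0` in an interval of the form `[0, E ^ j 0)` are the obvious ones. -/
theorem exists_eq_e_pow {g : B3} {j : ℕ} (h0 : 0 ≤ w.rep₀ g 0) (h : w.rep₀ g 0 < (w.E ^ j) 0) :
    ∃ i < j, g = B3.e ^ i := by
  obtain ⟨i, hi, h1, h2⟩ := w.exists_E_pow_le h0 h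
  refine ⟨i, hi, ?_⟩
  set g' := (B3.e ^ i)⁻¹ * g
  have hg : g = B3.e ^ i * g' := (mul_inv_cancel_left _ _).symm
  have hr : w.rep₀ g 0 = (w.E ^ i) (w.rep₀ g' 0) := by
    rw [hg, map_mul, deg1_mul_apply, map_pow, rep₀_e]
  rw [hr, (deg1_strictMono _).le_iff_le] at h1
  rw [hr, pow_succ, deg1_mul_apply, (deg1_strictMono _).lt_iff_lt] at h2
  have h3 : w.rep₀ g' 0 = 0 := by
    by_contra h3
    exact w.rep₀_notMem_Ioo g' ⟨lt_of_le_of_ne h1 (Ne.symm h3), h2⟩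
  have h4 := w.eq_t_zpow_of_rep₀ (l := 0) (g := g') (by simpa using h3)
  rw [hg, h4]; simp

/-- Between 0 and E^|6n+1|(0) the full orbit consists of points E^i(0). For such a point to be in
the twisted orbit, the degree forces 6n + 1 to divide i, leaving only i = 0. -/
theorem least_le {g : B3} (h : 0 < w.rep n g 0) : w.rep n (least n) 0 ≤ w.rep n g 0 := by
  by_contra hlt
  rw [not_le, rep_least] at hlt
  rw [rep_eq_rep₀] at h hlt
  obtain ⟨i, hi, hg⟩ := w.exists_eq_e_pow h.le hlt
  have hd := congrArg B3.deg hg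
  simp at hd
  have h2 : (6 * n + 1) ∣ (i : ℤ) := ⟨-B3.deg g, by linarith⟩
  have h3 : (6 * n + 1).natAbs ∣ i := by
    have := Int.natAbs_dvd_natAbs.2 h2
    simpa using this
  have h4 : i = 0 := Nat.eq_zero_of_dvd_of_lt h3 hi
  rw [hg, h4] at h
  simp at h

theorem leftOrd_least_inv_mul (g : B3) (h : (w.leftOrd n).1 g = 1) :
    g = least n ∨ (w.leftOrd n).1 ((least n)⁻¹ * g) = 1 := by
  rw [leftOrd_eq_one_iff] at h
  rcases (w.least_le n h).eq_or_lt with h1 | h1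
  · left
    have : w.rep n ((least n)⁻¹ * g) 0 = 0 := by
      rw [map_mul, deg1_mul_apply, ← h1, ← deg1_mul_apply, ← map_mul]; simp
    rw [← inv_mul_eq_one.1 (w.eq_one_of_rep n this)]
  · right; rwa [leftOrd_inv_mul_eq_one_iff]

theorem leftOrd_least : (w.leftOrd n).1 (least n) = 1 := (w.interlaced_leftOrd n).pos

theorem map_least {m : ℤ} {φ : B3 ≃* B3} (h : w.leftOrd m = (w.leftOrd n).pullback φ) :
    φ (least m) = least n := by
  have h' : ∀ g, (w.leftOrd m).1 g = (w.leftOrd n).1 (φ g) := fun g =>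
    congrFun (congrArg Subtype.val h) g
  have h1 : (w.leftOrd n).1 (φ (least m)) = 1 := by rw [← h', leftOrd_least]
  have h2 : (w.leftOrd m).1 (φ.symm (least n)) = 1 := by
    rw [h', MulEquiv.apply_symm_apply, leftOrd_least]
  rcases w.leftOrd_least_inv_mul n _ h1 with h3 | h3
  · exact h3
  rcases w.leftOrd_least_inv_mul m _ h2 with h4 | h4
  · rw [← h4]; simp
  · rw [h', map_mul, map_inv, MulEquiv.apply_symm_apply] at h4
    have h5 : ((least n)⁻¹ * φ (least m))⁻¹ = (φ (least m))⁻¹ * least n := by group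
    exact ((w.leftOrd n).2.asymm h3 (h5 ▸ h4)).elim

/-- An automorphism sends t to a central element, which dies in the modular group. What remains is
that a power with exponent |6m + 1| equals (αβ)^|6n+1|. -/
theorem dvd_of_map_least {m : ℤ} {φ : B3 ≃* B3} (h : φ (least m) = least n) :
    (6 * m + 1) ∣ (6 * n + 1) := by
  have ht : ∀ l : ℤ, B3.proj (φ (B3.t ^ l)) = 1 := fun l => by
    apply eq_one_of_central
    intro g
    obtain ⟨g, rfl⟩ := B3.proj_surjective g
    obtain ⟨g, rfl⟩ := φ.surjective g
    exact ((((B3.t_comm g).zpow_left l).map φ).map B3.proj)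
  have h1 := congrArg B3.proj h
  rw [least, least, map_mul, map_mul, map_mul, ht, mul_one, map_zpow, map_zpow, map_zpow, map_zpow,
    B3.proj_t, _root_.one_zpow, mul_one, B3.proj_e] at h1
  have h2 := dvd_of_pow_eq (by simp; omega) h1
  rwa [abs_dvd, dvd_abs] at h2

theorem leftOrd_ne_pullback {m : ℤ} (hm : 0 ≤ m) (hn : 0 ≤ n) (hmn : m ≠ n) (φ : B3 ≃* B3) :
    w.leftOrd m ≠ (w.leftOrd n).pullback φ := by
  intro h
  have h1 := w.map_least n h
  have h2 : φ.symm (least n) = least m := by rw [← h1]; simp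
  have := Int.dvd_antisymm (by omega) (by omega) (dvd_of_map_least n h1) (dvd_of_map_least m h2)
  omega

end FarPoint

theorem exists_isolated_leftOrders : ∃ lam : ℕ → LO B3, (∀ n, IsIsolatedPoint (lam n)) ∧
    ∀ m n, m ≠ n → ∀ φ : B3 ≃* B3, lam m ≠ (lam n).pullback φ := by
  obtain ⟨w⟩ := FarPoint.exists_farPoint
  exact ⟨fun n => w.leftOrd n, fun n => w.isIsolatedPoint_leftOrd n, fun m n hmn φ =>
    w.leftOrd_ne_pullback n (by positivity) (by positivity) (by exact_mod_cast hmn) φ⟩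

/-! ### Homeomorphisms of the circle from homeomorphisms of the line -/

theorem btw_coe_iff_le {a b c : ℝ} (hb : b ∈ Set.Ico a (a + 1)) (hc : c ∈ Set.Ioc a (a + 1)) :
    btw (a : UnitAddCircle) b c ↔ b ≤ c := by
  rw [QuotientAddGroup.btw_coe_iff, (toIcoMod_eq_self _).2 hb, (toIocMod_eq_self _).2 hc]

theorem exists_coe_Ico (a : ℝ) (z : UnitAddCircle) : ∃ b ∈ Set.Ico a (a + 1), (b : UnitAddCircle) = z := by
  obtain ⟨b, rfl⟩ := QuotientAddGroup.mk_surjective z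
  refine ⟨toIcoMod one_pos a b, toIcoMod_mem_Ico _ _ _, ?_⟩
  rw [toIcoMod]
  exact (QuotientAddGroup.eq_iff_sub_mem).2 ⟨-toIcoDiv one_pos a b, by simp⟩

theorem coe_eq_coe_iff {a b : ℝ} : (a : UnitAddCircle) = b ↔ ∃ m : ℤ, b = a + m := by
  rw [eq_comm, QuotientAddGroup.eq_iff_sub_mem, AddSubgroup.mem_zmultiples_iff]
  refine exists_congr fun m => ?_
  simp only [zsmul_eq_mul, mul_one]
  constructor <;> intro h <;> linarith

theorem coe_add_int (a : ℝ) (m : ℤ) : ((a + m : ℝ) : UnitAddCircle) = a :=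
  (coe_eq_coe_iff.2 ⟨m, rfl⟩).symm

theorem exists_coe_Ioc (a : ℝ) (z : UnitAddCircle) : ∃ b ∈ Set.Ioc a (a + 1), (b : UnitAddCircle) = z := by
  obtain ⟨b, hb, h⟩ := exists_coe_Ico (-a - 1) (-z)
  have h1 := coe_add_int (-b) 0
  rcases hb.1.eq_or_lt with h0 | h0
  · refine ⟨a + 1, ⟨by linarith, le_rfl⟩, ?_⟩
    have : a + 1 = -b := by linarith
    rw [this, AddCircle.coe_neg, h, neg_neg]
  · exact ⟨-b, ⟨by linarith [hb.2], by linarith⟩, by rw [AddCircle.coe_neg, h, neg_neg]⟩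

theorem deg1_periodic (F : CircleDeg1Liftˣ) :
    Function.Periodic (fun θ => ((F θ : ℝ) : UnitAddCircle)) 1 := fun θ => by
  have : F (θ + 1) = F θ + 1 := CircleDeg1Lift.map_add_one F θ
  simp only [this]
  exact_mod_cast coe_add_int (F θ) 1

/-- The map of the circle induced by a degree one homeomorphism of the line. -/
def circMap (F : CircleDeg1Liftˣ) : UnitAddCircle → UnitAddCircle := (deg1_periodic F).lift

theorem circMap_mul (F F' : CircleDeg1Liftˣ) (z : UnitAddCircle) :
    circMap (F * F') z = circMap F (circMap F' z) := by
  obtain ⟨θ, rfl⟩ := QuotientAddGroup.mk_surjective z; rfl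

theorem circMap_one (z : UnitAddCircle) : circMap 1 z = z := by
  obtain ⟨θ, rfl⟩ := QuotientAddGroup.mk_surjective z; rfl

theorem continuous_circMap (F : CircleDeg1Liftˣ) : Continuous (circMap F) := by
  refine continuous_quot_lift _ ?_
  exact (AddCircle.continuous_mk' (1 : ℝ)).comp (deg1_continuous F)

theorem deg1_map_add_one (F : CircleDeg1Liftˣ) (a : ℝ) : F (a + 1) = F a + 1 :=
  CircleDeg1Lift.map_add_one F a

theorem deg1_map_add_int (F : CircleDeg1Liftˣ) (a : ℝ) (m : ℤ) : F (a + m) = F a + m :=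
  CircleDeg1Lift.map_add_int F a m

theorem btw_circMap (F : CircleDeg1Liftˣ) (u v z : UnitAddCircle) :
    btw (circMap F u) (circMap F v) (circMap F z) ↔ btw u v z := by
  obtain ⟨a, rfl⟩ := QuotientAddGroup.mk_surjective u
  obtain ⟨b, hb, rfl⟩ := exists_coe_Ico a v
  obtain ⟨c, hc, rfl⟩ := exists_coe_Ioc a z
  have hF := deg1_strictMono F
  have h1 := btw_coe_iff_le hb hc
  have h2 : btw ((F a : ℝ) : UnitAddCircle) (F b : ℝ) (F c : ℝ) ↔ F b ≤ F c :=
    btw_coe_iff_le ⟨hF.monotone hb.1, deg1_map_add_one F a ▸ hF hb.2⟩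
      ⟨hF hc.1, deg1_map_add_one F a ▸ hF.monotone hc.2⟩
  exact (h2.trans hF.le_iff_le).trans h1.symm

/-- The homeomorphism of the circle induced by a degree one homeomorphism of the line. -/
def circHom : CircleDeg1Liftˣ →* HomeoPlus where
  toFun F := ⟨{
    toFun := circMap F
    invFun := circMap F⁻¹
    left_inv := fun z => by rw [← circMap_mul, inv_mul_cancel, circMap_one]
    right_inv := fun z => by rw [← circMap_mul, mul_inv_cancel, circMap_one]
    continuous_toFun := continuous_circMap F
    continuous_invFun := continuous_circMap F⁻¹ }, btw_circMap F⟩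
  map_one' := Subtype.ext (Homeomorph.ext circMap_one)
  map_mul' F F' := Subtype.ext (Homeomorph.ext (circMap_mul F F'))

theorem circHom_coe (F : CircleDeg1Liftˣ) (θ : ℝ) :
    (circHom F).1 (θ : UnitAddCircle) = (F θ : ℝ) := rfl

/-- Conjugation by the multiplication by `K`. -/
def scale (K : ℕ) [NeZero K] : CircleDeg1Liftˣ →* CircleDeg1Liftˣ :=
  Units.map
    { toFun := fun F =>
        { toFun := fun θ => F (K * θ) / K
          monotone' := fun a b h => by
            dsimp only
            have := F.monotone (mul_le_mul_of_nonneg_left h (Nat.cast_nonneg (α := ℝ) K))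
            gcongr
          map_add_one' := fun θ => by
            have hK : (K : ℝ) ≠ 0 := Nat.cast_ne_zero.2 (NeZero.ne K)
            rw [mul_add, mul_one, CircleDeg1Lift.map_add_nat]
            field_simp }
      map_one' := by
        have hK : (K : ℝ) ≠ 0 := Nat.cast_ne_zero.2 (NeZero.ne K)
        refine CircleDeg1Lift.ext fun θ => ?_
        change (K * θ) / K = θ
        field_simp
      map_mul' := fun F F' => by
        have hK : (K : ℝ) ≠ 0 := Nat.cast_ne_zero.2 (NeZero.ne K)
        refine CircleDeg1Lift.ext fun θ => ?_
        change F (F' (K * θ)) / K = F (K * (F' (K * θ) / K)) / K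
        congr 2
        field_simp }

theorem tanPt_add_int (θ : ℝ) (m : ℤ) : tanPt (θ + m) = tanPt θ := by
  simpa using tanPt_periodic.int_mul m θ

theorem tanPt_zero : tanPt 0 = basePt := by
  unfold tanPt basePt
  congr 1
  ext i; fin_cases i <;> simp

theorem exists_sin_cos_of_tanPt_eq {θ a b : ℝ} (h : ![a, b] ≠ 0)
    (e : tanPt θ = Projectivization.mk ℝ ![a, b] h) :
    ∃ r : ℝ, r ≠ 0 ∧ r * a = Real.sin (Real.pi * θ) ∧ r * b = Real.cos (Real.pi * θ) := by
  unfold tanPt at e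
  rw [Projectivization.mk_eq_mk_iff] at e
  obtain ⟨r, hr⟩ := e
  exact ⟨r, r.ne_zero, congrFun hr 0, congrFun hr 1⟩

theorem exists_int_of_tanPt_eq {θ : ℝ} (h : tanPt θ = basePt) : ∃ m : ℤ, θ = m := by
  obtain ⟨r, hr, h0, h1⟩ := exists_sin_cos_of_tanPt_eq _ h
  rw [mul_zero] at h0
  obtain ⟨m, hm⟩ := Real.sin_eq_zero_iff.1 h0.symm
  exact ⟨m, by
    have := Real.pi_ne_zero
    apply mul_right_cancel₀ this
    rw [hm]; ring⟩

theorem kCover_coe (K : ℕ) (θ : ℝ) : kCover K θ = tanPt (K * θ) := by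
  rw [kCover, ← AddCircle.coe_nsmul, nsmul_eq_mul]; rfl

namespace FarPoint
variable (w : FarPoint) (n : ℤ)

/-! ### The Fuchsian representation -/

theorem hypRotation_I_sq : (hypRotation UpperHalfPlane.I Real.pi) ^ 2 = 1 := by
  rw [hypRotation, ← map_pow, toPSL2_eq_one_iff]
  right
  change (rotMatrix UpperHalfPlane.I Real.pi).1 ^ 2 = -1
  ext i j
  fin_cases i <;> fin_cases j <;> simp [rotMatrix, pow_two, mul_apply, Fin.sum_univ_two]

theorem hypRotation_cube : (hypRotation w.1 (2 * Real.pi / 3)) ^ 3 = 1 := by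
  rw [hypRotation, ← map_pow, toPSL2_eq_one_iff]
  right
  have h := w.rotMatrix_eq
  change (rotMatrix w.1 (2 * Real.pi / 3)).1 ^ 3 = -1
  rw [h]
  have hs := w.s_sq
  ext i j
  fin_cases i <;> fin_cases j <;> simp [pow_succ, mul_apply, Fin.sum_univ_two]
  · linear_combination (-3 / 2 - w.p) * hs
  · linear_combination (-w.s) * hs
  · linear_combination (w.s) * hs
  · linear_combination (-3 / 2 + w.p) * hs

/-- The representation of the modular group in `PSL(2, ℝ)` by hyperbolic rotations. -/
def fuchs : GBar →* PSL2 ℝ :=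
  GBar.lift (hypRotation UpperHalfPlane.I Real.pi) (hypRotation w.1 (2 * Real.pi / 3))
    hypRotation_I_sq w.hypRotation_cube

@[simp] theorem fuchs_α : w.fuchs gα = hypRotation UpperHalfPlane.I Real.pi := GBar.lift_α _ _ _ _
@[simp] theorem fuchs_β : w.fuchs gβ = hypRotation w.1 (2 * Real.pi / 3) := GBar.lift_β _ _ _ _

theorem tanPt_rep₀ (g : B3) (θ : ℝ) : tanPt (w.rep₀ g θ) = w.fuchs (B3.proj g) • tanPt θ := by
  have hx : ∀ θ, tanPt (X θ) = w.fuchs gα • tanPt θ := fun θ => by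
    rw [fuchs_α]; exact isLineLift_X.tanPt θ
  have hy : ∀ θ, tanPt (w.Y θ) = w.fuchs gβ • tanPt θ := fun θ => by
    rw [fuchs_β]; exact w.isLineLift_Y.tanPt θ
  have inv : ∀ (F : CircleDeg1Liftˣ) (a : GBar), (∀ θ, tanPt (F θ) = w.fuchs a • tanPt θ) →
      ∀ θ, tanPt ((F⁻¹ : CircleDeg1Liftˣ) θ) = w.fuchs a⁻¹ • tanPt θ := fun F a h θ => by
    have h1 := h ((F⁻¹ : CircleDeg1Liftˣ) θ)
    rw [CircleDeg1Lift.units_apply_inv_apply] at h1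
    rw [h1, smul_smul, ← map_mul, inv_mul_cancel, map_one, one_smul]
  refine B3.induction_left (p := fun g => tanPt (w.rep₀ g θ) = w.fuchs (B3.proj g) • tanPt θ)
    g (by simp) ?_ ?_ ?_ ?_ <;> intro g hg
  · rw [map_mul, map_mul, map_mul, deg1_mul_apply, rep₀_x, hx, hg, smul_smul, B3.proj_x]
  · rw [map_mul, map_mul, map_mul, deg1_mul_apply, map_inv, rep₀_x, inv X gα hx, hg, smul_smul,
      map_inv B3.proj, B3.proj_x]
  · rw [map_mul, map_mul, map_mul, deg1_mul_apply, rep₀_y, hy, hg, smul_smul, B3.proj_y]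
  · rw [map_mul, map_mul, map_mul, deg1_mul_apply, map_inv, rep₀_y, inv w.Y gβ hy, hg, smul_smul,
      map_inv B3.proj, B3.proj_y]

/-- An element acting trivially on the boundary moves 0 to an integer on the line. -/
theorem exists_eq_t_zpow_of_fuchs {g : B3} (h : w.fuchs (B3.proj g) = 1) : ∃ l : ℤ, g = B3.t ^ l := by
  have h1 := w.tanPt_rep₀ g 0
  rw [h, one_smul, tanPt_zero] at h1
  obtain ⟨l, hl⟩ := exists_int_of_tanPt_eq h1
  exact ⟨l, w.eq_t_zpow_of_rep₀ hl⟩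

theorem fuchs_injective : Function.Injective w.fuchs := by
  rw [injective_iff_map_eq_one]
  intro g h
  obtain ⟨g, rfl⟩ := B3.proj_surjective g
  obtain ⟨l, rfl⟩ := w.exists_eq_t_zpow_of_fuchs h
  rw [map_zpow, B3.proj_t, _root_.one_zpow]

theorem rep₀_notMem_Ioo_neg (g : B3) : w.rep₀ g 0 ∉ Set.Ioo (w.F (1 / 2) - 1 / 2) 0 := by
  rintro ⟨h1, h2⟩
  have hF := w.F_zero_pos
  have hE := w.E_zero_pos
  have hF' : w.F 0 < w.F (1 / 2) := deg1_strictMono _ (by norm_num)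
  have hEF := w.E_half_lt_F_zero
  rcases w.orbit_cases g with ⟨m, rfl⟩ | ⟨m, ζ, hζ, h⟩
  · rw [rep₀_x_zpow_apply] at h1 h2
    have h3 : (m : ℝ) < 0 := by linarith
    have h4 : (m : ℝ) ≤ -1 := by
      have : m < 0 := by exact_mod_cast h3
      exact_mod_cast (by omega : m ≤ -1)
    linarith
  · have hb : w.rep₀ g 0 - m / 2 ∈ Set.Icc 0 (w.F (1 / 2)) := by
      have e1 := (deg1_strictMono w.E).monotone hζ.1
      have e2 := (deg1_strictMono w.E).monotone hζ.2
      have f1 := (deg1_strictMono w.F).monotone hζ.1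
      have f2 := (deg1_strictMono w.F).monotone hζ.2
      rcases h with h | h <;> rw [h] <;> constructor <;> linarith
    rcases le_or_gt 0 m with h3 | h3
    · have : (0 : ℝ) ≤ m := by exact_mod_cast h3
      linarith [hb.1]
    · have h4 : (m : ℝ) ≤ -1 := by exact_mod_cast (by omega : m ≤ -1)
      linarith [hb.2]

theorem exists_isolating : ∃ δ : ℝ, 0 < δ ∧ δ < 1 / 2 ∧ ∀ (g : B3) (m : ℤ),
    |w.rep₀ g 0 - m| < δ → w.rep₀ g 0 = m := by
  have hE := w.E_zero_pos
  have hF := w.F_half_lt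
  have hE2 := w.E_half_lt
  have hE3 : w.E 0 < w.E (1 / 2) := deg1_strictMono _ (by norm_num)
  refine ⟨min (w.E 0) (1 / 2 - w.F (1 / 2)), by simp; constructor <;> linarith, ?_, fun g m h => ?_⟩
  · exact (min_le_left _ _).trans_lt (by linarith)
  · rw [lt_min_iff, abs_lt, abs_lt] at h
    have h1 : w.rep₀ (B3.t ^ (-m) * g) 0 = w.rep₀ g 0 - m := by
      rw [map_mul, deg1_mul_apply, rep₀_t_zpow, tr_apply]; push_cast; ring
    rcases lt_trichotomy (w.rep₀ g 0 - m) 0 with h2 | h2 | h2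
    · exact (w.rep₀_notMem_Ioo_neg _ ⟨by rw [h1]; linarith, by rw [h1]; exact h2⟩).elim
    · linarith
    · exact (w.rep₀_notMem_Ioo _ ⟨by rw [h1]; exact h2, by rw [h1]; linarith⟩).elim

/-- A matrix close to ±1 moves the boundary point 0 only slightly, while 0 is isolated in its orbit.
So an image close to the identity fixes the boundary point 0 and is trivial by freeness. -/
theorem discrete_fuchs : DiscreteTopology w.fuchs.range := by
  obtain ⟨δ, h0, h1, hδ⟩ := w.exists_isolating
  set c := Real.sin (Real.pi * δ) with hc
  have hpi := Real.pi_pos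
  have hc0 : 0 < c := Real.sin_pos_of_pos_of_lt_pi (by positivity) (by nlinarith)
  -- An open condition saying that M sends 0 close to 0; the strict inequality bounds |sin(πθ)| by c
  -- for any lift θ of the image point.
  let U : Set (SpecialLinearGroup (Fin 2) ℝ) := {M | |M.1 0 1| < c * |M.1 1 1|}
  have hU : IsOpen U := by
    have hcont : ∀ i j, Continuous fun M : SpecialLinearGroup (Fin 2) ℝ => M.1 i j := fun i j =>
      (continuous_subtype_val.matrix_elem i j)
    exact isOpen_lt (hcont 0 1).abs (continuous_const.mul (hcont 1 1).abs)
  have hV : IsOpen ((toPSL2 : SpecialLinearGroup (Fin 2) ℝ → PSL2 ℝ) '' U) :=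
    QuotientGroup.isOpenMap_coe U hU
  refine discreteTopology_of_isOpen_singleton_one ?_
  have : ({1} : Set w.fuchs.range) = Subtype.val ⁻¹' ((toPSL2 : SpecialLinearGroup (Fin 2) ℝ → PSL2 ℝ) '' U) := by
    ext ⟨a, g, rfl⟩
    constructor
    · intro h
      have h2 : w.fuchs g = 1 := congrArg Subtype.val h
      exact ⟨1, by simp [U, hc0], by simp [h2]⟩
    · rintro ⟨M, hM, e⟩
      obtain ⟨g, rfl⟩ := B3.proj_surjective g
      have h2 := w.tanPt_rep₀ g 0
      change toPSL2 M = w.fuchs (B3.proj g) at e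
      have h3 : toPSL2 M • basePt = M • basePt := rfl
      have hv : M.1 *ᵥ ![0, 1] = ![M.1 0 1, M.1 1 1] := by
        ext i; fin_cases i <;> simp [mulVec, dotProduct, Fin.sum_univ_two]
      have hne : ![M.1 0 1, M.1 1 1] ≠ 0 := by
        intro h
        have e0 : M.1 0 1 = 0 := by simpa using congrFun h 0
        have e1 : M.1 1 1 = 0 := by simpa using congrFun h 1
        have := M.2
        rw [det_fin_two, e0, e1] at this
        simp at this
      have h4 : M • basePt = Projectivization.mk ℝ ![M.1 0 1, M.1 1 1] hne := by
        unfold basePt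
        rw [Projectivization.smul_mk]
        congr 1
      rw [← e, tanPt_zero, h3, h4] at h2
      obtain ⟨r, hr, hs, hcs⟩ := exists_sin_cos_of_tanPt_eq _ h2
      set θ := w.rep₀ g 0 with hθ
      have h5 : |Real.sin (Real.pi * θ)| < c := by
        rw [← hs, abs_mul]
        have h6 : |r| * |M.1 1 1| ≤ 1 := by
          rw [← abs_mul, hcs]; exact Real.abs_cos_le_one _
        have h7 := abs_pos.2 hr
        calc |r| * |M.1 0 1| < |r| * (c * |M.1 1 1|) := by gcongr; exact hM
          _ = c * (|r| * |M.1 1 1|) := by ring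
          _ ≤ c * 1 := by gcongr
          _ = c := mul_one c
      have h8 : |Real.sin (Real.pi * (θ - round θ))| < c := by
        rw [mul_sub, mul_comm Real.pi (round θ : ℝ), Real.sin_sub_int_mul_pi, abs_mul, abs_zpow,
          abs_neg, abs_one, _root_.one_zpow, one_mul]
        exact h5
      have h9 := abs_sub_round θ
      have h10 : |θ - round θ| < δ := by
        by_contra hcon
        rw [not_lt] at hcon
        have e1 : Real.sin (Real.pi * δ) ≤ Real.sin (Real.pi * |θ - round θ|) := by
          apply Real.sin_le_sin_of_le_of_le_pi_div_two
          · nlinarith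
          · nlinarith
          · gcongr
        have e2 : Real.sin (Real.pi * |θ - round θ|) ≤ |Real.sin (Real.pi * (θ - round θ))| := by
          rcases abs_choice (θ - round θ) with h | h <;> rw [h]
          · exact le_abs_self _
          · rw [mul_neg, Real.sin_neg]; exact neg_le_abs _
        linarith
      have h11 := w.eq_t_zpow_of_rep₀ (hδ g _ h10)
      simp [h11]
  rw [this]
  exact hV.preimage continuous_subtype_val

theorem isFuchsian_fuchs : IsFuchsian w.fuchs := ⟨w.fuchs_injective, w.discrete_fuchs⟩

theorem exists_eq_t_zpow_of_proj (w : FarPoint) {g : B3} (h : B3.proj g = 1) : ∃ l : ℤ, g = B3.t ^ l :=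
  w.exists_eq_t_zpow_of_fuchs (by rw [h, map_one])

/-! ### The lifts of the boundary action -/

/-- The degree of the covering. -/
abbrev covDeg (n : ℤ) : ℕ := (6 * n + 1).natAbs

instance (n : ℤ) : NeZero (covDeg n) := ⟨by unfold covDeg; omega⟩

theorem covDeg_pos : (0 : ℝ) < covDeg n := by
  have := NeZero.pos (covDeg n)
  exact_mod_cast this

theorem sign_mul_covDeg : ((6 * n + 1).sign * covDeg n : ℤ) = 6 * n + 1 := Int.sign_mul_natAbs _

/-- The action of the braid group on the line corresponding to the covering of degree `|6 n + 1|`. -/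
def srep : B3 →* CircleDeg1Liftˣ := (scale (covDeg n)).comp (w.rep n)

theorem srep_apply (g : B3) (θ : ℝ) : w.srep n g θ = w.rep n g (covDeg n * θ) / covDeg n := rfl

theorem srep_t_zpow (m : ℤ) (θ : ℝ) : w.srep n (B3.t ^ m) θ = θ + ((6 * n + 1).sign * m : ℤ) := by
  rw [srep_apply, rep_t_zpow_apply]
  have h := covDeg_pos n
  have h2 : ((6 * n + 1 : ℤ) : ℝ) = ((6 * n + 1).sign : ℤ) * (covDeg n : ℝ) := by
    rw [← Int.cast_natCast (covDeg n), ← Int.cast_mul, sign_mul_covDeg]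
  rw [Int.cast_mul, h2]
  push_cast
  field_simp

theorem circHom_srep_t : circHom (w.srep n B3.t) = 1 := by
  refine Subtype.ext (Homeomorph.ext fun z => ?_)
  obtain ⟨θ, rfl⟩ := QuotientAddGroup.mk_surjective z
  have h := w.srep_t_zpow n 1 θ
  rw [_root_.zpow_one] at h
  change ((w.srep n B3.t θ : ℝ) : UnitAddCircle) = θ
  rw [h, coe_add_int]

/-- The lift of the boundary action to the covering of degree `|6 n + 1|`. -/
def circRep : GBar →* HomeoPlus :=
  GBar.lift (circHom (w.srep n B3.x)) (circHom (w.srep n B3.y))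
    (by rw [← map_pow, ← map_pow, B3.x_sq, circHom_srep_t])
    (by rw [← map_pow, ← map_pow, B3.y_cube, circHom_srep_t])

theorem circRep_proj (g : B3) : w.circRep n (B3.proj g) = circHom (w.srep n g) := by
  have : (w.circRep n).comp B3.proj = circHom.comp (w.srep n) := by
    apply B3.hom_ext
    · simp [circRep]
    · simp [circRep]
  exact DFunLike.congr_fun this g

theorem circRep_proj_coe (g : B3) (θ : ℝ) :
    (w.circRep n (B3.proj g)).1 (θ : UnitAddCircle) = (w.srep n g θ : ℝ) := by
  rw [circRep_proj]; rfl

/-- The twist is by integer translations, which are invisible on the boundary, so the rescaled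
action still covers that of `fuchs`. -/
theorem isKFoldLift_circRep : IsKFoldLift w.fuchs (covDeg n) (w.circRep n) := by
  intro g z
  obtain ⟨g, rfl⟩ := B3.proj_surjective g
  obtain ⟨θ, rfl⟩ := QuotientAddGroup.mk_surjective z
  rw [circRep_proj_coe, kCover_coe, kCover_coe, ← tanPt_rep₀, srep_apply,
    mul_div_cancel₀ _ (covDeg_pos n).ne', rep_apply, tanPt_add_int]

end FarPoint

/-! ### The cyclic order of the circle -/

theorem btw_coe_iff_of_mem {m a b c : ℝ} (ha : a ∈ Set.Ico m (m + 1)) (hb : b ∈ Set.Ico m (m + 1))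
    (hc : c ∈ Set.Ico m (m + 1)) : btw (a : UnitAddCircle) b c ↔
      (a ≤ b ∧ b ≤ c) ∨ (b ≤ c ∧ c ≤ a) ∨ (c ≤ a ∧ a ≤ b) := by
  obtain ⟨ha1, ha2⟩ := ha
  obtain ⟨hb1, hb2⟩ := hb
  obtain ⟨hc1, hc2⟩ := hc
  have hb' : ((b + 1 : ℝ) : UnitAddCircle) = b := by exact_mod_cast coe_add_int b 1
  have hc' : ((c + 1 : ℝ) : UnitAddCircle) = c := by exact_mod_cast coe_add_int c 1
  rcases le_or_gt a b with h1 | h1 <;> rcases lt_or_ge a c with h2 | h2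
  · rw [btw_coe_iff_le ⟨h1, by linarith⟩ ⟨h2, by linarith⟩]
    exact ⟨fun h => Or.inl ⟨h1, h⟩, by rintro (⟨_, h⟩ | ⟨h, h'⟩ | ⟨h, _⟩) <;> linarith⟩
  · rw [← hc', btw_coe_iff_le ⟨h1, by linarith⟩ ⟨by linarith, by linarith⟩]
    exact ⟨fun _ => Or.inr (Or.inr ⟨h2, h1⟩), fun _ => by linarith⟩
  · rw [← hb', btw_coe_iff_le ⟨by linarith, by linarith⟩ ⟨h2, by linarith⟩]
    exact ⟨fun _ => by linarith, by rintro (⟨h, h'⟩ | ⟨h, h'⟩ | ⟨h, _⟩) <;> linarith⟩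
  · rw [← hb', ← hc', btw_coe_iff_le ⟨by linarith, by linarith⟩ ⟨by linarith, by linarith⟩]
    refine ⟨fun h => Or.inr (Or.inl ⟨by linarith, h2⟩), ?_⟩
    rintro (⟨h, h'⟩ | ⟨h, h'⟩ | ⟨h, _⟩) <;> linarith

/-- On a fundamental interval the circular sign is the coboundary of the sign of the difference;
this turns the cocycle identity into linear algebra. -/
theorem circleSign_coe {m a b c : ℝ} (ha : a ∈ Set.Ico m (m + 1)) (hb : b ∈ Set.Ico m (m + 1))
    (hc : c ∈ Set.Ico m (m + 1)) : (circleSign a b c : ℤ) =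
      (SignType.sign (b - a) : ℤ) + (SignType.sign (c - b) : ℤ) - (SignType.sign (c - a) : ℤ) := by
  rw [circleSign, sbtw_iff_btw_not_btw, sbtw_iff_btw_not_btw, btw_coe_iff_of_mem ha hb hc,
    btw_coe_iff_of_mem hc hb ha]
  rcases lt_trichotomy a b with h1 | h1 | h1 <;> rcases lt_trichotomy b c with h2 | h2 | h2 <;>
    rcases lt_trichotomy a c with h3 | h3 | h3 <;> first | (exfalso; linarith) | skip
  all_goals
    simp [h1, h2, h3, h1.le, h2.le, h3.le, not_le, sign_pos, sign_neg, sub_pos.2, sub_neg.2]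

theorem exists_coe_three (x y z : UnitAddCircle) : ∃ a ∈ Set.Ico (0 : ℝ) (0 + 1),
    ∃ b ∈ Set.Ico (0 : ℝ) (0 + 1), ∃ c ∈ Set.Ico (0 : ℝ) (0 + 1),
      (a : UnitAddCircle) = x ∧ (b : UnitAddCircle) = y ∧ (c : UnitAddCircle) = z := by
  obtain ⟨a, ha, rfl⟩ := exists_coe_Ico 0 x
  obtain ⟨b, hb, rfl⟩ := exists_coe_Ico 0 y
  obtain ⟨c, hc, rfl⟩ := exists_coe_Ico 0 z
  exact ⟨a, ha, b, hb, c, hc, rfl, rfl, rfl⟩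

theorem coe_inj_of_mem {m a b : ℝ} (ha : a ∈ Set.Ico m (m + 1)) (hb : b ∈ Set.Ico m (m + 1)) :
    (a : UnitAddCircle) = b ↔ a = b := by
  refine ⟨fun h => ?_, fun h => by rw [h]⟩
  obtain ⟨l, rfl⟩ := coe_eq_coe_iff.1 h
  have h1 : (l : ℝ) < 1 := by linarith [ha.1, hb.2]
  have h2 : (-1 : ℝ) < l := by linarith [ha.2, hb.1]
  have h3 : l < 1 := by exact_mod_cast h1
  have h4 : -1 < l := by exact_mod_cast h2
  rw [show l = 0 by omega]; simp

theorem circleSign_eq_zero_iff (x y z : UnitAddCircle) :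
    circleSign x y z = 0 ↔ x = y ∨ y = z ∨ x = z := by
  obtain ⟨a, ha, b, hb, c, hc, rfl, rfl, rfl⟩ := exists_coe_three x y z
  have h := circleSign_coe ha hb hc
  have h0 : circleSign (a : UnitAddCircle) b c = 0 ↔ (circleSign (a : UnitAddCircle) b c : ℤ) = 0 := by
    cases circleSign (a : UnitAddCircle) b c <;> simp
  rw [h0, h, coe_inj_of_mem ha hb, coe_inj_of_mem hb hc, coe_inj_of_mem ha hc]
  rcases lt_trichotomy a b with h1 | h1 | h1 <;> rcases lt_trichotomy b c with h2 | h2 | h2 <;>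
    rcases lt_trichotomy a c with h3 | h3 | h3 <;> first | (exfalso; linarith) | skip
  all_goals
    simp [h1, h2, h3, LT.lt.ne, LT.lt.ne', sign_pos, sign_neg, sub_pos.2, sub_neg.2]

theorem circleSign_cocycle (x y z v : UnitAddCircle) :
    (circleSign y z v : ℤ) - circleSign x z v + circleSign x y v - circleSign x y z = 0 := by
  obtain ⟨a, ha, b, hb, c, hc, rfl, rfl, rfl⟩ := exists_coe_three x y z
  obtain ⟨d, hd, rfl⟩ := exists_coe_Ico 0 v
  rw [circleSign_coe ha hb hc, circleSign_coe hb hc hd, circleSign_coe ha hc hd,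
    circleSign_coe ha hb hd]
  ring

theorem circleSign_map (F : HomeoPlus) (x y z : UnitAddCircle) :
    circleSign (F.1 x) (F.1 y) (F.1 z) = circleSign x y z := by
  have h : ∀ x y z, btw (F.1 x) (F.1 y) (F.1 z) ↔ btw x y z := F.2
  have hs : ∀ x y z, sbtw (F.1 x) (F.1 y) (F.1 z) ↔ sbtw x y z := fun x y z => by
    rw [sbtw_iff_btw_not_btw, sbtw_iff_btw_not_btw, h, h]
  simp only [circleSign]
  congr 1
  · exact propext (hs x y z)
  · congr 1
    exact propext (hs z y x)

/-- The circular order on a group acting on the circle given by the orbit of a free point. -/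
def CO.ofOrbit {G : Type*} [Group G] (ρ : G →* HomeoPlus) (y : UnitAddCircle)
    (h : ∀ g, (ρ g).1 y = y → g = 1) : CO G :=
  ⟨fun g₁ g₂ g₃ => circleSign ((ρ g₁).1 y) ((ρ g₂).1 y) ((ρ g₃).1 y),
    { eq_zero_iff := fun g₁ g₂ g₃ => by
        have hi : ∀ g g', (ρ g).1 y = (ρ g').1 y ↔ g = g' := fun g g' => by
          refine ⟨fun e => ?_, fun e => by rw [e]⟩
          have : (ρ (g'⁻¹ * g)).1 y = y := by
            rw [map_mul, map_inv]
            change (ρ g').1.symm ((ρ g).1 y) = y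
            rw [e]; exact (ρ g').1.symm_apply_apply y
          exact (inv_mul_eq_one.1 (h _ this)).symm
        rw [circleSign_eq_zero_iff, hi, hi, hi]
      cocycle := fun _ _ _ _ => circleSign_cocycle _ _ _ _
      left_inv := fun g₄ g₁ g₂ g₃ => by
        simp only [map_mul]
        exact circleSign_map (ρ g₄) _ _ _ }⟩

/-! ### Arcs of the circle -/

theorem isOpen_coe_image {U : Set ℝ} (hU : IsOpen U) :
    IsOpen ((fun a : ℝ => (a : UnitAddCircle)) '' U) := QuotientAddGroup.isOpenMap_coe U hU

theorem continuous_coe_circle : Continuous fun a : ℝ => (a : UnitAddCircle) :=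
  AddCircle.continuous_mk' 1

theorem isPreconnected_arc (a b : ℝ) :
    IsPreconnected ((fun a : ℝ => (a : UnitAddCircle)) '' Set.Ioo a b) :=
  isPreconnected_Ioo.image _ continuous_coe_circle.continuousOn

/-- A connected subset of the circle that avoids the end points of an arc and meets the arc lies
in the arc. -/
theorem IsPreconnected.subset_arc {S : Set UnitAddCircle} (hS : IsPreconnected S) {a b c : ℝ}
    (hab : b < a + 1) (ha : (a : UnitAddCircle) ∉ S) (hb : (b : UnitAddCircle) ∉ S)
    (hc : c ∈ Set.Ioo a b) (hcS : (c : UnitAddCircle) ∈ S) :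
    S ⊆ (fun a : ℝ => (a : UnitAddCircle)) '' Set.Ioo a b := by
  refine hS.subset_left_of_subset_union (isOpen_coe_image isOpen_Ioo)
    (isOpen_coe_image (isOpen_Ioo (a := b) (b := a + 1))) ?_ ?_ ⟨c, hcS, c, hc, rfl⟩
  · rw [Set.disjoint_left]
    rintro _ ⟨u, hu, rfl⟩ ⟨v, hv, e⟩
    have := (coe_inj_of_mem (m := a) ⟨by linarith [hv.1, hc.1, hc.2], hv.2⟩
      ⟨hu.1.le, by linarith [hu.2]⟩).1 e
    linarith [hu.2, hv.1]
  · intro z hz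
    obtain ⟨d, hd, rfl⟩ := exists_coe_Ico a z
    have h1 : a ≠ d := by rintro rfl; exact ha hz
    have h2 : d ≠ b := by rintro rfl; exact hb hz
    rcases lt_or_gt_of_ne h2 with h | h
    · exact Or.inl ⟨d, ⟨lt_of_le_of_ne hd.1 h1, h⟩, rfl⟩
    · exact Or.inr ⟨d, ⟨h, hd.2⟩, rfl⟩

/-- If the limit points of a set outside the set are limits from both sides, then the boundary points
of the components of the complement of its closure lie in the set. -/
theorem frontier_component_subset {O : Set UnitAddCircle}
    (hO : ∀ ζ : ℝ, (ζ : UnitAddCircle) ∈ closure O → (ζ : UnitAddCircle) ∉ O → ∀ ε > 0,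
      (∃ a ∈ Set.Ioo (ζ - ε) ζ, (a : UnitAddCircle) ∈ O) ∧
        ∃ a ∈ Set.Ioo ζ (ζ + ε), (a : UnitAddCircle) ∈ O)
    {x : UnitAddCircle} (hx : x ∈ (closure O)ᶜ) :
    frontier (connectedComponentIn (closure O)ᶜ x) ⊆ O := by
  set U := (closure O)ᶜ with hU
  set C := connectedComponentIn U x with hC
  have hUo : IsOpen U := isClosed_closure.isOpen_compl
  have hCp : IsPreconnected C := isPreconnected_connectedComponentIn
  have hCU : C ⊆ U := connectedComponentIn_subset _ _
  have hxC : x ∈ C := mem_connectedComponentIn hx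
  rintro z ⟨hz1, hz2⟩
  by_contra hzO
  obtain ⟨ζ, rfl⟩ := QuotientAddGroup.mk_surjective z
  change (ζ : UnitAddCircle) ∈ closure C at hz1
  change (ζ : UnitAddCircle) ∉ interior C at hz2
  change (ζ : UnitAddCircle) ∉ O at hzO
  by_cases hzU : (ζ : UnitAddCircle) ∈ U
  -- Off the closure of O, a small arc around ζ meets C, hence lies in C, and ζ would be interior.
  · apply hz2
    obtain ⟨ε, hε, hball⟩ := Metric.isOpen_iff.1 (hUo.preimage continuous_coe_circle) ζ hzU
    rw [Real.ball_eq_Ioo] at hball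
    set A := (fun a : ℝ => (a : UnitAddCircle)) '' Set.Ioo (ζ - ε) (ζ + ε)
    have hA : IsOpen A := isOpen_coe_image isOpen_Ioo
    have hzA : (ζ : UnitAddCircle) ∈ A := ⟨ζ, ⟨by linarith, by linarith⟩, rfl⟩
    obtain ⟨p, hpA, hpC⟩ := mem_closure_iff.1 hz1 A hA hzA
    have hAC : A ⊆ C := by
      rw [hC, connectedComponentIn_eq hpC]
      exact (isPreconnected_arc _ _).subset_connectedComponentIn hpA (Set.image_subset_iff.2 hball)
    exact mem_interior.2 ⟨A, hAC, hA, hzA⟩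
  · have hzc : (ζ : UnitAddCircle) ∈ closure O := not_not.1 hzU
    obtain ⟨ξ, hξ, rfl⟩ := exists_coe_Ico ζ x
    have hne : ζ ≠ ξ := by rintro rfl; exact hx hzc
    have hlt : ζ < ξ := lt_of_le_of_ne hξ.1 hne
    -- Points of O just after ζ and just before ζ + 1 enclose ξ and trap C in an arc whose closure
    -- avoids ζ.
    obtain ⟨a, ha, haO⟩ := (hO ζ hzc hzO (ξ - ζ) (by linarith)).2
    obtain ⟨b, hb, hbO⟩ := (hO ζ hzc hzO (ζ + 1 - ξ) (by linarith [hξ.2])).1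
    have hbO' : ((b + 1 : ℝ) : UnitAddCircle) ∈ O := by
      have := coe_add_int b 1
      rw [Int.cast_one] at this
      rwa [this]
    have hsub : C ⊆ (fun a : ℝ => (a : UnitAddCircle)) '' Set.Ioo a (b + 1) :=
      hCp.subset_arc (c := ξ) (by linarith [ha.1, hb.2]) (fun h => hCU h (subset_closure haO))
        (fun h => hCU h (subset_closure hbO')) ⟨by linarith [ha.2], by linarith [hb.1]⟩ hxC
    have hcl : closure C ⊆ (fun a : ℝ => (a : UnitAddCircle)) '' Set.Icc a (b + 1) :=
      closure_minimal (hsub.trans (Set.image_mono Set.Ioo_subset_Icc_self))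
        (isCompact_Icc.image continuous_coe_circle).isClosed
    obtain ⟨d, hd, e⟩ := hcl hz1
    have := (coe_inj_of_mem (m := ζ) ⟨by linarith [ha.1, hd.1], by linarith [hb.2, hd.2]⟩
      ⟨le_rfl, by linarith⟩).1 e
    linarith [ha.1, hd.1]

/-! ### Rotations commuting with an action -/

theorem subgroupOrbit_map {G : Type*} [Group G] {ρ : G →* HomeoPlus} {R : UnitAddCircle ≃ₜ UnitAddCircle}
    (hR : ∀ g z, (ρ g).1 (R z) = R ((ρ g).1 z)) (y : UnitAddCircle) (H : Subgroup G) :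
    subgroupOrbit ρ (R y) H = R '' subgroupOrbit ρ y H := by
  ext z
  constructor
  · rintro ⟨g, hg, rfl⟩
    exact ⟨_, ⟨g, hg, rfl⟩, (hR g y).symm⟩
  · rintro ⟨_, ⟨g, hg, rfl⟩, rfl⟩
    exact ⟨g, hg, (hR g y).symm⟩

theorem IsTightAt.map {G : Type*} [Group G] {ρ : G →* HomeoPlus} {R : UnitAddCircle ≃ₜ UnitAddCircle}
    (hR : ∀ g z, (ρ g).1 (R z) = R ((ρ g).1 z)) {y : UnitAddCircle} (h : IsTightAt ρ y) :
    IsTightAt ρ (R y) := by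
  refine ⟨fun g hg => h.1 g (R.injective (by rw [← hR, hg])), fun x hx => ?_⟩
  rw [subgroupOrbit_map hR, ← R.image_closure, ← Set.image_compl_eq R.bijective] at hx ⊢
  obtain ⟨x, hx, rfl⟩ := hx
  rw [← R.image_connectedComponentIn hx, ← R.image_frontier]
  exact Set.image_mono (h.2 x hx)

namespace FarPoint
variable (w : FarPoint) (n : ℤ)

/-! ### The circular orders -/

theorem srep_zero (g : B3) : w.srep n g 0 = w.rep n g 0 / covDeg n := by
  rw [srep_apply, mul_zero]

/-- Fixing the base point on the circle means that `rep n g 0` is a multiple of |6n + 1|, and then g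
is a power of t. -/
theorem circRep_free (g : GBar) (h : (w.circRep n g).1 ((0 : ℝ) : UnitAddCircle) = ((0 : ℝ) : UnitAddCircle)) :
    g = 1 := by
  obtain ⟨g, rfl⟩ := B3.proj_surjective g
  rw [circRep_proj_coe, coe_eq_coe_iff, srep_zero] at h
  obtain ⟨m, hm⟩ := h
  have hK := covDeg_pos n
  have h2 : ((6 * n + 1 : ℤ) : ℝ) = ((6 * n + 1).sign : ℤ) * (covDeg n : ℝ) := by
    rw [← Int.cast_natCast (covDeg n), ← Int.cast_mul, sign_mul_covDeg]
  have hs : (((6 * n + 1).sign : ℤ) : ℝ) * ((6 * n + 1).sign : ℤ) = 1 := by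
    have : (6 * n + 1).sign * (6 * n + 1).sign = 1 := by
      rcases Int.sign_trichotomy (6 * n + 1) with h | h | h
      · rw [h]; rfl
      · rw [Int.sign_eq_zero_iff_zero] at h; omega
      · rw [h]; rfl
    exact_mod_cast this
  have h3 : w.rep n g 0 = ((6 * n + 1) * ((6 * n + 1).sign * (-m)) : ℤ) := by
    rw [Int.cast_mul, h2, Int.cast_mul]
    have : w.rep n g 0 = - m * covDeg n := by
      field_simp at hm; linarith
    rw [this]
    push_cast
    linear_combination (m * (covDeg n : ℝ)) * hs
  rw [w.eq_t_zpow_of_rep n h3, map_zpow, B3.proj_t, _root_.one_zpow]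

/-- The circular order on the modular group given by the orbit of `0` in the `|6 n + 1|`-fold lift. -/
def circOrd : CO GBar := CO.ofOrbit (w.circRep n) ((0 : ℝ) : UnitAddCircle) (w.circRep_free n)

theorem add_mul_mem_orb {z : ℝ} (hz : z ∈ w.orb n) (m : ℤ) : z + covDeg n * m ∈ w.orb n := by
  obtain ⟨g, rfl⟩ := hz
  refine ⟨B3.t ^ ((6 * n + 1).sign * m) * g, ?_⟩
  simp only
  rw [map_mul, deg1_mul_apply, rep_t_zpow_apply]
  congr 1
  have : (6 * n + 1) * ((6 * n + 1).sign * m) = covDeg n * m := by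
    rw [← mul_assoc, Int.mul_sign_self]
  rw [this, Int.cast_mul, Int.cast_natCast]

theorem coe_mem_orbit_iff (ζ : ℝ) :
    (ζ : UnitAddCircle) ∈ subgroupOrbit (w.circRep n) ((0 : ℝ) : UnitAddCircle) ⊤ ↔
      covDeg n * ζ ∈ w.orb n := by
  have hK := covDeg_pos n
  constructor
  · rintro ⟨g, -, hg⟩
    obtain ⟨g, rfl⟩ := B3.proj_surjective g
    rw [circRep_proj_coe, eq_comm, coe_eq_coe_iff, srep_zero] at hg
    obtain ⟨m, rfl⟩ := hg
    rw [mul_add, mul_div_cancel₀ _ hK.ne']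
    exact w.add_mul_mem_orb n ⟨g, rfl⟩ m
  · rintro ⟨g, hg⟩
    refine ⟨B3.proj g, trivial, ?_⟩
    simp only at hg
    rw [circRep_proj_coe, srep_zero, hg, mul_div_cancel_left₀ _ hK.ne']

theorem isTightAt_zero : IsTightAt (w.circRep n) ((0 : ℝ) : UnitAddCircle) := by
  have hK := covDeg_pos n
  refine ⟨w.circRep_free n, fun x hx => frontier_component_subset (fun ζ h1 h2 ε hε => ?_) hx⟩
  set O := subgroupOrbit (w.circRep n) ((0 : ℝ) : UnitAddCircle) ⊤
  have hpre : (fun a : ℝ => (a : UnitAddCircle)) ⁻¹' O = (fun a : ℝ => covDeg n * a) ⁻¹' w.orb n :=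
    Set.ext fun ζ => w.coe_mem_orbit_iff n ζ
  have h3 : ζ ∈ closure ((fun a : ℝ => (a : UnitAddCircle)) ⁻¹' O) := by
    have := IsOpenMap.preimage_closure_subset_closure_preimage
      (f := fun a : ℝ => (a : UnitAddCircle)) QuotientAddGroup.isOpenMap_coe (s := O)
    exact this h1
  rw [hpre] at h3
  have h4 : covDeg n * ζ ∈ closure (w.orb n) :=
    Continuous.closure_preimage_subset (continuous_const.mul continuous_id) _ h3
  have h5 : covDeg n * ζ ∉ w.orb n := fun h => h2 ((w.coe_mem_orbit_iff n ζ).2 h)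
  obtain ⟨⟨a, ha, ha'⟩, b, hb, hb'⟩ := w.exists_orb_near n h4 h5 (mul_pos hK hε)
  have hmul : ∀ c : ℝ, covDeg n * (c / covDeg n) = c := fun c => mul_div_cancel₀ _ hK.ne'
  refine ⟨⟨a / covDeg n, ⟨?_, ?_⟩, ?_⟩, b / covDeg n, ⟨?_, ?_⟩, ?_⟩
  · rw [lt_div_iff₀ hK]; linarith [ha'.1]
  · rw [div_lt_iff₀ hK]; linarith [ha'.2]
  · rw [w.coe_mem_orbit_iff n, hmul]; exact ha
  · rw [lt_div_iff₀ hK]; linarith [hb'.1]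
  · rw [div_lt_iff₀ hK]; linarith [hb'.2]
  · rw [w.coe_mem_orbit_iff n, hmul]; exact hb

theorem circRep_add (m : ℤ) (g : GBar) (z : UnitAddCircle) :
    (w.circRep n g).1 (z + ((m / covDeg n : ℝ) : UnitAddCircle)) =
      (w.circRep n g).1 z + ((m / covDeg n : ℝ) : UnitAddCircle) := by
  have hK := covDeg_pos n
  obtain ⟨g, rfl⟩ := B3.proj_surjective g
  obtain ⟨θ, rfl⟩ := QuotientAddGroup.mk_surjective z
  change (w.circRep n (B3.proj g)).1 ((θ + m / covDeg n : ℝ) : UnitAddCircle) =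
    (w.circRep n (B3.proj g)).1 (θ : UnitAddCircle) + _
  rw [circRep_proj_coe, circRep_proj_coe, ← AddCircle.coe_add, srep_apply, srep_apply, mul_add,
    mul_div_cancel₀ _ hK.ne', deg1_map_add_int, add_div]

theorem circleSign_add (x y z u : UnitAddCircle) :
    circleSign (x + u) (y + u) (z + u) = circleSign x y z := by
  obtain ⟨b, rfl⟩ := QuotientAddGroup.mk_surjective u
  have h : ∀ z : UnitAddCircle, z + (b : UnitAddCircle) = (circHom (tr b)).1 z := fun z => by
    obtain ⟨θ, rfl⟩ := QuotientAddGroup.mk_surjective z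
    change (θ : UnitAddCircle) + (b : UnitAddCircle) = (circHom (tr b)).1 (θ : UnitAddCircle)
    rw [circHom_coe, tr_apply, add_comm b, AddCircle.coe_add]
  change circleSign (x + (b : UnitAddCircle)) (y + (b : UnitAddCircle)) (z + (b : UnitAddCircle)) = _
  rw [h, h, h, circleSign_map]

theorem isDynamicalRealization_circRep {y : UnitAddCircle} (hy : kCover (covDeg n) y = basePt) :
    IsDynamicalRealization (w.circOrd n) (w.circRep n) y := by
  have hK := covDeg_pos n
  obtain ⟨θ, rfl⟩ := QuotientAddGroup.mk_surjective y
  change kCover (covDeg n) (θ : UnitAddCircle) = basePt at hy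
  rw [kCover_coe] at hy
  obtain ⟨m, hm⟩ := exists_int_of_tanPt_eq hy
  have hθ : ((θ : ℝ) : UnitAddCircle) = ((0 : ℝ) : UnitAddCircle) + ((m / covDeg n : ℝ) : UnitAddCircle) := by
    rw [← AddCircle.coe_add, zero_add, ← hm, mul_div_cancel_left₀ _ hK.ne']
  change IsDynamicalRealization (w.circOrd n) (w.circRep n) (θ : UnitAddCircle)
  rw [hθ]
  refine ⟨(w.isTightAt_zero n).map (R := Homeomorph.addRight ((m / covDeg n : ℝ) : UnitAddCircle))
    (w.circRep_add n m), fun g₁ g₂ g₃ => ?_⟩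
  rw [circRep_add, circRep_add, circRep_add, circleSign_add]
  rfl

end FarPoint

/-! ### The central extension defined by a circular order -/

namespace CO
variable {G : Type*} [Group G] (c : CO G)

open Classical in
/-- The indicator function of the complement of the identity. -/
def ind (g : G) : ℤ := if g = 1 then 0 else 1

theorem ind_one : ind (1 : G) = 0 := if_pos rfl

theorem ind_of_ne {g : G} (h : g ≠ 1) : ind g = 1 := if_neg h

/-- The cocycle of the central extension of `G` by `ℤ` lifting the circular order `c`. -/
def wrap (g h : G) : ℤ := (ind g + ind h - ind (g * h) - c.1 1 g (g * h)) / 2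

theorem ne_zero_cases {s : SignType} (h : s ≠ 0) : s = 1 ∨ s = -1 := by
  cases s <;> first | exact (h rfl).elim | simp

/-- The numerator is even: it is 0 if g or h is trivial, 2 if only the product is trivial, and 1 ∓ 1
in general position. -/
theorem two_mul_wrap (g h : G) :
    2 * c.wrap g h = ind g + ind h - ind (g * h) - c.1 1 g (g * h) := by
  apply Int.mul_ediv_cancel'
  by_cases hg : g = 1
  · rw [hg, (c.2.eq_zero_iff _ _ _).2 (Or.inl rfl)]; simp [ind_one]
  by_cases hh : h = 1
  · rw [hh, mul_one, (c.2.eq_zero_iff _ _ _).2 (Or.inr (Or.inl rfl))]; simp [ind_one]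
  by_cases hgh : g * h = 1
  · rw [hgh, (c.2.eq_zero_iff _ _ _).2 (Or.inr (Or.inr rfl))]
    simp [ind_one, ind_of_ne hg, ind_of_ne hh]
  · have h0 : c.1 1 g (g * h) ≠ 0 := by
      rw [Ne, c.2.eq_zero_iff]; rintro (h | h | h)
      · exact hg h.symm
      · exact hh (by simpa using h)
      · exact hgh h.symm
    rw [ind_of_ne hg, ind_of_ne hh, ind_of_ne hgh]
    rcases ne_zero_cases h0 with h1 | h1 <;> rw [h1] <;> simp

theorem wrap_one_left (h : G) : c.wrap 1 h = 0 := by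
  have := c.two_mul_wrap 1 h
  rw [(c.2.eq_zero_iff _ _ _).2 (Or.inl rfl), one_mul, ind_one] at this
  simpa using this

theorem wrap_one_right (g : G) : c.wrap g 1 = 0 := by
  have := c.two_mul_wrap g 1
  rw [mul_one, (c.2.eq_zero_iff _ _ _).2 (Or.inr (Or.inl rfl)), ind_one] at this
  simpa using this

theorem wrap_of_mul_eq_one {g h : G} (hg : g ≠ 1) (hgh : g * h = 1) : c.wrap g h = 1 := by
  have := c.two_mul_wrap g h
  have hh : h ≠ 1 := by rintro rfl; exact hg (by simpa using hgh)
  rw [hgh, (c.2.eq_zero_iff _ _ _).2 (Or.inr (Or.inr rfl)), ind_one, ind_of_ne hg, ind_of_ne hh] at this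
  simp at this; omega

theorem two_mul_wrap_of_ne {g h : G} (hg : g ≠ 1) (hh : h ≠ 1) (hgh : g * h ≠ 1) :
    2 * c.wrap g h = 1 - c.1 1 g (g * h) := by
  rw [two_mul_wrap, ind_of_ne hg, ind_of_ne hh, ind_of_ne hgh]; ring

theorem wrap_nonneg (g h : G) : 0 ≤ c.wrap g h := by
  by_cases hg : g = 1
  · rw [hg, wrap_one_left]
  by_cases hh : h = 1
  · rw [hh, wrap_one_right]
  by_cases hgh : g * h = 1
  · rw [wrap_of_mul_eq_one c hg hgh]; norm_num
  · have := c.two_mul_wrap_of_ne hg hh hgh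
    have h1 : (c.1 1 g (g * h) : ℤ) ≤ 1 := by cases c.1 1 g (g * h) <;> simp
    omega

theorem wrap_assoc (g h k : G) :
    c.wrap g h + c.wrap (g * h) k = c.wrap h k + c.wrap g (h * k) := by
  have h1 := c.2.cocycle 1 g (g * h) (g * h * k)
  have h2 : c.1 g (g * h) (g * h * k) = c.1 1 h (h * k) := by
    rw [← c.2.left_inv g 1 h (h * k), mul_one, mul_assoc g h k]
  rw [h2] at h1
  have e1 := c.two_mul_wrap g h
  have e2 := c.two_mul_wrap (g * h) k
  have e3 := c.two_mul_wrap h k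
  have e4 := c.two_mul_wrap g (h * k)
  rw [← mul_assoc g h k] at e4
  have : 2 * (c.wrap g h + c.wrap (g * h) k) = 2 * (c.wrap h k + c.wrap g (h * k)) := by
    rw [mul_add, mul_add, e1, e2, e3, e4]; linear_combination h1
  omega

/-- A circular order is determined by its cocycle. -/
theorem eq_of_wrap_eq {c c' : CO G} (h : c.wrap = c'.wrap) : c = c' := by
  have h1 : ∀ g h, c.1 1 g h = c'.1 1 g h := fun g k => by
    have e := c.two_mul_wrap g (g⁻¹ * k)
    have e' := c'.two_mul_wrap g (g⁻¹ * k)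
    rw [mul_inv_cancel_left] at e e'
    rw [h] at e
    have : (c.1 1 g k : ℤ) = c'.1 1 g k := by linarith
    revert this
    cases c.1 1 g k <;> cases c'.1 1 g k <;> simp
  refine Subtype.ext (funext fun g₁ => funext fun g₂ => funext fun g₃ => ?_)
  have e := c.2.left_inv g₁ 1 (g₁⁻¹ * g₂) (g₁⁻¹ * g₃)
  have e' := c'.2.left_inv g₁ 1 (g₁⁻¹ * g₂) (g₁⁻¹ * g₃)
  rw [mul_one, mul_inv_cancel_left, mul_inv_cancel_left] at e e'
  rw [e, e', h1]

/-- The central extension of `G` by `ℤ` defined by `c`. -/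
@[ext] structure Ext (c : CO G) where
  /-- The coordinate in `ℤ`. -/
  fst : ℤ
  /-- The coordinate in `G`. -/
  snd : G

namespace Ext
variable {c}

instance : Mul c.Ext := ⟨fun p q => ⟨p.fst + q.fst + c.wrap p.snd q.snd, p.snd * q.snd⟩⟩
instance : One c.Ext := ⟨⟨0, 1⟩⟩
instance : Inv c.Ext := ⟨fun p => ⟨-p.fst - c.wrap p.snd⁻¹ p.snd, p.snd⁻¹⟩⟩

@[simp] theorem mul_fst (p q : c.Ext) : (p * q).fst = p.fst + q.fst + c.wrap p.snd q.snd := rfl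
@[simp] theorem mul_snd (p q : c.Ext) : (p * q).snd = p.snd * q.snd := rfl
@[simp] theorem one_fst : (1 : c.Ext).fst = 0 := rfl
@[simp] theorem one_snd : (1 : c.Ext).snd = 1 := rfl
@[simp] theorem inv_fst (p : c.Ext) : (p⁻¹).fst = -p.fst - c.wrap p.snd⁻¹ p.snd := rfl
@[simp] theorem inv_snd (p : c.Ext) : (p⁻¹).snd = p.snd⁻¹ := rfl

instance : Group c.Ext := Group.ofLeftAxioms
  (fun p q r => Ext.ext (by have := c.wrap_assoc p.snd q.snd r.snd; simp; linarith)
    (mul_assoc _ _ _))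
  (fun p => Ext.ext (by simp [wrap_one_left]) (one_mul _))
  (fun p => Ext.ext (by simp only [mul_fst, inv_fst, inv_snd, one_fst]; ring) (inv_mul_cancel _))

/-- The projection of the central extension. -/
def sndHom : c.Ext →* G where
  toFun := Ext.snd
  map_one' := rfl
  map_mul' _ _ := rfl

end Ext

theorem continuous_apply (g₁ g₂ g₃ : G) : Continuous fun c : CO G => c.1 g₁ g₂ g₃ :=
  (_root_.continuous_apply g₃).comp ((_root_.continuous_apply g₂).comp
    ((_root_.continuous_apply g₁).comp continuous_subtype_val))

theorem continuous_wrap (g h : G) : Continuous fun c : CO G => c.wrap g h := by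
  have : (fun c : CO G => c.wrap g h) =
      (fun s : SignType => (ind g + ind h - ind (g * h) - (s : ℤ)) / 2) ∘ fun c : CO G => c.1 1 g (g * h) := rfl
  rw [this]
  exact continuous_of_discreteTopology.comp (continuous_apply _ _ _)

end CO

/-! ### Lifting circular orders to left orders on the braid group -/

/-- `a` is the integral part of a lift of `B3 → GBar` to the central extension defined by `c`. -/
structure IsLiftFun (c : CO GBar) (a : B3 → ℤ) : Prop where
  map_mul : ∀ g h, a (g * h) = a g + a h + c.wrap (B3.proj g) (B3.proj h)

namespace IsLiftFun
variable {c : CO GBar} {a : B3 → ℤ} (h : IsLiftFun c a)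
include h

theorem map_one : a 1 = 0 := by
  have := h.map_mul 1 1
  rw [_root_.map_one, c.wrap_one_left, mul_one] at this
  omega

theorem mul_t_zpow (g : B3) (m : ℤ) : a (g * B3.t ^ m) = a g + m * a B3.t := by
  have key : ∀ g, a (g * B3.t) = a g + a B3.t := fun g => by
    rw [h.map_mul, B3.proj_t, c.wrap_one_right, add_zero]
  induction m with
  | zero => simp
  | succ i ih => rw [_root_.zpow_add_one, ← mul_assoc g, key, ih]; ring
  | pred i ih =>
    have := key (g * B3.t ^ (-(i : ℤ) - 1))
    rw [mul_assoc g, ← _root_.zpow_add_one, sub_add_cancel, ih] at this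
    linarith

theorem t_zpow (m : ℤ) : a (B3.t ^ m) = m * a B3.t := by
  have := h.mul_t_zpow 1 m
  rwa [one_mul, h.map_one, zero_add] at this

theorem eq_of_eq {a' : B3 → ℤ} (h' : IsLiftFun c a') (hx : a B3.x = a' B3.x)
    (hy : a B3.y = a' B3.y) : a = a' := by
  funext g
  refine B3.induction_left (p := fun g => a g = a' g) g ?_ ?_ ?_ ?_ ?_
  · rw [h.map_one, h'.map_one]
  · intro g hg; rw [h.map_mul, h'.map_mul, hx, hg]
  · intro g hg
    have e := h.map_mul B3.x (B3.x⁻¹ * g)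
    have e' := h'.map_mul B3.x (B3.x⁻¹ * g)
    rw [mul_inv_cancel_left] at e e'
    linarith
  · intro g hg; rw [h.map_mul, h'.map_mul, hy, hg]
  · intro g hg
    have e := h.map_mul B3.y (B3.y⁻¹ * g)
    have e' := h'.map_mul B3.y (B3.y⁻¹ * g)
    rw [mul_inv_cancel_left] at e e'
    linarith

end IsLiftFun

theorem proj_y_ne_one : B3.proj B3.y ≠ 1 := fun h => by
  obtain ⟨w⟩ := FarPoint.exists_farPoint
  obtain ⟨l, hl⟩ := w.exists_eq_t_zpow_of_proj h
  have := congrArg B3.deg hl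
  simp at this; omega

theorem gβ_ne_one : gβ ≠ 1 := by simpa using proj_y_ne_one

theorem gα_mul_self : gα * gα = 1 := (pow_two gα).symm.trans gα_sq

theorem gβ_mul_mul_self : gβ * gβ * gβ = 1 := by
  have h3 := gβ_cube
  rwa [pow_succ gβ, pow_two gβ] at h3

theorem gβ_sq_ne_one : gβ * gβ ≠ 1 := fun h => gβ_ne_one (by
  have h3 := gβ_mul_mul_self
  rwa [h, one_mul] at h3)

theorem gα_ne_one : gα ≠ 1 := fun h => by
  obtain ⟨w⟩ := FarPoint.exists_farPoint
  obtain ⟨l, hl⟩ := w.exists_eq_t_zpow_of_proj (g := B3.x) (by rw [B3.proj_x, h])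
  have := congrArg B3.deg hl
  simp at this; omega

/-- In the extension (p, α)² = (2p + 1, 1) and (q, β)³ = (3q + wrap(β, β) + 1, 1), so the hypothesis
is exactly the relation x² = y³. -/
theorem exists_isLiftFun (c : CO GBar) {p q : ℤ} (h : 2 * p = 3 * q + c.wrap gβ gβ) :
    ∃ a, IsLiftFun c a ∧ a B3.x = p ∧ a B3.y = q := by
  have hα := gα_mul_self
  have hβ := gβ_mul_mul_self
  have h3 : ∀ r : c.Ext, r ^ 3 = r * r * r := fun r => by rw [pow_succ r, pow_two r]
  have h2 : ∀ r : c.Ext, r ^ 2 = r * r := pow_two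
  let φ : B3 →* c.Ext := B3.lift ⟨p, gα⟩ ⟨q, gβ⟩ (by
    apply CO.Ext.ext
    · rw [h2, h3]
      simp only [CO.Ext.mul_fst, CO.Ext.mul_snd]
      rw [c.wrap_of_mul_eq_one gα_ne_one hα, c.wrap_of_mul_eq_one gβ_sq_ne_one hβ]
      linarith
    · rw [h2, h3]
      simp only [CO.Ext.mul_snd]
      rw [hα, hβ])
  have hx : φ B3.x = ⟨p, gα⟩ := B3.lift_x _ _ _
  have hy : φ B3.y = ⟨q, gβ⟩ := B3.lift_y _ _ _
  have hs : ∀ g, (φ g).snd = B3.proj g := fun g => by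
    have : CO.Ext.sndHom.comp φ = B3.proj := B3.hom_ext
      (by rw [MonoidHom.comp_apply, hx, B3.proj_x]; rfl)
      (by rw [MonoidHom.comp_apply, hy, B3.proj_y]; rfl)
    exact DFunLike.congr_fun this g
  exact ⟨fun g => (φ g).fst, ⟨fun g g' => by simp only [map_mul, CO.Ext.mul_fst, hs]⟩,
    by simp only [hx], by simp only [hy]⟩

open Classical in
/-- The sign of an element of the central extension with respect to its left order. -/
def liftSign (a : B3 → ℤ) (g : B3) : SignType :=
  if a g < 0 then -1 else if a g = 0 ∧ B3.proj g = 1 then 0 else 1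

theorem liftSign_eq_one_iff (a : B3 → ℤ) (g : B3) :
    liftSign a g = 1 ↔ 0 ≤ a g ∧ ¬ (a g = 0 ∧ B3.proj g = 1) := by
  unfold liftSign
  split_ifs with h1 h2
  · simp; intro h; omega
  · simp [h2]
  · simp [not_lt.1 h1]; simpa using h2

theorem liftSign_eq_zero_iff (a : B3 → ℤ) (g : B3) :
    liftSign a g = 0 ↔ a g = 0 ∧ B3.proj g = 1 := by
  unfold liftSign
  split_ifs with h1 h2
  · simp; intro h; omega
  · simp [h2]
  · simpa using h2

theorem liftSign_eq_neg_one_iff (a : B3 → ℤ) (g : B3) : liftSign a g = -1 ↔ a g < 0 := by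
  unfold liftSign
  split_ifs with h1 h2
  · simp [h1]
  · simp [h1]
  · simp [not_lt.1 h1]

/-- Nonnegativity of the cocycle makes the positive cone multiplicative. Outside the kernel of the
projection the integral parts of f and f⁻¹ add up to -1, so exactly one of them is nonnegative. -/
theorem IsLiftFun.isLeftOrder {c : CO GBar} {a : B3 → ℤ} (h : IsLiftFun c a) (ht : a B3.t ≠ 0) :
    IsLeftOrder (liftSign a) where
  eq_zero_iff g := by
    rw [liftSign_eq_zero_iff]
    constructor
    · rintro ⟨h1, h2⟩
      obtain ⟨w⟩ := FarPoint.exists_farPoint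
      obtain ⟨l, rfl⟩ := w.exists_eq_t_zpow_of_proj h2
      rw [h.t_zpow] at h1
      rw [(mul_eq_zero.1 h1).resolve_right ht, zpow_zero]
    · rintro rfl
      exact ⟨h.map_one, _root_.map_one _⟩
  mul_pos f g hf hg := by
    rw [liftSign_eq_one_iff] at *
    have hw := c.wrap_nonneg (B3.proj f) (B3.proj g)
    rw [h.map_mul, _root_.map_mul]
    refine ⟨by linarith, fun ⟨h1, h2⟩ => ?_⟩
    have hf0 : a f = 0 := by linarith
    have hfp : B3.proj f ≠ 1 := fun e => hf.2 ⟨hf0, e⟩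
    rw [c.wrap_of_mul_eq_one hfp h2] at h1
    linarith
  inv_eq f := by
    have h0 := h.map_mul f f⁻¹
    rw [mul_inv_cancel, h.map_one] at h0
    by_cases hp : B3.proj f = 1
    · rw [hp, c.wrap_one_left] at h0
      have hp' : B3.proj f⁻¹ = 1 := by rw [map_inv, hp, inv_one]
      rcases lt_trichotomy (a f) 0 with h1 | h1 | h1
      · rw [(liftSign_eq_neg_one_iff a f).2 h1, neg_neg, liftSign_eq_one_iff]
        exact ⟨by linarith, fun h => by linarith [h.1]⟩
      · rw [(liftSign_eq_zero_iff a f).2 ⟨h1, hp⟩, neg_zero, liftSign_eq_zero_iff]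
        exact ⟨by linarith, hp'⟩
      · rw [(liftSign_eq_one_iff a f).2 ⟨h1.le, fun h => by linarith [h.1]⟩, liftSign_eq_neg_one_iff]
        linarith
    · rw [c.wrap_of_mul_eq_one hp (by rw [map_inv, mul_inv_cancel])] at h0
      have hp' : B3.proj f⁻¹ ≠ 1 := by rw [map_inv]; simpa using hp
      rcases lt_or_ge (a f) 0 with h1 | h1
      · rw [(liftSign_eq_neg_one_iff a f).2 h1, neg_neg, liftSign_eq_one_iff]
        exact ⟨by linarith, fun h => hp' h.2⟩
      · rw [(liftSign_eq_one_iff a f).2 ⟨h1, fun h => hp h.2⟩, liftSign_eq_neg_one_iff]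
        linarith

/-- As a(t) = ±1, multiplying by powers of t shifts the integral part by any integer, so the signs
alone recover a. The cocycle, and hence the circular order, is then recovered from a. -/
theorem IsLiftFun.eq_of_liftSign_eq {c c' : CO GBar} {a a' : B3 → ℤ} (h : IsLiftFun c a)
    (h' : IsLiftFun c' a') {s : ℤ} (hs : s * s = 1) (ht : a B3.t = s) (ht' : a' B3.t = s)
    (e : liftSign a = liftSign a') : c = c' := by
  have key : ∀ g m, m ≤ a g ↔ m ≤ a' g := fun g m => by
    have h1 := h.mul_t_zpow g (-(s * m))
    have h1' := h'.mul_t_zpow g (-(s * m))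
    rw [ht] at h1
    rw [ht'] at h1'
    have hsm : s * m * s = m := by linear_combination m * hs
    have h2 := liftSign_eq_neg_one_iff a (g * B3.t ^ (-(s * m)))
    rw [e, liftSign_eq_neg_one_iff, h1, h1', neg_mul, hsm] at h2
    constructor <;> intro <;> by_contra <;> omega
  have ha : a = a' := funext fun g =>
    le_antisymm ((key g _).1 le_rfl) ((key g _).2 le_rfl)
  apply CO.eq_of_wrap_eq
  funext g k
  obtain ⟨g, rfl⟩ := B3.proj_surjective g
  obtain ⟨k, rfl⟩ := B3.proj_surjective k
  have e1 := h.map_mul g k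
  have e2 := h'.map_mul g k
  rw [ha] at e1
  linarith

/-- The circular orders with a given value of the cocycle at `(β, β)`. -/
abbrev COWrap (v : ℤ) : Type := {c : CO GBar // c.wrap gβ gβ = v}

section
variable {p q v : ℤ} (h : 2 * p = 3 * q + v)

/-- The integral part of the lift to the central extension with given values on generators. -/
def liftFun (c : COWrap v) : B3 → ℤ :=
  Classical.choose (exists_isLiftFun c.1 (p := p) (q := q) (by rw [c.2, h]))

theorem liftFun_spec (c : COWrap v) :
    IsLiftFun c.1 (liftFun h c) ∧ liftFun h c B3.x = p ∧ liftFun h c B3.y = q :=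
  Classical.choose_spec (exists_isLiftFun c.1 (p := p) (q := q) (by rw [c.2, h]))

theorem liftFun_t (c : COWrap v) : liftFun h c B3.t = 2 * p + 1 := by
  obtain ⟨h1, h2, -⟩ := liftFun_spec h c
  rw [← B3.x_sq, pow_two B3.x, h1.map_mul, h2, B3.proj_x,
    c.1.wrap_of_mul_eq_one gα_ne_one gα_mul_self]
  ring

/-- Each value is built from the constants p and q and finitely many values of the cocycle, by
induction along a word in x and y. -/
theorem continuous_liftFun (g : B3) : Continuous fun c : COWrap v => liftFun h c g := by
  have hw : ∀ g k, Continuous fun c : COWrap v => c.1.wrap g k := fun g k =>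
    (CO.continuous_wrap g k).comp continuous_subtype_val
  have hmul := fun c : COWrap v => (liftFun_spec h c).1.map_mul
  refine B3.induction_left (p := fun g => Continuous fun c : COWrap v => liftFun h c g) g ?_ ?_ ?_ ?_ ?_
  · simp only [fun c : COWrap v => (liftFun_spec h c).1.map_one]
    exact continuous_const
  · intro g hg
    simp only [hmul, fun c : COWrap v => (liftFun_spec h c).2.1]
    exact (continuous_const.add hg).add (hw _ _)
  · intro g hg
    have : ∀ c : COWrap v, liftFun h c (B3.x⁻¹ * g) =
        liftFun h c g - p - c.1.wrap (B3.proj B3.x) (B3.proj (B3.x⁻¹ * g)) := fun c => by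
      have := hmul c B3.x (B3.x⁻¹ * g)
      rw [mul_inv_cancel_left, (liftFun_spec h c).2.1] at this
      linarith
    simp only [this]
    exact (hg.sub continuous_const).sub (hw _ _)
  · intro g hg
    simp only [hmul, fun c : COWrap v => (liftFun_spec h c).2.2]
    exact (continuous_const.add hg).add (hw _ _)
  · intro g hg
    have : ∀ c : COWrap v, liftFun h c (B3.y⁻¹ * g) =
        liftFun h c g - q - c.1.wrap (B3.proj B3.y) (B3.proj (B3.y⁻¹ * g)) := fun c => by
      have := hmul c B3.y (B3.y⁻¹ * g)
      rw [mul_inv_cancel_left, (liftFun_spec h c).2.2] at this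
      linarith
    simp only [this]
    exact (hg.sub continuous_const).sub (hw _ _)

/-- The left order on the braid group lifting a circular order. -/
def liftOrd (c : COWrap v) : LO B3 :=
  ⟨liftSign (liftFun h c), (liftFun_spec h c).1.isLeftOrder (by rw [liftFun_t]; omega)⟩

theorem continuous_liftOrd : Continuous (liftOrd h : COWrap v → LO B3) := by
  refine Continuous.subtype_mk (continuous_pi fun g => ?_) _
  classical
  have : (fun c : COWrap v => liftSign (liftFun h c) g) =
      (fun m : ℤ => if m < 0 then (-1 : SignType) else if m = 0 ∧ B3.proj g = 1 then 0 else 1) ∘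
        fun c => liftFun h c g := by
    funext c
    simp only [liftSign, Function.comp]
  rw [this]
  exact continuous_of_discreteTopology.comp (continuous_liftFun h g)

theorem liftOrd_injective (hp : (2 * p + 1) * (2 * p + 1) = 1) :
    Function.Injective (liftOrd h : COWrap v → LO B3) := fun c c' e =>
  Subtype.ext ((liftFun_spec h c).1.eq_of_liftSign_eq (liftFun_spec h c').1 hp (liftFun_t h c)
    (liftFun_t h c') (congrArg Subtype.val e))

theorem isOpen_COWrap : IsOpen {c : CO GBar | c.wrap gβ gβ = v} :=
  (isOpen_discrete {v}).preimage (CO.continuous_wrap gβ gβ)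

theorem isIsolatedPoint_of_liftOrd (hp : (2 * p + 1) * (2 * p + 1) = 1) (c : COWrap v)
    (hc : IsIsolatedPoint (liftOrd h c)) : IsIsolatedPoint c.1 := by
  have h1 : IsOpen ({c} : Set (COWrap v)) := by
    have := hc.preimage (continuous_liftOrd h)
    convert this
    ext c'
    exact ⟨fun e => congrArg _ e, fun e => liftOrd_injective h hp e⟩
  have h2 := (isOpen_COWrap (v := v)).isOpenMap_subtype_val _ h1
  rwa [Set.image_singleton] at h2

end

/-! ### The circular orders of the lifts correspond to the left orders on the braid group -/

namespace FarPoint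
variable (w : FarPoint) (n : ℤ)

theorem ind_proj (g : B3) :
    CO.ind (B3.proj g) = (SignType.sign (Int.fract (w.srep n g 0)) : ℤ) := by
  have h0 := Int.fract_nonneg (w.srep n g 0)
  by_cases h : B3.proj g = 1
  · obtain ⟨l, rfl⟩ := w.exists_eq_t_zpow_of_proj h
    rw [h, CO.ind_one, srep_t_zpow, zero_add, Int.fract_intCast]; simp
  · rw [CO.ind_of_ne h, sign_pos (lt_of_le_of_ne h0 fun e => h ?_)]
    · rfl
    · apply w.circRep_free n
      rw [circRep_proj_coe, eq_comm, coe_eq_coe_iff]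
      exact ⟨⌊w.srep n g 0⌋, by
        have := Int.self_sub_floor (w.srep n g 0)
        linarith⟩

theorem circOrd_apply (g h : B3) : (w.circOrd n).1 1 (B3.proj g) (B3.proj h) =
    circleSign ((0 : ℝ) : UnitAddCircle) (w.srep n g 0 : ℝ) (w.srep n h 0 : ℝ) := by
  change circleSign ((w.circRep n 1).1 ((0 : ℝ) : UnitAddCircle))
    ((w.circRep n (B3.proj g)).1 ((0 : ℝ) : UnitAddCircle))
    ((w.circRep n (B3.proj h)).1 ((0 : ℝ) : UnitAddCircle)) = _
  rw [circRep_proj_coe, circRep_proj_coe, map_one]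
  rfl

theorem coe_fract (a : ℝ) : ((Int.fract a : ℝ) : UnitAddCircle) = a :=
  coe_eq_coe_iff.2 ⟨⌊a⌋, (Int.fract_add_floor a).symm⟩

/-- The floor of a composite exceeds the sum of the floors by one exactly when g carries the
fractional part of v past the next integer; this carry is what the cocycle records. -/
theorem isLiftFun_floor : IsLiftFun (w.circOrd n) fun g => ⌊w.srep n g 0⌋ where
  map_mul g h := by
    have h2 := (w.circOrd n).two_mul_wrap (B3.proj g) (B3.proj h)
    set u := w.srep n g 0 with hu
    set v := w.srep n h 0 with hv
    set z := w.srep n (g * h) 0 with hz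
    have hm : ∀ a : ℝ, Int.fract a ∈ Set.Ico (0 : ℝ) (0 + 1) := fun a =>
      ⟨Int.fract_nonneg a, by rw [zero_add]; exact Int.fract_lt_one a⟩
    have hc : (((w.circOrd n).1 1 (B3.proj g) (B3.proj (g * h)) : SignType) : ℤ) =
        SignType.sign (Int.fract u) + SignType.sign (Int.fract z - Int.fract u) -
          SignType.sign (Int.fract z) := by
      rw [circOrd_apply, ← coe_fract (w.srep n g 0), ← coe_fract (w.srep n (g * h) 0),
        circleSign_coe ⟨le_rfl, by norm_num⟩ (hm _) (hm _), sub_zero, sub_zero]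
    rw [← map_mul, hc, w.ind_proj n, w.ind_proj n, w.ind_proj n, ← hu, ← hv, ← hz] at h2
    have hF := deg1_strictMono (w.srep n g)
    have hzF : z = w.srep n g (Int.fract v) + ⌊v⌋ := by
      rw [← deg1_map_add_int, Int.fract_add_floor, hz, hv, map_mul, deg1_mul_apply]
    set ζ := w.srep n g (Int.fract v) - ⌊u⌋ with hζ
    have hfu := Int.self_sub_floor u
    have h3 : Int.fract u ≤ ζ := by
      have := hF.monotone (Int.fract_nonneg v)
      linarith
    have h4 : ζ < Int.fract u + 1 := by
      have := hF (Int.fract_lt_one v)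
      have h5 := deg1_map_add_one (w.srep n g) 0
      rw [zero_add] at h5
      linarith
    have h5 : (SignType.sign (Int.fract v) : ℤ) = SignType.sign (ζ - Int.fract u) := by
      rcases (Int.fract_nonneg v).eq_or_lt with h6 | h6
      · have : ζ = Int.fract u := by rw [hζ, ← h6]; linarith
        rw [← h6, this, sub_self]
      · have := hF h6
        rw [sign_pos h6, sign_pos (by linarith)]
    have hzz : z = ζ + (⌊u⌋ + ⌊v⌋ : ℤ) := by rw [hzF, hζ]; push_cast; ring
    have h0 := Int.fract_nonneg u
    have h0' := Int.fract_lt_one u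
    rcases lt_or_ge ζ 1 with h6 | h6
    · have hfl : ⌊z⌋ = ⌊u⌋ + ⌊v⌋ := by
        rw [hzz, Int.floor_add_intCast, Int.floor_eq_zero_iff.2 ⟨by linarith, h6⟩, zero_add]
      have hfr : Int.fract z = ζ := by
        rw [hzz, Int.fract_add_intCast, Int.fract_eq_self.2 ⟨by linarith, h6⟩]
      rw [hfr, h5] at h2
      rw [hfl]; omega
    · have hfl : ⌊z⌋ = ⌊u⌋ + ⌊v⌋ + 1 := by
        have : ⌊ζ⌋ = 1 := Int.floor_eq_iff.2 ⟨by simpa using h6, by push_cast; linarith⟩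
        rw [hzz, Int.floor_add_intCast, this]; ring
      have hfr : Int.fract z = ζ - 1 := by
        rw [← Int.self_sub_floor, hfl, hzz]; push_cast; ring
      rw [hfr, h5, sign_pos (by linarith : 0 < ζ - Int.fract u),
        sign_neg (by linarith : ζ - 1 - Int.fract u < 0)] at h2
      simp at h2
      rw [hfl]; omega

theorem liftSign_floor : liftSign (fun g => ⌊w.srep n g 0⌋) = (w.leftOrd n).1 := by
  funext g
  have hK := covDeg_pos n
  have hs := w.srep_zero n g
  rcases lt_trichotomy (w.rep n g 0) 0 with h | h | h
  · have h1 : w.srep n g 0 < 0 := by rw [hs]; exact div_neg_of_neg_of_pos h hK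
    change _ = SignType.sign (w.rep n g 0)
    rw [sign_neg h, liftSign_eq_neg_one_iff]
    exact Int.floor_lt.2 (by simpa using h1)
  · have := w.eq_one_of_rep n h
    rw [this, (w.leftOrd n).2.map_one, liftSign_eq_zero_iff]
    simp
  · have h1 : 0 < w.srep n g 0 := by rw [hs]; exact div_pos h hK
    rw [(w.leftOrd_eq_one_iff n g).2 h, liftSign_eq_one_iff]
    refine ⟨Int.floor_nonneg.2 h1.le, fun ⟨h2, h3⟩ => ?_⟩
    have h4 := w.ind_proj n g
    rw [h3, CO.ind_one, Int.fract_eq_self.2 (Int.floor_eq_zero_iff.1 h2), sign_pos h1] at h4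
    simp at h4

/-- The square of x is t, which translates by the sign of 6n + 1; the 1 is the cocycle at (α, α). -/
theorem floor_srep_x : 2 * ⌊w.srep n B3.x 0⌋ + 1 = (6 * n + 1).sign := by
  have h := (w.isLiftFun_floor n).map_mul B3.x B3.x
  rw [(w.circOrd n).wrap_of_mul_eq_one (by simpa using gα_ne_one) (by rw [B3.proj_x, gα_mul_self]),
    ← pow_two B3.x, B3.x_sq] at h
  have h2 := w.srep_t_zpow n 1 0
  rw [_root_.zpow_one] at h2
  simp only [h2, zero_add, Int.floor_intCast, mul_one] at h
  omega

theorem isIsolatedPoint_circOrd : IsIsolatedPoint (w.circOrd n) := by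
  have hl := w.isLiftFun_floor n
  set p := ⌊w.srep n B3.x 0⌋ with hp
  set q := ⌊w.srep n B3.y 0⌋ with hq
  have hx := w.floor_srep_x n
  have h1 : ⌊w.srep n B3.t 0⌋ = 3 * q + (w.circOrd n).wrap gβ gβ + 1 := by
    have e1 := hl.map_mul B3.y B3.y
    have e2 := hl.map_mul (B3.y * B3.y) B3.y
    have hy3 : B3.y * B3.y * B3.y = B3.t := by rw [← B3.y_cube, pow_succ B3.y, pow_two B3.y]
    rw [map_mul B3.proj, B3.proj_y, (w.circOrd n).wrap_of_mul_eq_one gβ_sq_ne_one gβ_mul_mul_self, hy3] at e2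
    rw [B3.proj_y] at e1
    simp only [← hq] at e1 e2
    linarith
  have h2 : ⌊w.srep n B3.t 0⌋ = (6 * n + 1).sign := by
    have h2 := w.srep_t_zpow n 1 0
    rw [_root_.zpow_one] at h2
    rw [h2, zero_add, Int.floor_intCast, mul_one]
  have h : 2 * p = 3 * q + (w.circOrd n).wrap gβ gβ := by linarith
  have hs : (2 * p + 1) * (2 * p + 1) = 1 := by
    rw [hx]
    rcases Int.sign_trichotomy (6 * n + 1) with h | h | h
    · rw [h]; rfl
    · rw [Int.sign_eq_zero_iff_zero] at h; omega
    · rw [h]; rfl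
  refine isIsolatedPoint_of_liftOrd h hs ⟨w.circOrd n, rfl⟩ ?_
  have : liftOrd h ⟨w.circOrd n, rfl⟩ = w.leftOrd n := by
    apply Subtype.ext
    obtain ⟨e1, e2, e3⟩ := liftFun_spec h ⟨w.circOrd n, rfl⟩
    change liftSign (liftFun h ⟨w.circOrd n, rfl⟩) = _
    rw [← liftSign_floor, e1.eq_of_eq hl e2 e3]
  rw [this]
  exact w.isIsolatedPoint_leftOrd n

end FarPoint

/-! ### The fixed points of the hyperbolic element `E` -/

theorem deg1_zpow_apply_eq {F : CircleDeg1Liftˣ} {a : ℝ} (h : F a = a) (j : ℤ) : (F ^ j) a = a := by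
  induction j with
  | zero => simp
  | succ i ih => rw [_root_.zpow_add_one, deg1_mul_apply, h, ih]
  | pred i ih =>
    have h' : (F⁻¹ : CircleDeg1Liftˣ) a = a := by
      conv_lhs => rw [← h]
      exact CircleDeg1Lift.units_inv_apply_apply F a
    rw [_root_.zpow_sub_one, deg1_mul_apply, h', ih]

/-- On the compact interval the displacement has a positive minimum, so the iterates advance at
least linearly until they leave. -/
theorem exists_lt_pow_apply (F : CircleDeg1Liftˣ) {a b : ℝ} (h : ∀ z ∈ Set.Icc a b, z < F z) :
    ∃ m : ℕ, b < (F ^ m) a := by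
  rcases lt_or_ge b a with hab | hab
  · exact ⟨0, by simpa using hab⟩
  obtain ⟨z₀, hz₀, hmin⟩ := isCompact_Icc.exists_isMinOn (Set.nonempty_Icc.2 hab)
    ((deg1_continuous F).sub continuous_id).continuousOn
  set δ := F z₀ - z₀ with hδ
  have hδ0 : 0 < δ := sub_pos.2 (h z₀ hz₀)
  by_contra! hcon
  have key : ∀ m : ℕ, a + m * δ ≤ (F ^ m) a := fun m => by
    induction m with
    | zero => simp
    | succ i ih =>
      have hi : (F ^ i) a ∈ Set.Icc a b := ⟨le_trans (by nlinarith [(Nat.cast_nonneg i : (0 : ℝ) ≤ i)]) ih, hcon i⟩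
      have h1 : δ ≤ F ((F ^ i) a) - (F ^ i) a := hmin hi
      rw [pow_succ', deg1_mul_apply]
      rw [Nat.cast_add, Nat.cast_one]
      linarith
  obtain ⟨m, hm⟩ := Archimedean.arch (b - a + 1) hδ0
  rw [nsmul_eq_mul] at hm
  linarith [key m, hcon m]

namespace FarPoint
variable (w : FarPoint) (n : ℤ)

/-- A direction is preserved exactly when its wedge product with its image vanishes; that product is
computed to be (2p cos(2πz) - 1)/2. -/
theorem exists_E_eq_add_int_iff (z : ℝ) :
    (∃ m : ℤ, w.E z = z + m) ↔ 2 * w.p * Real.cos (2 * (Real.pi * z)) = 1 := by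
  obtain ⟨r, hr, h⟩ := w.isLineLift_E z
  have h0 : w.s * Real.sin (Real.pi * z) + (w.p - 1 / 2) * Real.cos (Real.pi * z) =
      r * Real.sin (Real.pi * w.E z) := by
    have := congrFun h 0
    simpa [mulVec, dotProduct, Fin.sum_univ_two, dirVec] using this
  have h1 : (w.p + 1 / 2) * Real.sin (Real.pi * z) + w.s * Real.cos (Real.pi * z) =
      r * Real.cos (Real.pi * w.E z) := by
    have := congrFun h 1
    simpa [mulVec, dotProduct, Fin.sum_univ_two, dirVec] using this
  have h2 : r * Real.sin (Real.pi * w.E z - Real.pi * z) =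
      (2 * w.p * Real.cos (2 * (Real.pi * z)) - 1) / 2 := by
    rw [Real.sin_sub, Real.cos_two_mul']
    have h3 := Real.sin_sq_add_cos_sq (Real.pi * z)
    linear_combination (-Real.cos (Real.pi * z)) * h0 + Real.sin (Real.pi * z) * h1 - (1 / 2) * h3
  have hpi := Real.pi_ne_zero
  constructor
  · rintro ⟨m, hm⟩
    have : Real.pi * w.E z - Real.pi * z = m * Real.pi := by rw [hm]; ring
    rw [this, Real.sin_int_mul_pi] at h2
    linarith
  · intro h3
    rw [h3, sub_self, zero_div] at h2
    obtain ⟨m, hm⟩ := Real.sin_eq_zero_iff.1 ((mul_eq_zero.1 h2).resolve_left hr)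
    refine ⟨m, mul_left_cancel₀ hpi ?_⟩
    linear_combination -hm

/-- The attracting fixed point of `E` next to `0`. -/
def fix : ℝ := Real.arccos (1 / (2 * w.p)) / (2 * Real.pi)

theorem two_pi_mul_fix : 2 * (Real.pi * w.fix) = Real.arccos (1 / (2 * w.p)) := by
  have := Real.pi_ne_zero
  rw [fix]; field_simp

theorem inv_two_p : 0 < 1 / (2 * w.p) ∧ 1 / (2 * w.p) < 1 := by
  have := w.half_lt_p
  constructor
  · positivity
  · rw [div_lt_one (by linarith)]; linarith

theorem fix_pos : 0 < w.fix :=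
  div_pos (Real.arccos_pos.2 w.inv_two_p.2) (by have := Real.pi_pos; positivity)

theorem fix_lt : w.fix < 1 / 4 := by
  have h1 := w.two_pi_mul_fix
  have h2 := Real.arccos_lt_pi_div_two.2 w.inv_two_p.1
  have h3 := Real.pi_pos
  by_contra h
  nlinarith

theorem cos_fix : Real.cos (2 * (Real.pi * w.fix)) = 1 / (2 * w.p) := by
  rw [two_pi_mul_fix, Real.cos_arccos (by linarith [w.inv_two_p.1]) w.inv_two_p.2.le]

theorem cos_fix' : 2 * w.p * Real.cos (2 * (Real.pi * w.fix)) = 1 := by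
  have := w.half_lt_p
  rw [cos_fix]; field_simp

theorem int_eq_zero_of_abs_lt_one {m : ℤ} (h1 : (-1 : ℝ) < m) (h2 : (m : ℝ) < 1) : m = 0 := by
  have h3 : -1 < m := by exact_mod_cast h1
  have h4 : m < 1 := by exact_mod_cast h2
  omega

theorem E_neg_half : -1 < w.E (-(1 / 2)) := by
  have h := deg1_map_add_one w.E (-(1 / 2))
  have h1 : w.E 0 < w.E (1 / 2) := deg1_strictMono _ (by norm_num)
  have h2 := w.E_zero_pos
  norm_num at h
  norm_num at h1 ⊢
  linarith

theorem E_fix : w.E w.fix = w.fix := by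
  obtain ⟨m, hm⟩ := (w.exists_E_eq_add_int_iff w.fix).2 w.cos_fix'
  have h1 : w.E 0 < w.E w.fix := deg1_strictMono _ w.fix_pos
  have h2 : w.E w.fix < w.E (1 / 2) := deg1_strictMono _ (by linarith [w.fix_lt])
  have := w.E_zero_pos
  have := w.E_half_lt
  have := w.fix_pos
  have := w.fix_lt
  rw [hm, int_eq_zero_of_abs_lt_one (m := m) (by linarith) (by linarith)]; simp

theorem E_neg_fix : w.E (-w.fix) = -w.fix := by
  obtain ⟨m, hm⟩ := (w.exists_E_eq_add_int_iff (-w.fix)).2 (by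
    rw [mul_neg, mul_neg, Real.cos_neg, w.cos_fix'])
  have h1 : w.E (-(1 / 2)) < w.E (-w.fix) := deg1_strictMono _ (by linarith [w.fix_lt])
  have h2 : w.E (-w.fix) < w.E (1 / 2) := deg1_strictMono _ (by linarith [w.fix_pos])
  have := w.E_neg_half
  have := w.E_half_lt
  have := w.fix_pos
  have := w.fix_lt
  rw [hm, int_eq_zero_of_abs_lt_one (m := m) (by linarith) (by linarith)]; simp

theorem abs_eq_fix {z : ℝ} (h : w.E z = z) (hz : |z| ≤ 1 / 2) : |z| = w.fix := by
  have h1 := (w.exists_E_eq_add_int_iff z).1 ⟨0, by simpa using h⟩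
  have h2 := w.cos_fix'
  have hp := w.half_lt_p
  have hpi := Real.pi_pos
  have h3 : Real.cos (2 * (Real.pi * |z|)) = Real.cos (2 * (Real.pi * w.fix)) := by
    have : Real.cos (2 * (Real.pi * |z|)) = Real.cos (2 * (Real.pi * z)) := by
      rw [← Real.cos_abs (2 * (Real.pi * z)), abs_mul, abs_mul, abs_of_pos hpi]; norm_num
    rw [this]
    apply mul_left_cancel₀ (by linarith : (2 * w.p) ≠ 0)
    rw [h1, h2]
  have h4 := Real.injOn_cos ⟨by positivity, by nlinarith⟩
    ⟨by have := w.fix_pos; positivity, by nlinarith [w.fix_lt]⟩ h3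
  have h5 := mul_left_cancel₀ two_ne_zero h4
  exact mul_left_cancel₀ hpi.ne' h5

/-- Otherwise the intermediate value theorem, starting from E(0) > 0, would give a fixed point
strictly between the two known ones. -/
theorem lt_E {z : ℝ} (hz : z ∈ Set.Ioo (-w.fix) w.fix) : z < w.E z := by
  by_contra hcon
  obtain ⟨y, hy, hy'⟩ := isPreconnected_Ioo.intermediate_value₂ (s := Set.Ioo (-w.fix) w.fix) (a := z)
    (b := 0) hz ⟨by linarith [w.fix_pos], w.fix_pos⟩ (deg1_continuous w.E).continuousOn
    continuous_id.continuousOn (not_lt.1 hcon) w.E_zero_pos.le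
  have h1 : |y| < w.fix := abs_lt.2 hy
  have := w.abs_eq_fix hy' (by linarith [w.fix_lt])
  linarith

theorem E_lt {z : ℝ} (hz : z ∈ Set.Ioc w.fix (1 / 2)) : w.E z < z := by
  by_contra hcon
  obtain ⟨y, hy, hy'⟩ := isPreconnected_Ioc.intermediate_value₂ (s := Set.Ioc w.fix (1 / 2))
    (a := 1 / 2) (b := z) ⟨by linarith [w.fix_lt], le_rfl⟩ hz (deg1_continuous w.E).continuousOn
    continuous_id.continuousOn w.E_half_lt.le (not_lt.1 hcon)
  have h0 : 0 < y := w.fix_pos.trans hy.1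
  have h1 := w.abs_eq_fix hy' (by rw [abs_of_pos h0]; exact hy.2)
  rw [abs_of_pos h0] at h1
  linarith [hy.1]

theorem E_zpow_mem {z : ℝ} (hz : z ∈ Set.Ioo (-w.fix) w.fix) (j : ℤ) :
    (w.E ^ j) z ∈ Set.Ioo (-w.fix) w.fix := by
  have h := deg1_strictMono (w.E ^ j)
  have h1 := h hz.1
  have h2 := h hz.2
  rw [deg1_zpow_apply_eq w.E_neg_fix] at h1
  rw [deg1_zpow_apply_eq w.E_fix] at h2
  exact ⟨h1, h2⟩

theorem E_pow_mem {z : ℝ} (hz : z ∈ Set.Ioo (-w.fix) w.fix) (j : ℕ) :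
    (w.E ^ j) z ∈ Set.Ioo (-w.fix) w.fix := by
  simpa using w.E_zpow_mem hz j

theorem lt_E_pow {z : ℝ} (hz : z ∈ Set.Ioo (-w.fix) w.fix) {j : ℕ} (hj : j ≠ 0) : z < (w.E ^ j) z := by
  obtain ⟨j, rfl⟩ := Nat.exists_eq_succ_of_ne_zero hj
  clear hj
  rw [Nat.succ_eq_add_one]
  induction j with
  | zero => simpa using w.lt_E hz
  | succ j ih =>
    rw [pow_succ', deg1_mul_apply]
    exact ih.trans (w.lt_E (w.E_pow_mem hz _))

theorem zero_mem_Ioo_fix : (0 : ℝ) ∈ Set.Ioo (-w.fix) w.fix := ⟨by linarith [w.fix_pos], w.fix_pos⟩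

theorem exists_lt_E_pow {a b : ℝ} (ha : a ∈ Set.Ioo (-w.fix) w.fix) (hb : b < w.fix) :
    ∃ j : ℕ, b < (w.E ^ j) a :=
  exists_lt_pow_apply w.E fun _ hz => w.lt_E ⟨ha.1.trans_le hz.1, hz.2.trans_lt hb⟩

/-- E⁻¹ pushes points right of the attracting fixed point past 1/2 in finitely many steps; E then
brings 1/2 back below z. -/
theorem exists_E_pow_half_lt {z : ℝ} (hz : w.fix < z) : ∃ j : ℕ, (w.E ^ j) (1 / 2) < z := by
  obtain ⟨m, hm⟩ := exists_lt_pow_apply (w.E⁻¹) (a := z) (b := 1 / 2) fun y hy => by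
    have h1 := w.E_lt ⟨hz.trans_le hy.1, hy.2⟩
    have h2 := deg1_strictMono w.E⁻¹ h1
    rwa [CircleDeg1Lift.units_inv_apply_apply] at h2
  refine ⟨m, ?_⟩
  have h3 := deg1_strictMono (w.E ^ m) hm
  rwa [← deg1_mul_apply, inv_pow, mul_inv_cancel, deg1_one_apply] at h3

/-- The points of the orbit of `0` between the fixed points next to `0` are the obvious ones. -/
theorem exists_eq_e_zpow {g : B3} (h : w.rep₀ g 0 ∈ Set.Ioo (-w.fix) w.fix) :
    ∃ i : ℤ, g = B3.e ^ i := by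
  obtain ⟨j, hj⟩ := w.exists_lt_E_pow h (b := 0) w.fix_pos
  obtain ⟨m, hm⟩ := w.exists_lt_E_pow w.zero_mem_Ioo_fix (w.E_pow_mem h j).2
  have h1 : w.rep₀ (B3.e ^ j * g) 0 = (w.E ^ j) (w.rep₀ g 0) := by
    rw [map_mul, deg1_mul_apply, map_pow, rep₀_e]
  obtain ⟨i, -, hi⟩ := w.exists_eq_e_pow (h1 ▸ hj.le) (h1 ▸ hm)
  refine ⟨-j + i, ?_⟩
  rw [_root_.zpow_add, _root_.zpow_neg, zpow_natCast, zpow_natCast, ← hi, inv_mul_cancel_left]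

theorem proj_mem_zpowers {g : B3} (h : w.rep n g 0 ∈ Set.Ioo (-w.fix) w.fix) :
    B3.proj g ∈ Subgroup.zpowers ((gα * gβ) ^ covDeg n) := by
  rw [rep_eq_rep₀] at h
  obtain ⟨i, hi⟩ := w.exists_eq_e_zpow h
  have hd := congrArg B3.deg hi
  simp only [B3.deg_mul, B3.deg_zpow, B3.deg_t, B3.deg_e] at hd
  have h1 := congrArg B3.proj hi
  rw [map_mul, map_zpow, map_zpow, B3.proj_t, B3.proj_e, _root_.one_zpow, mul_one] at h1
  rw [h1]
  have h2 : (covDeg n : ℤ) ∣ i := by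
    rw [Int.natCast_natAbs, abs_dvd]
    exact ⟨-B3.deg g, by linarith⟩
  obtain ⟨l, rfl⟩ := h2
  exact ⟨l, by simp only [_root_.zpow_mul, zpow_natCast]⟩

/-- If g moved 0 to the fixed point, a conjugate of e would fix 0 and so be trivial, yet its degree
is -1. -/
theorem fix_notMem_orb₀ : w.fix ∉ w.orb₀ := by
  rintro ⟨g, hg⟩
  simp only at hg
  have h1 : w.rep₀ (g⁻¹ * B3.e * g) 0 = (0 : ℤ) := by
    rw [map_mul, map_mul, deg1_mul_apply, deg1_mul_apply, hg, rep₀_e, E_fix, ← hg, ← deg1_mul_apply,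
      ← map_mul, inv_mul_cancel, map_one, deg1_one_apply, Int.cast_zero]
  have h2 := congrArg B3.deg (w.eq_t_zpow_of_rep₀ h1)
  simp at h2

/-! ### The linear part -/

theorem proj_least : B3.proj (least n) = (gα * gβ) ^ covDeg n := by
  rw [least, map_mul, map_zpow, map_zpow, B3.proj_t, B3.proj_e, _root_.one_zpow, mul_one,
    Int.abs_eq_natAbs, zpow_natCast]

theorem srep_least_zpow (i : ℤ) (θ : ℝ) :
    w.srep n (least n ^ i) θ = (w.E ^ (covDeg n * i : ℤ)) (covDeg n * θ) / covDeg n := by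
  rw [srep_apply, map_zpow, rep_least, _root_.zpow_mul, zpow_natCast]

theorem coe_mem_globalFix {z : ℝ} (h : w.E z = z) :
    ((z / covDeg n : ℝ) : UnitAddCircle) ∈
      globalFix (w.circRep n) (Subgroup.zpowers ((gα * gβ) ^ covDeg n)) := by
  rintro _ ⟨i, rfl⟩
  simp only
  rw [← proj_least, ← map_zpow, circRep_proj_coe, srep_least_zpow,
    mul_div_cancel₀ _ (covDeg_pos n).ne', deg1_zpow_apply_eq h]

theorem coe_notMem_globalFix {z : ℝ} (h : z ∈ Set.Ioo (-w.fix) w.fix) :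
    ((z / covDeg n : ℝ) : UnitAddCircle) ∉
      globalFix (w.circRep n) (Subgroup.zpowers ((gα * gβ) ^ covDeg n)) := by
  intro hfix
  have h1 := hfix _ (Subgroup.mem_zpowers _)
  have hK := covDeg_pos n
  have hK1 : (1 : ℝ) ≤ covDeg n := by exact_mod_cast NeZero.one_le (n := covDeg n)
  have h2 := w.srep_least_zpow n 1 (z / covDeg n)
  rw [_root_.zpow_one, mul_one, zpow_natCast, mul_div_cancel₀ _ hK.ne'] at h2
  rw [← proj_least, circRep_proj_coe, h2, eq_comm, coe_eq_coe_iff] at h1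
  obtain ⟨m, hm⟩ := h1
  have h3 := w.E_pow_mem h (covDeg n)
  have h4 := w.fix_lt
  have h5 : (w.E ^ covDeg n) z = z + covDeg n * m := by field_simp at hm; linarith
  have h6 := w.lt_E_pow h (NeZero.ne (covDeg n))
  have h7 : m = 0 := by
    apply int_eq_zero_of_abs_lt_one
    · by_contra hcon
      rw [not_lt] at hcon
      nlinarith [h3.1, h3.2, h.1, h.2]
    · by_contra hcon
      rw [not_lt] at hcon
      nlinarith [h3.1, h3.2, h.1, h.2]
  rw [h7, Int.cast_zero, mul_zero, add_zero] at h5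
  linarith

theorem kCover_zero (K : ℕ) : kCover K ((0 : ℝ) : UnitAddCircle) = basePt := by
  rw [kCover_coe, mul_zero, tanPt_zero]

/-- The component of the base point is the arc between the rescaled fixed points ±`fix`: the end
points are fixed and no interior point is. Its orbit points come from powers of e, and the degree
leaves only multiples of the covering degree as exponents. -/
theorem isConvex_zpowers : (w.circOrd n).IsConvex (Subgroup.zpowers ((gα * gβ) ^ covDeg n)) := by
  have hK := covDeg_pos n
  have hK1 : (1 : ℝ) ≤ covDeg n := by exact_mod_cast NeZero.one_le (n := covDeg n)
  have hfix0 := w.fix_pos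
  have hfix1 := w.fix_lt
  set L := Subgroup.zpowers ((gα * gβ) ^ covDeg n) with hL
  set Fx := globalFix (w.circRep n) L with hFx
  refine Or.inr ⟨w.circRep n, ((0 : ℝ) : UnitAddCircle),
    w.isDynamicalRealization_circRep n (kCover_zero _), ⟨_, w.coe_mem_globalFix n w.E_fix⟩, ?_⟩
  have hdiv : ∀ z : ℝ, (covDeg n : ℝ) * (z / covDeg n) = z := fun z => mul_div_cancel₀ _ hK.ne'
  have h0 : (0 : ℝ) ∈ Set.Ioo (-w.fix / covDeg n) (w.fix / covDeg n) :=
    ⟨by rw [neg_div]; linarith [div_pos hfix0 hK], div_pos hfix0 hK⟩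
  have hmem : ∀ θ : ℝ, θ ∈ Set.Ioo (-w.fix / covDeg n) (w.fix / covDeg n) ↔
      covDeg n * θ ∈ Set.Ioo (-w.fix) w.fix := fun θ => by
    rw [Set.mem_Ioo, Set.mem_Ioo, div_lt_iff₀' hK, lt_div_iff₀' hK]
  have hnot : ∀ θ ∈ Set.Ioo (-w.fix / covDeg n) (w.fix / covDeg n), (θ : UnitAddCircle) ∈ Fxᶜ :=
    fun θ hθ => by
      have := w.coe_notMem_globalFix n ((hmem θ).1 hθ)
      rwa [mul_div_cancel_left₀ _ hK.ne'] at this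
  have harc : (fun a : ℝ => (a : UnitAddCircle)) '' Set.Ioo (-w.fix / covDeg n) (w.fix / covDeg n) ⊆
      connectedComponentIn Fxᶜ ((0 : ℝ) : UnitAddCircle) :=
    (isPreconnected_arc _ _).subset_connectedComponentIn ⟨0, h0, rfl⟩ (by
      rintro _ ⟨θ, hθ, rfl⟩; exact hnot θ hθ)
  have hC : connectedComponentIn Fxᶜ ((0 : ℝ) : UnitAddCircle) ⊆
      (fun a : ℝ => (a : UnitAddCircle)) '' Set.Ioo (-w.fix / covDeg n) (w.fix / covDeg n) := by
    refine isPreconnected_connectedComponentIn.subset_arc (c := 0) ?_ ?_ ?_ h0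
      (mem_connectedComponentIn (hnot 0 h0))
    · have : w.fix / covDeg n ≤ w.fix := div_le_self hfix0.le hK1
      rw [neg_div]; linarith
    · exact fun h => connectedComponentIn_subset _ _ h (w.coe_mem_globalFix n w.E_neg_fix)
    · exact fun h => connectedComponentIn_subset _ _ h (w.coe_mem_globalFix n w.E_fix)
  apply Set.Subset.antisymm
  · rintro _ ⟨hx, hx'⟩
    obtain ⟨θ, hθ, rfl⟩ := hC hx'
    obtain ⟨g, hg⟩ := (w.coe_mem_orbit_iff n θ).1 hx
    simp only at hg
    refine ⟨B3.proj g, w.proj_mem_zpowers n (hg ▸ (hmem θ).1 hθ), ?_⟩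
    rw [circRep_proj_coe, srep_zero, hg, mul_div_cancel_left₀ _ hK.ne']
  · rintro _ ⟨g, hg, rfl⟩
    refine ⟨⟨g, trivial, rfl⟩, harc ?_⟩
    obtain ⟨i, rfl⟩ := hg
    simp only
    rw [← proj_least, ← map_zpow, circRep_proj_coe, srep_least_zpow, mul_zero]
    exact ⟨_, (hmem _).2 (by rw [hdiv]; exact w.E_zpow_mem w.zero_mem_Ioo_fix _), rfl⟩

end FarPoint

/-! ### Upper bound for convex subgroups -/

/-- A connected subset of the circle that contains two points and avoids a third one contains an arc
between the two points. -/
theorem IsPreconnected.arc_subset {S : Set UnitAddCircle} (hS : IsPreconnected S) {a b : ℝ}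
    (hab : a < b) (hb1 : b < a + 1) (ha : (a : UnitAddCircle) ∈ S) (hb : (b : UnitAddCircle) ∈ S)
    {f : UnitAddCircle} (hf : f ∉ S) :
    (∀ c ∈ Set.Ioo a b, (c : UnitAddCircle) ∈ S) ∨
      ∀ c ∈ Set.Ioo b (a + 1), (c : UnitAddCircle) ∈ S := by
  obtain ⟨φ, hφ, rfl⟩ := exists_coe_Ico a f
  have h1 : φ ≠ a := by rintro rfl; exact hf ha
  have h2 : φ ≠ b := by rintro rfl; exact hf hb
  have hφa : a < φ := lt_of_le_of_ne hφ.1 h1.symm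
  rcases lt_or_gt_of_ne h2 with h | h
  · refine Or.inr fun c hc => by_contra fun hcS => ?_
    obtain ⟨d, hd, e⟩ := hS.subset_arc (a := φ) (b := c) (c := b) (by linarith [hc.2]) hf hcS
      ⟨h, hc.1⟩ hb ha
    have := (coe_inj_of_mem (m := a) ⟨by linarith [hd.1], hd.2.trans hc.2⟩ ⟨le_rfl, by linarith⟩).1 e
    linarith [hd.1]
  · refine Or.inl fun c hc => by_contra fun hcS => ?_
    obtain ⟨d, hd, e⟩ := hS.subset_arc (a := c) (b := φ) (c := b) (by linarith [hφ.2, hc.1]) hcS hf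
      ⟨hc.2, h⟩ hb ha
    have := (coe_inj_of_mem (m := a) ⟨by linarith [hd.1, hc.1], hd.2.trans hφ.2⟩
      ⟨le_rfl, by linarith⟩).1 e
    linarith [hd.1, hc.1]

theorem circleSign_coe_eq_one_iff {a b c : ℝ} (hb : b ∈ Set.Ico a (a + 1))
    (hc : c ∈ Set.Ico a (a + 1)) : circleSign a b c = 1 ↔ a < b ∧ b < c := by
  have h := circleSign_coe (m := a) ⟨le_rfl, by linarith⟩ hb hc
  have h1 : circleSign (a : UnitAddCircle) b c = 1 ↔ (circleSign (a : UnitAddCircle) b c : ℤ) = 1 := by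
    cases circleSign (a : UnitAddCircle) b c <;> simp
  rw [h1, h]
  rcases hb.1.eq_or_lt with e1 | e1
  · subst e1; simp
  · rcases lt_trichotomy b c with e2 | e2 | e2
    · simp [sign_pos, sub_pos.2, e1, e2, e1.trans e2]
    · subst e2; simp
    · rw [sign_pos (sub_pos.2 e1), sign_neg (sub_neg.2 e2)]
      simp [e2.not_gt]
      rcases hc.1.eq_or_lt with e3 | e3
      · subst e3; simp
      · rw [sign_pos (sub_pos.2 e3)]; simp

theorem circleSign_swap (x y z : UnitAddCircle) : circleSign x z y = -circleSign x y z := by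
  obtain ⟨a, ha, b, hb, c, hc, rfl, rfl, rfl⟩ := exists_coe_three x y z
  have h1 := circleSign_coe ha hb hc
  have h2 := circleSign_coe ha hc hb
  have h3 : (SignType.sign (b - c) : ℤ) = -(SignType.sign (c - b) : ℤ) := by
    rw [← neg_sub c b, Left.sign_neg]; simp
  have h4 : (circleSign (a : UnitAddCircle) c b : ℤ) = -circleSign (a : UnitAddCircle) b c := by
    rw [h1, h2, h3]; ring
  revert h4
  cases circleSign (a : UnitAddCircle) b c <;> cases circleSign (a : UnitAddCircle) c b <;> simp

section
variable {G : Type*} [Group G] {c : CO G} {H : Subgroup G}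

theorem eq_of_free {ρ : G →* HomeoPlus} {y : UnitAddCircle} (h : ∀ g, (ρ g).1 y = y → g = 1)
    {g g' : G} (e : (ρ g).1 y = (ρ g').1 y) : g = g' := by
  have : (ρ (g'⁻¹ * g)).1 y = y := by
    rw [map_mul, map_inv]
    change (ρ g').1.symm ((ρ g).1 y) = y
    rw [e]; exact (ρ g').1.symm_apply_apply y
  exact (inv_mul_eq_one.1 (h _ this)).symm

/-- A convex subgroup contains all elements on one side of each of its elements. -/
theorem CO.IsConvex.mem_or_mem (h : c.IsConvex H) {g : G} (hg : g ∈ H) (hg1 : g ≠ 1) :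
    (∀ k, c.1 1 k g = 1 → k ∈ H) ∨ ∀ k, c.1 1 g k = 1 → k ∈ H := by
  rcases h with rfl | ⟨ρ, y, ⟨⟨hfree, -⟩, hc⟩, ⟨f, hf⟩, hconv⟩
  · exact (hg1 (Subgroup.mem_bot.1 hg)).elim
  obtain ⟨a, rfl⟩ := QuotientAddGroup.mk_surjective y
  change ∀ g, (ρ g).1 (a : UnitAddCircle) = (a : UnitAddCircle) → g = 1 at hfree
  change ∀ g₁ g₂ g₃, c.1 g₁ g₂ g₃ = circleSign ((ρ g₁).1 (a : UnitAddCircle))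
    ((ρ g₂).1 (a : UnitAddCircle)) ((ρ g₃).1 (a : UnitAddCircle)) at hc
  change subgroupOrbit ρ (a : UnitAddCircle) ⊤ ∩ connectedComponentIn (globalFix ρ H)ᶜ
    (a : UnitAddCircle) = subgroupOrbit ρ (a : UnitAddCircle) H at hconv
  set S := connectedComponentIn (globalFix ρ H)ᶜ (a : UnitAddCircle)
  have hone : ∀ z, (ρ 1).1 z = z := fun z => by rw [map_one]; rfl
  have hHS : ∀ k ∈ H, (ρ k).1 (a : UnitAddCircle) ∈ S := fun k hk => by
    have : (ρ k).1 (a : UnitAddCircle) ∈ subgroupOrbit ρ (a : UnitAddCircle) H := ⟨k, hk, rfl⟩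
    rw [← hconv] at this
    exact this.2
  have hSH : ∀ k, (ρ k).1 (a : UnitAddCircle) ∈ S → k ∈ H := fun k hk => by
    have : (ρ k).1 (a : UnitAddCircle) ∈ subgroupOrbit ρ (a : UnitAddCircle) H := by
      rw [← hconv]; exact ⟨⟨k, trivial, rfl⟩, hk⟩
    obtain ⟨k', hk', e⟩ := this
    rwa [eq_of_free hfree e]
  have ha : (a : UnitAddCircle) ∈ S := by simpa [hone] using hHS 1 H.one_mem
  have hfS : f ∉ S := fun h => connectedComponentIn_subset _ _ h hf
  obtain ⟨b, hb, hbe⟩ := exists_coe_Ico a ((ρ g).1 (a : UnitAddCircle))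
  have hab : a < b := lt_of_le_of_ne hb.1 (by
    rintro rfl; exact hg1 (hfree g hbe.symm))
  have hbS : (b : UnitAddCircle) ∈ S := hbe ▸ hHS g hg
  refine (isPreconnected_connectedComponentIn.arc_subset hab hb.2 ha hbS hfS).imp ?_ ?_ <;>
    intro harc k hk <;> apply hSH <;>
    obtain ⟨d, hd, hde⟩ := exists_coe_Ico a ((ρ k).1 (a : UnitAddCircle)) <;>
    rw [hc, hone, ← hbe, ← hde] at hk <;> rw [← hde] <;> apply harc
  · exact (circleSign_coe_eq_one_iff hd hb).1 hk
  · exact ⟨((circleSign_coe_eq_one_iff hb hd).1 hk).2, hd.2⟩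

/-- An element of a convex subgroup or its inverse has all smaller elements in the subgroup. -/
theorem CO.IsConvex.exists_bound (h : c.IsConvex H) {g : G} (hg : g ∈ H) (hg1 : g ≠ 1) :
    (∀ k, c.1 1 k g = 1 → k ∈ H) ∨ ∀ k, c.1 1 k g⁻¹ = 1 → k ∈ H := by
  refine (h.mem_or_mem hg hg1).imp id fun h2 k hk => ?_
  -- Translating (1, k, g⁻¹) by g gives (g, gk, 1), and the cocycle identity permutes it cyclically.
  have h3 : c.1 1 g (g * k) = 1 := by
    have e := c.2.left_inv g 1 k g⁻¹
    rw [mul_one, mul_inv_cancel, hk] at e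
    have e2 := c.2.cocycle 1 g (g * k) 1
    rw [e, (c.2.eq_zero_iff 1 (g * k) 1).2 (Or.inr (Or.inr rfl)),
      (c.2.eq_zero_iff 1 g 1).2 (Or.inr (Or.inr rfl))] at e2
    revert e2
    cases c.1 1 g (g * k) <;> simp
  exact (H.mul_mem_cancel_left hg).1 (h2 _ h3)

/-- A convex subgroup contains no involution. -/
theorem CO.IsConvex.eq_one_of_mul_self (h : c.IsConvex H) {g : G} (hg : g ∈ H) (h2 : g * g = 1) :
    g = 1 := by
  rcases h with rfl | ⟨ρ, y, ⟨⟨hfree, -⟩, -⟩, ⟨f, hf⟩, -⟩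
  · exact Subgroup.mem_bot.1 hg
  have hinv : ∀ z, (ρ g).1 ((ρ g).1 z) = z := fun z => by
    change ((ρ g * ρ g) : HomeoPlus).1 z = z
    rw [← map_mul, h2, map_one]; rfl
  by_contra hg1
  -- The involution fixes f and exchanges y with its image, so it would reverse the orientation of
  -- this triple unless two of the points coincide.
  have e := circleSign_map (ρ g) f y ((ρ g).1 y)
  rw [hf g hg, hinv, circleSign_swap] at e
  have e0 : circleSign f y ((ρ g).1 y) = 0 := by
    revert e; cases circleSign f y ((ρ g).1 y) <;> simp
  rcases (circleSign_eq_zero_iff _ _ _).1 e0 with e1 | e1 | e1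
  · exact hg1 (hfree g (by rw [← e1, hf g hg]))
  · exact hg1 (hfree g e1.symm)
  · have e2 := congrArg (ρ g).1 e1
    rw [hinv, hf g hg] at e2
    exact hg1 (hfree g (by rw [← e1, e2]))

end

/-- The sixth power of αβ is a commutator in the images of ef and fe, two words of degree zero that
are available for every n. -/
theorem mul_pow_six {G : Type*} [Group G] {a b : G} (ha : a * a = 1) (hb : b * b * b = 1) :
    (a * b) ^ 6 = (a * b * (a * (b * b))) * (a * (b * b) * (a * b))⁻¹ *
      (a * b * (a * (b * b)))⁻¹ * (a * (b * b) * (a * b)) := by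
  have ha' : a⁻¹ = a := inv_eq_of_mul_eq_one_left ha
  have hb' : b⁻¹ = b * b := inv_eq_of_mul_eq_one_left hb
  have h1 : ∀ z, a * (a * z) = z := fun z => by rw [← mul_assoc, ha, one_mul]
  have h2 : ∀ z, b * (b * (b * z)) = z := fun z => by rw [← mul_assoc b b, ← mul_assoc, hb, one_mul]
  simp only [pow_succ, pow_zero, one_mul, _root_.mul_inv_rev, ha', hb', mul_assoc, h1, h2]

namespace FarPoint
variable (w : FarPoint) (n : ℤ)

theorem exists_lift (h : GBar) : ∃ g, B3.proj g = h ∧ w.srep n g 0 ∈ Set.Ico (0 : ℝ) (0 + 1) := by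
  obtain ⟨θ, hθ, e⟩ := exists_coe_Ico 0 ((w.circRep n h).1 ((0 : ℝ) : UnitAddCircle))
  have hK := covDeg_pos n
  obtain ⟨g, hg⟩ := (w.coe_mem_orbit_iff n θ).1 ⟨h, trivial, e⟩
  simp only at hg
  have h1 : w.srep n g 0 = θ := by rw [srep_zero, hg, mul_div_cancel_left₀ _ hK.ne']
  refine ⟨g, eq_of_free (w.circRep_free n) ?_, h1 ▸ hθ⟩
  rw [circRep_proj_coe, h1, e]

theorem rep₀_zero_mem {u : B3} (hu : u ∈ B3.posMonoid) : w.rep₀ u 0 ∈ Set.Ico (0 : ℝ) (1 / 2) :=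
  ⟨(w.rep₀_posMonoid_mem hu ⟨le_rfl, by norm_num⟩).1,
    (deg1_strictMono (w.rep₀ u) (by norm_num : (0 : ℝ) < 1 / 2)).trans_le
      (w.rep₀_posMonoid_mem hu ⟨by norm_num, le_rfl⟩).2⟩

theorem eq_fix_lt_of_notMem {g : B3} (h : B3.proj g ∉ Subgroup.zpowers ((gα * gβ) ^ covDeg n))
    (h0 : 0 ≤ w.rep n g 0) : w.fix < w.rep n g 0 := by
  rcases lt_trichotomy (w.rep n g 0) w.fix with h1 | h1 | h1
  · exact (h (w.proj_mem_zpowers n ⟨by linarith [w.fix_pos], h1⟩)).elim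
  · exact (w.fix_notMem_orb₀ (h1 ▸ w.orb_subset n ⟨g, rfl⟩)).elim
  · exact h1

/-- The orbit point of h lies beyond the attracting fixed point, so the arc up to it contains E^m[0,
1/2] for some large m, and H contains the images of all positive words of degree divisible by 6n +
1. These generate the whole group, involution included. -/
theorem not_forall_mem {H : Subgroup GBar} (hH : (w.circOrd n).IsConvex H) {h : GBar}
    (hL : h ∉ Subgroup.zpowers ((gα * gβ) ^ covDeg n)) :
    ¬ ∀ k, (w.circOrd n).1 1 k h = 1 → k ∈ H := by
  intro hall
  have hK := covDeg_pos n
  obtain ⟨g, rfl, hg⟩ := w.exists_lift n h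
  set z := w.rep n g 0 with hz
  have hsz : w.srep n g 0 = z / covDeg n := w.srep_zero n g
  have hz0 : 0 ≤ z := by
    have := hg.1
    rw [hsz] at this
    by_contra hcon
    exact absurd this (not_le.2 (div_neg_of_neg_of_pos (not_le.1 hcon) hK))
  have hfz : w.fix < z := w.eq_fix_lt_of_notMem n hL hz0
  have hmem : ∀ k, 0 < w.rep n k 0 → w.rep n k 0 < z → B3.proj k ∈ H := fun k h0 h1 => by
    apply hall
    rw [circOrd_apply]
    have e0 : 0 < w.srep n k 0 := by rw [srep_zero]; exact div_pos h0 hK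
    have e1 : w.srep n k 0 < w.srep n g 0 := by
      rw [srep_zero, srep_zero]; exact (div_lt_div_iff_of_pos_right hK).2 h1
    exact (circleSign_coe_eq_one_iff ⟨e0.le, e1.trans hg.2⟩ hg).2 ⟨e0, e1⟩
  obtain ⟨j, hj⟩ := w.exists_E_pow_half_lt hfz
  -- A nonzero multiple of the covering degree, so that e^m satisfies the divisibility condition,
  -- and at least j, so that E^m(1/2) stays before z.
  set m := covDeg n * (j + 1) with hm
  have hjm : j ≤ m := by
    have : 1 ≤ covDeg n := NeZero.one_le
    nlinarith
  have hm0 : m ≠ 0 := mul_ne_zero (NeZero.ne _) (by omega)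
  have hmz : (w.E ^ m) (1 / 2) < z := by
    obtain ⟨i, hi⟩ := Nat.exists_eq_add_of_le hjm
    have h1 := (w.rep₀_posMonoid_mem (pow_mem B3.e_mem i) (θ := 1 / 2) ⟨by norm_num, le_rfl⟩).2
    rw [map_pow, rep₀_e] at h1
    rw [hi, pow_add, deg1_mul_apply]
    exact ((deg1_strictMono _).monotone h1).trans_lt hj
  have hdvd : (6 * n + 1 : ℤ) ∣ m := by
    rw [hm, Nat.cast_mul]
    exact Dvd.dvd.mul_right (by rw [Int.natCast_natAbs]; exact (dvd_abs _ _).2 dvd_rfl) _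
  have hpos : ∀ u ∈ B3.posMonoid, (6 * n + 1) ∣ B3.deg u → (gα * gβ) ^ m * B3.proj u ∈ H :=
    fun u hu hd => by
      have hd' : (6 * n + 1) ∣ B3.deg (B3.e ^ m * u) := by
        rw [B3.deg_mul, B3.deg_pow, B3.deg_e]
        exact dvd_add (Dvd.dvd.mul_right hdvd _) hd
      obtain ⟨l, hl⟩ := w.exists_rep_eq n hd'
      have h1 : w.rep n (B3.e ^ m * u * B3.t ^ l) 0 = (w.E ^ m) (w.rep₀ u 0) := by
        rw [hl, map_mul, deg1_mul_apply, map_pow, rep₀_e]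
      have hu0 := w.rep₀_zero_mem hu
      have h2 := hmem (B3.e ^ m * u * B3.t ^ l)
        (by rw [h1]
            exact (w.E_pow_zero_pos hm0).trans_le ((deg1_strictMono _).monotone hu0.1))
        (by rw [h1]
            exact (deg1_strictMono (w.E ^ m) hu0.2).trans hmz)
      rw [map_mul B3.proj, map_mul B3.proj, map_zpow, B3.proj_t, _root_.one_zpow, mul_one, map_pow,
        B3.proj_e] at h2
      exact h2
  have h1 : (gα * gβ) ^ m ∈ H := by
    simpa using hpos 1 (one_mem _) (by simp)
  have hmem' : ∀ u ∈ B3.posMonoid, (6 * n + 1) ∣ B3.deg u → B3.proj u ∈ H := fun u hu hd =>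
    (H.mul_mem_cancel_left h1).1 (hpos u hu hd)
  have hp : gα * gβ * (gα * (gβ * gβ)) ∈ H := by
    have := hmem' (B3.e * B3.f) (mul_mem B3.e_mem B3.f_mem) (by simp)
    rwa [map_mul, B3.proj_e, B3.proj_f, pow_two gβ] at this
  have hq : gα * (gβ * gβ) * (gα * gβ) ∈ H := by
    have := hmem' (B3.f * B3.e) (mul_mem B3.f_mem B3.e_mem) (by simp)
    rwa [map_mul, B3.proj_e, B3.proj_f, pow_two gβ] at this
  have h6 : (gα * gβ) ^ 6 ∈ H := by
    rw [mul_pow_six gα_mul_self gβ_mul_mul_self]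
    exact H.mul_mem (H.mul_mem (H.mul_mem hp (H.inv_mem hq)) (H.inv_mem hp)) hq
  have hk : (gα * gβ) ^ (6 * n + 1) ∈ H := by
    have h2 : (gα * gβ) ^ covDeg n ∈ H := by
      have := hmem' (B3.e ^ covDeg n) (pow_mem B3.e_mem _) (by
        rw [B3.deg_pow, B3.deg_e, Int.natCast_natAbs]
        exact Dvd.dvd.mul_right ((dvd_abs _ _).2 dvd_rfl) _)
      rwa [map_pow, B3.proj_e] at this
    have h3 := H.zpow_mem h2 (6 * n + 1).sign
    rwa [← zpow_natCast (gα * gβ), ← _root_.zpow_mul, mul_comm, sign_mul_covDeg] at h3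
  -- The exponents 6n + 1 and 6 are coprime.
  have hαβ : gα * gβ ∈ H := by
    have h2 := H.mul_mem hk (H.zpow_mem h6 (-n))
    have h3 : (gα * gβ) ^ (6 * n + 1) * ((gα * gβ) ^ 6) ^ (-n) = gα * gβ := by
      rw [← zpow_natCast (gα * gβ) 6, ← _root_.zpow_mul, ← _root_.zpow_add]
      have : (6 * n + 1 + ((6 : ℕ) : ℤ) * -n) = 1 := by push_cast; ring
      rw [this, _root_.zpow_one]
    rwa [h3] at h2
  have hαββ : gα * (gβ * gβ) ∈ H := (H.mul_mem_cancel_left hαβ).1 hp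
  have hβ : gβ ∈ H := by
    have := H.mul_mem (H.inv_mem hαβ) hαββ
    have e : (gα * gβ)⁻¹ * (gα * (gβ * gβ)) = gβ := by group
    rwa [e] at this
  have hα : gα ∈ H := (H.mul_mem_cancel_right hβ).1 hαβ
  exact gα_ne_one (hH.eq_one_of_mul_self hα gα_mul_self)

theorem isLinearPart_zpowers :
    (w.circOrd n).IsLinearPart (Subgroup.zpowers ((gα * gβ) ^ covDeg n)) := by
  refine ⟨w.isConvex_zpowers n, fun H hH h hh => by_contra fun hL => ?_⟩
  have h1 : h ≠ 1 := by rintro rfl; exact hL (one_mem _)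
  rcases hH.exists_bound hh h1 with h2 | h2
  · exact w.not_forall_mem n hH hL h2
  · exact w.not_forall_mem n hH (fun h3 => hL (by simpa using inv_mem h3)) h2

end FarPoint

/-! ### Automorphic images -/

section
variable {G : Type*} [Group G] {c : CO G}

theorem subgroupOrbit_comp (ρ : G →* HomeoPlus) (y : UnitAddCircle) (φ : G ≃* G) (H : Subgroup G) :
    subgroupOrbit (ρ.comp (φ : G →* G)) y (H.comap (φ : G →* G)) = subgroupOrbit ρ y H := by
  ext x
  constructor
  · rintro ⟨g, hg, rfl⟩; exact ⟨φ g, hg, rfl⟩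
  · rintro ⟨g, hg, rfl⟩
    exact ⟨φ.symm g, by simpa using hg, by simp⟩

theorem globalFix_comp (ρ : G →* HomeoPlus) (φ : G ≃* G) (H : Subgroup G) :
    globalFix (ρ.comp (φ : G →* G)) (H.comap (φ : G →* G)) = globalFix ρ H := by
  ext x
  constructor
  · intro h g hg
    simpa using h (φ.symm g) (by simpa using hg)
  · intro h g hg
    exact h (φ g) hg

theorem IsDynamicalRealization.pullback {ρ : G →* HomeoPlus} {y : UnitAddCircle} (φ : G ≃* G)
    (h : IsDynamicalRealization c ρ y) :
    IsDynamicalRealization (c.pullback φ) (ρ.comp (φ : G →* G)) y := by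
  obtain ⟨⟨h1, h2⟩, h3⟩ := h
  have e := subgroupOrbit_comp ρ y φ ⊤
  rw [Subgroup.comap_top] at e
  refine ⟨⟨fun g hg => ?_, ?_⟩, fun _ _ _ => h3 _ _ _⟩
  · exact φ.map_eq_one_iff.1 (h1 (φ g) hg)
  · rw [e]; exact h2

theorem CO.IsConvex.pullback {H : Subgroup G} (φ : G ≃* G) (h : c.IsConvex H) :
    (c.pullback φ).IsConvex (H.comap (φ : G →* G)) := by
  rcases h with rfl | ⟨ρ, y, h1, h2, h3⟩
  · left
    ext g
    simp
  · refine Or.inr ⟨ρ.comp (φ : G →* G), y, h1.pullback φ, by rwa [globalFix_comp], ?_⟩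
    have e := subgroupOrbit_comp ρ y φ ⊤
    rw [Subgroup.comap_top] at e
    rw [globalFix_comp, e, subgroupOrbit_comp, h3]

theorem CO.pullback_symm (φ : G ≃* G) : (c.pullback φ).pullback φ.symm = c := by
  apply Subtype.ext
  funext a b d
  simp [CO.pullback]

theorem CO.IsLinearPart.pullback {L : Subgroup G} (φ : G ≃* G) (h : c.IsLinearPart L) :
    (c.pullback φ).IsLinearPart (L.comap (φ : G →* G)) := by
  refine ⟨h.1.pullback φ, fun H hH g hg => ?_⟩
  have h1 := CO.IsConvex.pullback φ.symm hH
  rw [CO.pullback_symm] at h1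
  exact h.2 h1 (show φ g ∈ H.comap (φ.symm : G →* G) by simpa using hg)

/-- Circular orders whose linear parts do not correspond are not automorphic images. -/
theorem CO.ne_pullback {c' : CO G} {L L' : Subgroup G} (h : c.IsLinearPart L)
    (h' : c'.IsLinearPart L') (φ : G ≃* G) (hL : L.map (φ : G →* G) ≠ L') : c ≠ c'.pullback φ := by
  rintro rfl
  apply hL
  rw [h.unique (h'.pullback φ)]
  exact Subgroup.map_comap_eq_self_of_surjective φ.surjective L'

end

/-- The residue class of -1 is reached with 6n + 1 = -k, which is why n ranges over all integers and
the degree is an absolute value. -/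
theorem exists_covDeg {k : ℕ} (hk : k ∈ admissible) : ∃ n : ℤ, FarPoint.covDeg n = k := by
  obtain ⟨-, h⟩ := hk
  rcases h with h | h
  · obtain ⟨n, hn⟩ := h.symm.dvd
    exact ⟨n, by unfold FarPoint.covDeg; omega⟩
  · obtain ⟨n, hn⟩ := h.symm.dvd
    exact ⟨-n, by unfold FarPoint.covDeg; omega⟩

theorem theorem3 :
    -- infinitely many isolated left orders on `B₃`, pairwise not automorphic images
    (∃ lam : ℕ → LO B3, (∀ n, IsIsolatedPoint (lam n)) ∧
      ∀ m n, m ≠ n → ∀ φ : B3 ≃* B3, lam m ≠ (lam n).pullback φ) ∧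
    -- the group `⟨α, β ∣ α² = β³ = e⟩` is `PSL(2, ℤ)`
    (∃ ι : GBar ≃* PSL2 ℤ, ι gα = toPSL2 matα ∧ ι gβ = toPSL2 matβ) ∧
    -- for every point `ω'` of the geodesic through `i` and `ω = (-1 + √-3) / 2`, beyond `ω`
    (∀ ω' : UpperHalfPlane, ω'.re ^ 2 + ω'.im ^ 2 = 1 → ω'.re < -(1 / 2) →
      ∃ ρ : GBar →* PSL2 ℝ,
        ρ gα = hypRotation UpperHalfPlane.I Real.pi ∧
        ρ gβ = hypRotation ω' (2 * Real.pi / 3) ∧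
        IsFuchsian ρ ∧
        ∃ c : admissible → CO GBar,
          (∀ k, IsIsolatedPoint (c k)) ∧
          (∀ k l, k ≠ l → ∀ φ : GBar ≃* GBar, c k ≠ (c l).pullback φ) ∧
          (∀ k : admissible, ∃ ρk : GBar →* HomeoPlus, IsKFoldLift ρ k ρk ∧
            ∀ y : UnitAddCircle, kCover k y = basePt → IsDynamicalRealization (c k) ρk y) ∧
          (∀ k : admissible, (c k).IsLinearPart (Subgroup.zpowers ((gα * gβ) ^ (k : ℕ)))) ∧
          (∀ k l : admissible, k ≠ l → ∀ φ : GBar ≃* GBar,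
            (Subgroup.zpowers ((gα * gβ) ^ (k : ℕ))).map (φ : GBar →* GBar) ≠
              Subgroup.zpowers ((gα * gβ) ^ (l : ℕ)))) := by
  refine ⟨exists_isolated_leftOrders,
    ⟨MulEquiv.ofBijective modularHom ⟨modularHom_injective, modularHom_surjective⟩,
      GBar.lift_α _ _ toPSL2_matα_sq toPSL2_matβ_cube,
      GBar.lift_β _ _ toPSL2_matα_sq toPSL2_matβ_cube⟩, fun ω' h1 h2 => ?_⟩
  let w : FarPoint := ⟨ω', h1, h2⟩
  choose N hN using fun k : admissible => exists_covDeg k.2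
  have hlin : ∀ k : admissible, (w.circOrd (N k)).IsLinearPart
      (Subgroup.zpowers ((gα * gβ) ^ (k : ℕ))) := fun k => by
    have := w.isLinearPart_zpowers (N k)
    rwa [hN] at this
  have hmap : ∀ k l : admissible, k ≠ l → ∀ φ : GBar ≃* GBar,
      (Subgroup.zpowers ((gα * gβ) ^ (k : ℕ))).map (φ : GBar →* GBar) ≠
        Subgroup.zpowers ((gα * gβ) ^ (l : ℕ)) := fun k l hkl φ =>
    map_zpowers_ne k.2.1.ne' l.2.1.ne' (fun h => hkl (Subtype.ext h)) φ
  refine ⟨w.fuchs, w.fuchs_α, w.fuchs_β, w.isFuchsian_fuchs, fun k => w.circOrd (N k),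
    fun k => w.isIsolatedPoint_circOrd (N k), fun k l hkl φ =>
      CO.ne_pullback (hlin k) (hlin l) φ (hmap k l hkl φ), fun k => ?_, hlin, hmap⟩
  refine ⟨w.circRep (N k), ?_, fun y hy => w.isDynamicalRealization_circRep (N k) ?_⟩
  · have := w.isKFoldLift_circRep (N k)
    rwa [hN] at this
  · rwa [hN]

end
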